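/- Let $V\in L^1(\mathbb R)\cap L^\infty(\mathbb R)$ be real-valued, $L>0$, and let $A,B\in\mathbb C^{2\times2}$ satisfy $AB^*=BA^*$ and $\operatorname{rank}(A\mid B)=2$. On $L^2([-L,L])$ let $H_L=-\frac{d^2}{dx^2}$ with domain all $\varphi\in H^2([-L,L])$ such that $$A\begin{pmatrix}\varphi(L)\\ \varphi(-L)\end{pmatrix}=B\begin{pmatrix}-\varphi'(L)\\ \varphi'(-L)\end{pmatrix},$$ and let $H_\infty=-\frac{d^2}{dx^2}$ on $L^2(\mathbb R)$ with domain $H^2(\mathbb R)$. Write $\chi_L$ for the indicator function of $[-L,L]$, and $V=\sqrt{|V|}J\sqrt{|V|}$ with $J$ the multiplication by the sign of $V$ ($J=1$ where $V=0$). For $z\in\mathbb C\setminus\{0\}$ let $\sqrt z$ denote a square root with $\operatorname{Im}\sqrt z\ge0$ (for $z>0$ both roots are allowed and the objects below that are defined through $\sqrt z$ depend on this choice; complex conjugation of $z$ replaces $\sqrt z$ by $-\overline{\sqrt z}$). Define $$K_L(z)=\sqrt{|V|}(z-H_L)^{-1}\sqrt{|V|}J,\qquad K_{\infty,L}(z)=\sqrt{|V|}R_{\infty,L}(z)\sqrt{|V|}J,\qquad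 \Omega_{\infty,L}(z)=(1-K_{\infty,L}(z))^{-1},$$ where $R_{\infty,L}(z)=\chi_L(z-H_\infty)^{-1}\chi_L$ for $z\notin[0,\infty)$ and, for $z>0$, $R_{\infty,L}(z)$ is its boundary value, the integral operator with kernel $\frac{1}{2i\sqrt z}e^{i\sqrt z|x-y|}$ on $[-L,L]$. With $\sigma_x=\begin{pmatrix}0&1\\1&0\end{pmatrix}$ put $$U(z)=(iA-\sqrt zB)^{-1}(iA+\sqrt zB),\quad d_L(z)=e^{2iL\sqrt z},\quad G_L(z)=(g_{jl}(z))_{j,l=1,2}=(e^{2iL\sqrt z}+U(z)\sigma_x)^{-1},$$ $$D_L(z)\varphi=\frac{d_L(z)}{2i\sqrt z}\sum_{j,l=1}^2 g_{jl}(z)\Big(\int_{-L}^{L}\varepsilon_l(-y)\varphi(y)\,dy\Big)\varepsilon_j,\qquad \varepsilon_1(x)=e^{i\sqrt zx},\ \varepsilon_2(x)=e^{-i\sqrt zx}.$$ Let $S_L(z)=\begin{pmatrix}t&r_1\\ r_2&t\end{pmatrix}$ be the scattering matrix of the potential $V\chi_L$: there are solutions $u_\pm$ of $-u''+V\chi_Lu=zu$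 on $\mathbb R$ with $$u_+(x)=\begin{cases}t\,e^{-i\sqrt zx},&x\le-L,\\ e^{-i\sqrt zx}+r_1e^{i\sqrt zx},&x\ge L,\end{cases}\qquad u_-(x)=\begin{cases}e^{i\sqrt zx}+r_2e^{-i\sqrt zx},&x\le-L,\\ t\,e^{i\sqrt zx},&x\ge L,\end{cases}$$ and let $T_L(z)=S_L(z)-1$ be the T-matrix. Let $z\in\mathbb C\setminus\{0\}$ be such that $z\notin\sigma(H_L)$ (automatic if $\operatorname{Im}z\ne0$), $1-K_{\infty,L}(z)$ is invertible (automatic if $z\notin[-\frac14\|V\|_1^2,0]$), and $iA-\sqrt zB$ is invertible (automatic if $\operatorname{Re}\sqrt z\ne0$). Then $\bar z\notin\sigma(H_L)$, $e^{2iL\sqrt z}+U(z)\sigma_x$ is invertible, $S_L(z)$ exists and is unique, $K_L(z)$ and $K_{\infty,L}(z)$ are trace class, and the following hold. 1. $1-K_L(z)=(1-K_{\infty,L}(z))\big(1+\Omega_{\infty,L}(z)\sqrt{|V|}D_L(z)\sqrt{|V|}J\big)$. If $\operatorname{Im}z\neq0$, the operator $\Omega_{\infty,L}(z)\sqrt{|V|}D_L(z)\sqrt{|V|}J$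 has no spectral values in $(-\infty,-1]$. 2. The Fredholm determinants satisfy $$\det(1-K_L(z))=\det(1-K_{\infty,L}(z))\,\det\big(1+d_L(z)T_L(z)G_L(z)\big).$$ Moreover $\det(1-K_L(\bar z))=\overline{\det(1-K_L(z))}$, and likewise for each of the two determinants on the right-hand side. If $\operatorname{Im}z\ne0$, the $2\times2$ matrix $d_L(z)T_L(z)G_L(z)$ has no eigenvalues in $(-\infty,-1]$. 3. $1+d_L(z)T_L(z)G_L(z)=\big(e^{2iL\sqrt z}S_L(z)+U(z)\sigma_x\big)\big(e^{2iL\sqrt z}+U(z)\sigma_x\big)^{-1}$. -/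

import Mathlib

open MeasureTheory Filter Topology
open scoped ENNReal Matrix ComplexConjugate

noncomputable section

namespace FermiGas

/-! ### Trace class operators and Fredholm determinants -/

/-- `A` is trace class (nuclear): `A = ∑ₙ (gₙ, ·) fₙ` with `∑ₙ ‖fₙ‖ ‖gₙ‖ < ∞`. -/
def IsTraceClass {H : Type} [NormedAddCommGroup H] [InnerProductSpace ℂ H]
    (A : H →L[ℂ] H) : Prop :=
  ∃ f g : ℕ → H, Summable (fun n => ‖f n‖ * ‖g n‖) ∧
    ∀ x : H, HasSum (fun n => inner ℂ (g n) x • f n) (A x)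

open scoped Classical in
/-- `d = det T`, the Fredholm determinant of `T = 1 + (trace class)`: in every orthonormal basis
the determinants of the finite sections of `T` converge to `d`. -/
def IsFredholmDet {H : Type} [NormedAddCommGroup H] [InnerProductSpace ℂ H]
    (T : H →L[ℂ] H) (d : ℂ) : Prop :=
  IsTraceClass (T - 1) ∧
    ∀ (ι : Type) (b : HilbertBasis ι ℂ H),
      Tendsto (fun F : Finset ι =>
        (Matrix.of fun i j : F => inner ℂ (b (i : ι)) (T (b (j : ι)))).det) atTop (𝓝 d)

/-! ### Resolvents of unbounded operators -/

/-- The bounded operator `R` is the inverse of `z - T : dom T → H`. -/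
def IsResolventAt {H : Type} [NormedAddCommGroup H] [InnerProductSpace ℂ H]
    (T : H →ₗ.[ℂ] H) (z : ℂ) (R : H →L[ℂ] H) : Prop :=
  (∀ f : H, ∃ h : R f ∈ T.domain, z • R f - T ⟨R f, h⟩ = f) ∧
    ∀ φ : T.domain, R (z • (φ : H) - T φ) = φ

/-- The spectrum of an unbounded operator. -/
def unboundedSpectrum {H : Type} [NormedAddCommGroup H] [InnerProductSpace ℂ H]
    (T : H →ₗ.[ℂ] H) : Set ℂ :=
  {z | ¬ ∃ R : H →L[ℂ] H, IsResolventAt T z R}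

open scoped Classical in
/-- The resolvent `(z - T)⁻¹` (the zero operator if `z` lies in the spectrum). -/
def unboundedResolvent {H : Type} [NormedAddCommGroup H] [InnerProductSpace ℂ H]
    (T : H →ₗ.[ℂ] H) (z : ℂ) : H →L[ℂ] H :=
  if h : ∃ R : H →L[ℂ] H, IsResolventAt T z R then h.choose else 0

/-! ### The free Schrödinger operators on the line and on `[-L, L]` -/

/-- On the interval `s` the function `u` is continuously differentiable with derivative `u'`,
and `u'` is (locally) absolutely continuous with derivative `w` almost everywhere. -/
def HasSecondDerivOn (s : Set ℝ) (u u' w : ℝ → ℂ) : Prop :=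
  ∀ x ∈ s, ∀ y ∈ s,
    IntervalIntegrable u' volume x y ∧ IntervalIntegrable w volume x y ∧
      u y - u x = ∫ t in x..y, u' t ∧ u' y - u' x = ∫ t in x..y, w t

theorem HasSecondDerivOn.zero (s : Set ℝ) : HasSecondDerivOn s 0 0 0 := by
  intro x _ y _
  simp [Pi.zero_def]

theorem HasSecondDerivOn.add {s : Set ℝ} {u₁ u₁' w₁ u₂ u₂' w₂ : ℝ → ℂ}
    (h₁ : HasSecondDerivOn s u₁ u₁' w₁) (h₂ : HasSecondDerivOn s u₂ u₂' w₂) :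
    HasSecondDerivOn s (u₁ + u₂) (u₁' + u₂') (w₁ + w₂) := by
  intro x hx y hy
  obtain ⟨a₁, b₁, c₁, d₁⟩ := h₁ x hx y hy
  obtain ⟨a₂, b₂, c₂, d₂⟩ := h₂ x hx y hy
  refine ⟨a₁.add a₂, b₁.add b₂, ?_, ?_⟩
  · simp only [Pi.add_apply]
    rw [intervalIntegral.integral_add a₁ a₂, ← c₁, ← c₂]
    ring
  · simp only [Pi.add_apply]
    rw [intervalIntegral.integral_add b₁ b₂, ← d₁, ← d₂]
    ring

theorem HasSecondDerivOn.smul {s : Set ℝ} {u u' w : ℝ → ℂ} (c : ℂ)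
    (h : HasSecondDerivOn s u u' w) : HasSecondDerivOn s (c • u) (c • u') (c • w) := by
  intro x hx y hy
  obtain ⟨a, b, e, d⟩ := h x hx y hy
  refine ⟨a.smul c, b.smul c, ?_, ?_⟩
  · simp only [Pi.smul_apply]
    rw [intervalIntegral.integral_smul, ← e, smul_sub]
  · simp only [Pi.smul_apply]
    rw [intervalIntegral.integral_smul, ← d, smul_sub]

theorem HasSecondDerivOn.congr_ae {s : Set ℝ} (hs : s.OrdConnected) {u u' w v : ℝ → ℂ}
    (h : HasSecondDerivOn s u u' w) (hwv : w =ᵐ[volume.restrict s] v) :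
    HasSecondDerivOn s u u' v := by
  intro x hx y hy
  obtain ⟨a, b, e, d⟩ := h x hx y hy
  have hsub : Set.uIoc x y ⊆ s := Set.uIoc_subset_uIcc.trans (hs.uIcc_subset hx hy)
  have hae : w =ᵐ[volume.restrict (Set.uIoc x y)] v := ae_restrict_of_ae_restrict_of_subset hsub hwv
  refine ⟨a, b.congr_ae hae, e, ?_⟩
  rw [d]
  exact intervalIntegral.integral_congr_ae_restrict hae

/-- The Hilbert space `L²(ℝ)`. -/
abbrev LineSpace : Type := Lp ℂ 2 (volume : Measure ℝ)

/-- The Hilbert space `L²([-L, L])`. -/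
abbrev BoxSpace (L : ℝ) : Type := Lp ℂ 2 (volume.restrict (Set.Icc (-L) L))

/-- The graph of `-d²/dx²` on `L²(ℝ)` with domain the Sobolev space `H²(ℝ)`. -/
def lineGraph : Submodule ℂ (LineSpace × LineSpace) where
  carrier := {p | ∃ u u' : ℝ → ℂ, p.1 =ᵐ[volume] u ∧
    HasSecondDerivOn Set.univ u u' (fun x => -(p.2 : ℝ → ℂ) x)}
  zero_mem' := by
    refine ⟨0, 0, Lp.coeFn_zero _ _ _, ?_⟩
    refine (HasSecondDerivOn.zero _).congr_ae Set.ordConnected_univ ?_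
    rw [Measure.restrict_univ]
    filter_upwards [Lp.coeFn_zero ℂ 2 (volume : Measure ℝ)] with x hx
    change (0 : ℂ) = -((0 : LineSpace) : ℝ → ℂ) x
    rw [hx, Pi.zero_apply, neg_zero]
  add_mem' := by
    rintro p q ⟨u₁, u₁', e₁, h₁⟩ ⟨u₂, u₂', e₂, h₂⟩
    refine ⟨u₁ + u₂, u₁' + u₂', (Lp.coeFn_add _ _).trans (e₁.add e₂), ?_⟩
    refine (h₁.add h₂).congr_ae Set.ordConnected_univ ?_
    rw [Measure.restrict_univ]
    filter_upwards [Lp.coeFn_add p.2 q.2] with x hx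
    change -(p.2 : ℝ → ℂ) x + -(q.2 : ℝ → ℂ) x = -((p.2 + q.2 : LineSpace) : ℝ → ℂ) x
    rw [hx, Pi.add_apply, neg_add]
  smul_mem' := by
    rintro c p ⟨u, u', e, h⟩
    refine ⟨c • u, c • u', (Lp.coeFn_smul _ _).trans (e.const_smul c), ?_⟩
    refine (h.smul c).congr_ae Set.ordConnected_univ ?_
    rw [Measure.restrict_univ]
    filter_upwards [Lp.coeFn_smul c p.2] with x hx
    change c • -(p.2 : ℝ → ℂ) x = -((c • p.2 : LineSpace) : ℝ → ℂ) x
    rw [hx, Pi.smul_apply, smul_neg]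

/-- `H_∞ = -d²/dx²` on `L²(ℝ)`. -/
def lineHamiltonian : LineSpace →ₗ.[ℂ] LineSpace := lineGraph.toLinearPMap

/-- The graph of `-d²/dx²` on `L²([-L, L])` with the boundary conditions `A Γ₁φ = B Γ₂φ`, where
`Γ₁φ = (φ(L), φ(-L))` and `Γ₂φ = (-φ'(L), φ'(-L))`. -/
def boxGraph (A B : Matrix (Fin 2) (Fin 2) ℂ) (L : ℝ) :
    Submodule ℂ (BoxSpace L × BoxSpace L) where
  carrier := {p | ∃ u u' : ℝ → ℂ, p.1 =ᵐ[volume.restrict (Set.Icc (-L) L)] u ∧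
    HasSecondDerivOn (Set.Icc (-L) L) u u' (fun x => -(p.2 : ℝ → ℂ) x) ∧
    A *ᵥ ![u L, u (-L)] - B *ᵥ ![-u' L, u' (-L)] = 0}
  zero_mem' := by
    refine ⟨0, 0, Lp.coeFn_zero _ _ _, ?_, ?_⟩
    · refine (HasSecondDerivOn.zero _).congr_ae Set.ordConnected_Icc ?_
      filter_upwards [Lp.coeFn_zero ℂ 2 (volume.restrict (Set.Icc (-L) L))] with x hx
      change (0 : ℂ) = -((0 : BoxSpace L) : ℝ → ℂ) x
      rw [hx, Pi.zero_apply, neg_zero]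
    · ext i
      fin_cases i <;> simp
  add_mem' := by
    rintro p q ⟨u₁, u₁', e₁, h₁, k₁⟩ ⟨u₂, u₂', e₂, h₂, k₂⟩
    refine ⟨u₁ + u₂, u₁' + u₂', (Lp.coeFn_add _ _).trans (e₁.add e₂), ?_, ?_⟩
    · refine (h₁.add h₂).congr_ae Set.ordConnected_Icc ?_
      filter_upwards [Lp.coeFn_add p.2 q.2] with x hx
      change -(p.2 : ℝ → ℂ) x + -(q.2 : ℝ → ℂ) x = -((p.2 + q.2 : BoxSpace L) : ℝ → ℂ) x
      rw [hx, Pi.add_apply, neg_add]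
    · have := congrArg₂ (· + ·) k₁ k₂
      simp only [add_zero] at this
      rw [← this]
      ext i
      fin_cases i <;> simp <;> ring
  smul_mem' := by
    rintro c p ⟨u, u', e, h, k⟩
    refine ⟨c • u, c • u', (Lp.coeFn_smul _ _).trans (e.const_smul c), ?_, ?_⟩
    · refine (h.smul c).congr_ae Set.ordConnected_Icc ?_
      filter_upwards [Lp.coeFn_smul c p.2] with x hx
      change c • -(p.2 : ℝ → ℂ) x = -((c • p.2 : BoxSpace L) : ℝ → ℂ) x
      rw [hx, Pi.smul_apply, smul_neg]
    · have := congrArg (c • ·) k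
      simp only [smul_zero] at this
      rw [← this]
      ext i
      fin_cases i <;> simp <;> ring

/-- `H_L = -d²/dx²` on `L²([-L, L])` with the boundary conditions given by `A`, `B`. -/
def boxHamiltonian (A B : Matrix (Fin 2) (Fin 2) ℂ) (L : ℝ) : BoxSpace L →ₗ.[ℂ] BoxSpace L :=
  (boxGraph A B L).toLinearPMap

/-! ### Multiplication operators and integral operators on `L²([-L, L])` -/

open scoped Classical in
/-- Multiplication by the essentially bounded function `f`. -/
def mulOp (L : ℝ) (f : ℝ → ℂ) : BoxSpace L →L[ℂ] BoxSpace L :=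
  if h : MemLp f ∞ (volume.restrict (Set.Icc (-L) L)) then
    (ContinuousLinearMap.mul ℂ ℂ).holderL (volume.restrict (Set.Icc (-L) L)) ∞ 2 2 (h.toLp f)
  else 0

open scoped Classical in
/-- The bounded operator with integral kernel `g`. -/
def kernelOp (L : ℝ) (g : ℝ → ℝ → ℂ) : BoxSpace L →L[ℂ] BoxSpace L :=
  if h : ∃ T : BoxSpace L →L[ℂ] BoxSpace L, ∀ f : BoxSpace L,
      T f =ᵐ[volume.restrict (Set.Icc (-L) L)]
        fun x => ∫ y in Set.Icc (-L) L, g x y * (f : ℝ → ℂ) y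
  then h.choose else 0

/-- The multiplication operator `√|V|`. -/
def sqrtAbsOp (V : ℝ → ℝ) (L : ℝ) : BoxSpace L →L[ℂ] BoxSpace L :=
  mulOp L fun x => (Real.sqrt |V x| : ℂ)

/-- The multiplication operator `J`, so that `V = √|V| J √|V|`, `J = J*`, `J² = 1`. -/
def signOp (V : ℝ → ℝ) (L : ℝ) : BoxSpace L →L[ℂ] BoxSpace L :=
  mulOp L fun x => if V x < 0 then -1 else 1

/-! ### Birman--Schwinger operators

Below `k` is the square root of `z` with `Im k ≥ 0`. -/

/-- Restriction `L²(ℝ) → L²([-L, L])`; its adjoint is the extension by zero. -/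
def restrictBox (L : ℝ) : LineSpace →L[ℂ] BoxSpace L :=
  LpToLpRestrictCLM ℝ ℂ ℂ volume 2 (Set.Icc (-L) L)

open scoped Classical in
/-- `R_{∞,L}(z) = χ_L (z - H_∞)⁻¹ χ_L` with `z = k²`, and for real `k` its boundary value, the
operator with kernel `e^{ik|x-y|} / (2ik)`. -/
def freeBoxResolvent (L : ℝ) (k : ℂ) : BoxSpace L →L[ℂ] BoxSpace L :=
  if k.im = 0 then
    kernelOp L fun x y =>
      1 / (2 * Complex.I * k) * Complex.exp (Complex.I * k * ((|x - y| : ℝ) : ℂ))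
  else
    restrictBox L ∘L unboundedResolvent lineHamiltonian (k ^ 2) ∘L
      ContinuousLinearMap.adjoint (restrictBox L)

/-- `K_L(z) = √|V| (z - H_L)⁻¹ √|V| J`. -/
def boxBS (V : ℝ → ℝ) (A B : Matrix (Fin 2) (Fin 2) ℂ) (L : ℝ) (z : ℂ) :
    BoxSpace L →L[ℂ] BoxSpace L :=
  sqrtAbsOp V L * unboundedResolvent (boxHamiltonian A B L) z * sqrtAbsOp V L * signOp V L

/-- `K_{∞,L}(z) = √|V| R_{∞,L}(z) √|V| J`, `z = k²`. -/
def freeBS (V : ℝ → ℝ) (L : ℝ) (k : ℂ) : BoxSpace L →L[ℂ] BoxSpace L :=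
  sqrtAbsOp V L * freeBoxResolvent L k * sqrtAbsOp V L * signOp V L

/-- The wave operator `Ω_{∞,L}(z) = (1 - K_{∞,L}(z))⁻¹`, `z = k²`. -/
def waveOp (V : ℝ → ℝ) (L : ℝ) (k : ℂ) : BoxSpace L →L[ℂ] BoxSpace L :=
  Ring.inverse (1 - freeBS V L k)

/-! ### Boundary condition scattering matrix and the rank two operator -/

/-- The Pauli matrix `σ_x`. -/
def sigmaX : Matrix (Fin 2) (Fin 2) ℂ := !![0, 1; 1, 0]

/-- `U(z) = (iA - kB)⁻¹ (iA + kB)`, `z = k²`. -/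
def bcMatrix (A B : Matrix (Fin 2) (Fin 2) ℂ) (k : ℂ) : Matrix (Fin 2) (Fin 2) ℂ :=
  (Complex.I • A - k • B)⁻¹ * (Complex.I • A + k • B)

/-- `d_L(z) = e^{2ikL}`, `z = k²`. -/
def dFac (L : ℝ) (k : ℂ) : ℂ := Complex.exp (2 * Complex.I * k * L)

/-- `G_L(z) = (e^{2ikL} + U(z) σ_x)⁻¹`, `z = k²`. -/
def gMat (A B : Matrix (Fin 2) (Fin 2) ℂ) (L : ℝ) (k : ℂ) : Matrix (Fin 2) (Fin 2) ℂ :=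
  (dFac L k • (1 : Matrix (Fin 2) (Fin 2) ℂ) + bcMatrix A B k * sigmaX)⁻¹

/-- The functions `e^{iκx}` (index `0`) and `e^{-iκx}` (index `1`). -/
def planeWave (j : Fin 2) (κ : ℂ) (x : ℝ) : ℂ :=
  Complex.exp ((if j = 0 then 1 else -1) * Complex.I * κ * x)

theorem memLp_planeWave (L : ℝ) (j : Fin 2) (κ : ℂ) :
    MemLp (planeWave j κ) 2 (volume.restrict (Set.Icc (-L) L)) := by
  have hc : Continuous (planeWave j κ) := by
    unfold planeWave
    fun_prop
  obtain ⟨C, hC⟩ := (isCompact_Icc (a := -L) (b := L)).exists_bound_of_continuousOn hc.continuousOn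
  exact MemLp.of_bound hc.aestronglyMeasurable C
    ((ae_restrict_iff' measurableSet_Icc).2 (Eventually.of_forall hC))

/-- `ε₁`, `ε₂` as elements of `L²([-L, L])`. -/
def eps (L : ℝ) (j : Fin 2) (κ : ℂ) : BoxSpace L := (memLp_planeWave L j κ).toLp _

/-- `D_L(z) = (2ik)⁻¹ d_L(z) ∑_{j,l} g_{jl}(z) (ε_l(z̄), ·) ε_j(z)`, `z = k²`; here `ε_l(z̄)` is
`ε_l` with the square root of `z` replaced by its complex conjugate. -/
def dOp (A B : Matrix (Fin 2) (Fin 2) ℂ) (L : ℝ) (k : ℂ) : BoxSpace L →L[ℂ] BoxSpace L :=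
  (1 / (2 * Complex.I * k) * dFac L k) • ∑ j : Fin 2, ∑ l : Fin 2,
    gMat A B L k j l • (innerSL ℂ (eps L l (conj k))).smulRight (eps L j k)

/-- The rank two operator `Ω_{∞,L}(z) √|V| D_L(z) √|V| J`, `z = k²`. -/
def rankTwoOp (V : ℝ → ℝ) (A B : Matrix (Fin 2) (Fin 2) ℂ) (L : ℝ) (k : ℂ) :
    BoxSpace L →L[ℂ] BoxSpace L :=
  waveOp V L k * (sqrtAbsOp V L * dOp A B L k * sqrtAbsOp V L * signOp V L)

/-! ### Scattering data of the truncated potential `V χ_L` -/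

/-- `u` solves `-u'' + V χ_L u = k² u` on the line. -/
def IsTruncatedSolution (V : ℝ → ℝ) (L : ℝ) (k : ℂ) (u : ℝ → ℂ) : Prop :=
  ∃ u' : ℝ → ℂ, HasSecondDerivOn Set.univ u u'
    (fun x => (((Set.Icc (-L) L).indicator V x : ℝ) - k ^ 2) * u x)

/-- `S = (t, r₁; r₂, t)` is the scattering matrix of `V χ_L` at `k`: there are scattering solutions
`u₊ = t e^{-ikx}` to the left and `u₊ = e^{-ikx} + r₁ e^{ikx}` to the right of `[-L, L]`, and
`u₋ = e^{ikx} + r₂ e^{-ikx}` to the left and `u₋ = t e^{ikx}` to the right of `[-L, L]`. -/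
def IsScatteringMatrix (V : ℝ → ℝ) (L : ℝ) (k : ℂ) (S : Matrix (Fin 2) (Fin 2) ℂ) : Prop :=
  ∃ t r₁ r₂ : ℂ, S = !![t, r₁; r₂, t] ∧
    (∃ u : ℝ → ℂ, IsTruncatedSolution V L k u ∧
      (∀ x ≤ -L, u x = t * planeWave 1 k x) ∧
      ∀ x ≥ L, u x = planeWave 1 k x + r₁ * planeWave 0 k x) ∧
    ∃ u : ℝ → ℂ, IsTruncatedSolution V L k u ∧
      (∀ x ≤ -L, u x = planeWave 0 k x + r₂ * planeWave 1 k x) ∧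
      ∀ x ≥ L, u x = t * planeWave 0 k x

open scoped Classical in
/-- The scattering matrix `S_L(z)`, `z = k²`. -/
def sMat (V : ℝ → ℝ) (L : ℝ) (k : ℂ) : Matrix (Fin 2) (Fin 2) ℂ :=
  if h : ∃ S, IsScatteringMatrix V L k S then h.choose else 0

/-- The T-matrix `T_L(z) = S_L(z) - 1`, `z = k²`. -/
def tMat (V : ℝ → ℝ) (L : ℝ) (k : ℂ) : Matrix (Fin 2) (Fin 2) ℂ := sMat V L k - 1

/-- The matrix `d_L(z) T_L(z) G_L(z)`, `z = k²`. -/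
def dTG (V : ℝ → ℝ) (A B : Matrix (Fin 2) (Fin 2) ℂ) (L : ℝ) (k : ℂ) :
    Matrix (Fin 2) (Fin 2) ℂ :=
  dFac L k • (tMat V L k * gMat A B L k)

end FermiGas

end

open FermiGas

open MeasureTheory Filter Topology
open scoped ENNReal Matrix ComplexConjugate

noncomputable section

namespace FermiGas

/-! ### Hadamard's inequality and expansions in principal minors -/

section Hadamard

variable {E : Type*} [NormedAddCommGroup E] [InnerProductSpace ℂ E]

/-! On the box, `(z - H_L)⁻¹ f` and `R_{∞,L} f` solve the same equation `u'' + k² u = f`, with `k² =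
z`, so they differ by a combination of the two plane waves. The boundary conditions fix its
coefficients through a 2×2 system with matrix `e^{2ikL} + U σ_x`, and the result is Krein's formula
`(z - H_L)⁻¹ = R_{∞,L} - D_L` (`isResolventAt_box`). Sandwiching it between `√|V|` and `√|V| J` and
pulling out `1 - K_∞` gives the operator factorization (`one_sub_boxBS_eq`).

The second factor is `1 + ∑ₗ ⟪dₗ, ·⟫ cₗ` with two terms, so its determinant is that of the 2×2
matrix `1 + ⟪dᵢ, cⱼ⟫`. The Gram matrix equals `d T G` because the wave operator solves the
Lippmann-Schwinger equation: the outgoing amplitudes of `ε_j + R_{∞,L} V u_j` are the entries of the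
T-matrix (`isScatteringMatrix_waveT`, `inner_rankTwoBra_rankTwoKet`). Fredholm determinants are
handled through the expansion of `det (1 + M)` in principal minors. Hadamard's inequality bounds the
minors of a nuclear operator by a summable family, so finite sections converge in every basis
(`tendsto_det_section`); multiplicativity against a finite rank factor is a block factorization at
the finite level.

The spectral statements rest on two energy identities: `Im ⟪ψ, R_L ψ⟫ = -Im z ‖R_L ψ‖²`, and the
same for `R_{∞,L}` with an additional radiation term `-Re k (|u(L)|² + |u(-L)|²)`. Since `Im z = 2
Re k Im k` and `Im k ≥ 0`, all terms have one sign. An eigenvalue `x ≤ -1` of the rank two operator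
gives `x φ = (1 + x) K_∞ φ - K_L φ`; pairing with `J φ` and taking imaginary parts forces `R_L ψ =
0` for `ψ = √|V| J φ`, hence `φ = 0` (`eq_zero_of_rankTwoOp_apply`). The second identity also shows
that `1 - K_∞` is injective for nonreal `z`. For `z > 0` it yields vanishing boundary values and
Grönwall's inequality finishes; for very negative `z` a contraction estimate suffices.

Complex conjugation is the relation `1 - K(z̄) = J (1 - K(z))* J`, valid for both Birman-Schwinger
operators because `H_L` is symmetric and the free kernel is symmetric in its two variables. -/

theorem norm_det_orthonormalBasis_le [FiniteDimensional ℂ E] {n : ℕ}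
    (b : OrthonormalBasis (Fin n) ℂ E) (f : Fin n → E) :
    ‖(Matrix.of fun i j => inner ℂ (b i) (f j)).det‖ ≤ ∏ i, ‖f i‖ := by
  have hn : Module.finrank ℂ E = Fintype.card (Fin n) := by
    rw [Module.finrank_eq_card_basis b.toBasis]
  set gs := InnerProductSpace.gramSchmidtOrthonormalBasis hn f
  have h1 : (Matrix.of fun i j => inner ℂ (b i) (f j)).det = b.toBasis.det f := by
    rw [Module.Basis.det_apply]
    congr 1
    ext i j
    rw [Module.Basis.toMatrix_apply, Matrix.of_apply, OrthonormalBasis.coe_toBasis_repr_apply,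
      b.repr_apply_apply]
  -- In the Gram-Schmidt basis of `f` the matrix is triangular with diagonal `⟪gsᵢ, fᵢ⟫`; the change
  -- between two orthonormal bases has determinant of modulus one.
  have h2 : b.toBasis.det f = b.toBasis.det gs * gs.toBasis.det f := by
    conv_lhs => rw [AlternatingMap.eq_smul_basis_det gs.toBasis b.toBasis.det]
    simp
  rw [h1, h2, norm_mul, b.det_to_matrix_orthonormalBasis gs, one_mul,
    InnerProductSpace.gramSchmidtOrthonormalBasis_det, norm_prod]
  refine Finset.prod_le_prod (fun _ _ => norm_nonneg _) fun i _ => ?_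
  refine (norm_inner_le_norm _ _).trans ?_
  rw [gs.norm_eq_one, one_mul]

/-- Only the projections of the `g i` to the span of `f` matter. In an orthonormal basis of the span
the matrix factors as `Gᴴ F`, and each factor obeys the previous bound. If `f` is dependent, so are
the columns. -/
theorem norm_det_inner_fin_le {n : ℕ} (g f : Fin n → E) :
    ‖(Matrix.of fun i j => inner ℂ (g i) (f j)).det‖ ≤ ∏ i, ‖g i‖ * ‖f i‖ := by
  by_cases hf : LinearIndependent ℂ f
  · set W := Submodule.span ℂ (Set.range f) with hW
    have hfin : FiniteDimensional ℂ W := FiniteDimensional.span_of_finite ℂ (Set.finite_range f)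
    have hrank : Module.finrank ℂ W = n := by
      rw [hW, finrank_span_eq_card hf, Fintype.card_fin]
    set b := (stdOrthonormalBasis ℂ W).reindex (finCongr hrank)
    set F : Fin n → W := fun i => ⟨f i, Submodule.subset_span ⟨i, rfl⟩⟩
    set G : Fin n → W := fun i => W.orthogonalProjectionOnto (g i)
    have hmat : (Matrix.of fun i j => inner ℂ (g i) (f j)) =
        (Matrix.of fun i j => inner ℂ (b i) (G j))ᴴ *
          (Matrix.of fun i j => inner ℂ (b i) (F j)) := by
      ext i j
      have h1 : inner ℂ (g i) (f j) = inner ℂ (G i) (F j) := by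
        simp only [G]
        rw [Submodule.inner_orthogonalProjectionOnto_eq_of_mem_right]
      rw [Matrix.mul_apply, Matrix.of_apply, h1, ← b.sum_inner_mul_inner]
      simp [Matrix.conjTranspose_apply]
    rw [hmat, Matrix.det_mul, Matrix.det_conjTranspose, norm_mul, norm_star,
      Finset.prod_mul_distrib]
    refine mul_le_mul ?_ (norm_det_orthonormalBasis_le b F) (norm_nonneg _)
      (Finset.prod_nonneg fun _ _ => norm_nonneg _)
    refine (norm_det_orthonormalBasis_le b G).trans ?_
    exact Finset.prod_le_prod (fun _ _ => norm_nonneg _) fun i _ =>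
      W.norm_orthogonalProjectionOnto_apply_le (g i)
  · rw [Fintype.not_linearIndependent_iff] at hf
    obtain ⟨c, hc, i, hi⟩ := hf
    have : (Matrix.of fun i j => inner ℂ (g i) (f j)).det = 0 := by
      refine Matrix.exists_mulVec_eq_zero_iff.1 ⟨c, fun h => hi (congrFun h i), ?_⟩
      ext j
      simp only [Matrix.mulVec, dotProduct, Matrix.of_apply, Pi.zero_apply]
      have : inner ℂ (g j) (∑ i, c i • f i) = 0 := by rw [hc, inner_zero_right]
      rw [inner_sum] at this
      rw [← this]
      exact Finset.sum_congr rfl fun _ _ => by rw [inner_smul_right, mul_comm]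
    rw [this, norm_zero]
    exact Finset.prod_nonneg fun _ _ => by positivity

/-- Hadamard's inequality for matrices of inner products. -/
theorem norm_det_inner_le {ι : Type*} [Fintype ι] [DecidableEq ι] (g f : ι → E) :
    ‖(Matrix.of fun i j => inner ℂ (g i) (f j)).det‖ ≤ ∏ i, ‖g i‖ * ‖f i‖ := by
  set e := (Fintype.equivFin ι).symm
  have h := norm_det_inner_fin_le (fun i => g (e i)) (fun i => f (e i))
  have h2 := Matrix.det_submatrix_equiv_self e (Matrix.of fun i j => inner ℂ (g i) (f j))
  rw [← h2, ← e.prod_comp]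
  exact h

end Hadamard

/-- The determinant is multilinear in the rows; choosing the row of `M` on `s` and that of `1`
elsewhere leaves the principal minor on `s`. -/
theorem det_one_add_eq_sum_minors {R n : Type*} [CommRing R] [Fintype n] [DecidableEq n]
    (M : Matrix n n R) :
    (1 + M).det = ∑ s : Finset n, (M.submatrix (Subtype.val : s → n) Subtype.val).det := by
  have h := (Matrix.detRowAlternating : (n → R) [⋀^n]→ₗ[R] R).map_add_univ M.row (Matrix.row 1)
  have h1 : (1 + M).det = (Matrix.detRowAlternating : (n → R) [⋀^n]→ₗ[R] R)
      (M.row + Matrix.row 1) := by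
    rw [add_comm 1 M]; rfl
  rw [h1, h]
  exact Finset.sum_congr rfl fun s _ => Matrix.det_piecewise_one_eq_submatrix_det M s

/-! ### Determinants of nuclear operators -/

open scoped Classical in
/-- The principal minor with index set `s` of the matrix `⟪g i, f j⟫`. -/
def gramMinor {ι E : Type*} [NormedAddCommGroup E] [InnerProductSpace ℂ E] (g f : ι → E)
    (s : Finset ι) : ℂ :=
  (Matrix.of fun i j : s => inner ℂ (g i) (f j)).det

/-- The Fredholm determinant of `1 + ∑ₙ ⟪gₙ, ·⟫ fₙ`, as the sum of all principal minors. -/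
def nuclearDet {ι E : Type*} [NormedAddCommGroup E] [InnerProductSpace ℂ E] (g f : ι → E) : ℂ :=
  ∑' s : Finset ι, gramMinor g f s

/-- The sum over all finite sets is the expanded product `∏ (1 + aᵢ)`, which converges together with
`∑ aᵢ`. It is the majorant for all expansions in minors below. -/
theorem summable_prod_norm {ι E : Type*} [NormedAddCommGroup E] {g f : ι → E}
    (h : Summable fun i => ‖g i‖ * ‖f i‖) : Summable fun s : Finset ι => ∏ i ∈ s, ‖g i‖ * ‖f i‖ :=
  summable_finsetProd_of_summable_norm (by simpa using h)

section NuclearDet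

variable {ι E : Type*} [NormedAddCommGroup E] [InnerProductSpace ℂ E]

theorem norm_gramMinor_le (g f : ι → E) (s : Finset ι) :
    ‖gramMinor g f s‖ ≤ ∏ i ∈ s, ‖g i‖ * ‖f i‖ := by
  classical
  refine (norm_det_inner_le (fun i : s => g i) (fun i : s => f i)).trans (le_of_eq ?_)
  exact Finset.prod_coe_sort s fun i => ‖g i‖ * ‖f i‖

theorem summable_gramMinor {g f : ι → E} (h : Summable fun i => ‖g i‖ * ‖f i‖) :
    Summable (gramMinor g f) :=
  Summable.of_norm_bounded (summable_prod_norm h) (norm_gramMinor_le g f)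

open scoped Classical in
theorem det_one_add_gram (g f : ι → E) (N : Finset ι) :
    (1 + Matrix.of fun i j : N => inner ℂ (g i) (f j)).det = ∑ s ∈ N.powerset, gramMinor g f s := by
  rw [det_one_add_eq_sum_minors]
  refine Finset.sum_bij (fun s _ => s.map (Function.Embedding.subtype _)) ?_ ?_ ?_ ?_
  · intro s _
    rw [Finset.mem_powerset]
    exact Finset.map_subtype_subset s
  · intro s _ t _ h
    exact Finset.map_injective _ h
  · intro t ht
    rw [Finset.mem_powerset] at ht
    refine ⟨t.subtype _, Finset.mem_univ _, ?_⟩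
    rw [Finset.subtype_map, Finset.filter_true_of_mem]
    exact fun x hx => ht hx
  · intro s _
    rw [gramMinor, ← Matrix.det_submatrix_equiv_self
      (Finset.equivMap (Function.Embedding.subtype fun x => x ∈ N) s)]
    rfl

open scoped Classical in
theorem tendsto_det_one_add_gram {g f : ι → E} (h : Summable fun i => ‖g i‖ * ‖f i‖) :
    Tendsto (fun N : Finset ι => (1 + Matrix.of fun i j : N => inner ℂ (g i) (f j)).det) atTop
      (𝓝 (nuclearDet g f)) := by
  simp_rw [det_one_add_gram]
  exact (summable_gramMinor h).hasSum.comp tendsto_finset_powerset_atTop_atTop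

/-- The partial sum of the expansion of `x` in a Hilbert basis. -/
def basisProj {κ : Type*} (b : HilbertBasis κ ℂ E) (F : Finset κ) (x : E) : E :=
  ∑ i ∈ F, inner ℂ (b i) x • b i

theorem norm_basisProj_le {κ : Type*} (b : HilbertBasis κ ℂ E) (F : Finset κ) (x : E) :
    ‖basisProj b F x‖ ≤ ‖x‖ := by
  have h1 : ‖basisProj b F x‖ ^ 2 = ∑ i ∈ F, ‖inner ℂ (b i) x‖ ^ 2 := by
    have := b.orthonormal.inner_sum (fun i => inner ℂ (b i) x) (fun i => inner ℂ (b i) x) F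
    simp_rw [RCLike.conj_mul] at this
    rw [basisProj, @norm_sq_eq_re_inner ℂ, this]
    norm_cast
  have h2 := b.orthonormal.sum_inner_products_le (x := x) (s := F)
  rw [← h1] at h2
  exact le_of_sq_le_sq h2 (norm_nonneg _)

theorem tendsto_basisProj {κ : Type*} (b : HilbertBasis κ ℂ E) (x : E) :
    Tendsto (fun F => basisProj b F x) atTop (𝓝 x) := by
  have := b.hasSum_repr x
  simp_rw [b.repr_apply_apply] at this
  exact this

open scoped Classical in
-- For partial sums of the expansion of `A` this is Sylvester's identity `det (1 + XY) = det (1 +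
-- YX)`, which trades the index set of the basis for that of the expansion. Both sides pass to the
-- limit.
theorem det_section_eq {κ : Type*} (b : HilbertBasis κ ℂ E) {g f : ι → E}
    (h : Summable fun i => ‖g i‖ * ‖f i‖) (A : E →L[ℂ] E)
    (hA : ∀ x, HasSum (fun n => inner ℂ (g n) x • f n) (A x)) (F : Finset κ) :
    (1 + Matrix.of fun i j : F => inner ℂ (b i) (A (b j))).det =
      nuclearDet g (fun n => basisProj b F (f n)) := by
  have hs : Summable fun i => ‖g i‖ * ‖basisProj b F (f i)‖ :=
    Summable.of_nonneg_of_le (fun i => by positivity)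
      (fun i => mul_le_mul_of_nonneg_left (norm_basisProj_le b F _) (norm_nonneg _)) h
  refine tendsto_nhds_unique ?_ (tendsto_det_one_add_gram hs)
  have key : ∀ N : Finset ι,
      (1 + Matrix.of fun i j : N => inner ℂ (g i) (basisProj b F (f j))).det =
      (1 + Matrix.of fun i j : F => ∑ n ∈ N, inner ℂ (g n) (b j) * inner ℂ (b i) (f n)).det := by
    intro N
    have := Matrix.det_one_add_mul_comm (Matrix.of fun (n : N) (j : F) => inner ℂ (g n) (b j))
      (Matrix.of fun (i : F) (n : N) => inner ℂ (b i) (f n))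
    convert this using 3
    · ext n m
      rw [Matrix.mul_apply, Matrix.of_apply, basisProj, inner_sum]
      simp_rw [inner_smul_right, Matrix.of_apply]
      rw [← Finset.sum_coe_sort F]
      exact Finset.sum_congr rfl fun _ _ => mul_comm _ _
    · ext i j
      rw [Matrix.mul_apply, Matrix.of_apply, ← Finset.sum_coe_sort N]
      exact Finset.sum_congr rfl fun _ _ => by simp [mul_comm]
  simp_rw [key]
  have hcont : Continuous fun M : Matrix F F ℂ => (1 + M).det :=
    Continuous.matrix_det (continuous_const.add continuous_id)
  refine (hcont.tendsto _).comp ?_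
  refine tendsto_pi_nhds.2 fun i => tendsto_pi_nhds.2 fun j => ?_
  have := (hA (b j)).mapL (innerSL ℂ (b i))
  simpa [HasSum, inner_smul_right] using this

open scoped Classical in
/-- The determinants of the finite sections of `1 + ∑ₙ ⟪gₙ, ·⟫ fₙ` converge to `nuclearDet`. -/
theorem tendsto_det_section {κ : Type*} (b : HilbertBasis κ ℂ E) {g f : ι → E}
    (h : Summable fun i => ‖g i‖ * ‖f i‖) (A : E →L[ℂ] E)
    (hA : ∀ x, HasSum (fun n => inner ℂ (g n) x • f n) (A x)) :
    Tendsto (fun F : Finset κ => (1 + Matrix.of fun i j : F => inner ℂ (b i) (A (b j))).det) atTop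
      (𝓝 (nuclearDet g f)) := by
  simp_rw [det_section_eq b h A hA]
  -- Projections contract, so the majorant does not depend on `F`; each single minor is a continuous
  -- function of finitely many inner products.
  refine tendsto_tsum_of_dominated_convergence (summable_prod_norm h) ?_ ?_
  · intro s
    have hcont : Continuous fun M : Matrix s s ℂ => M.det := Continuous.matrix_det continuous_id
    refine (hcont.tendsto _).comp ?_
    refine tendsto_pi_nhds.2 fun i => tendsto_pi_nhds.2 fun j => ?_
    exact ((innerSL ℂ (g i)).continuous.tendsto _).comp (tendsto_basisProj b (f j))
  · refine Eventually.of_forall fun F s => (norm_gramMinor_le _ _ s).trans ?_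
    exact Finset.prod_le_prod (fun _ _ => by positivity) fun i _ =>
      mul_le_mul_of_nonneg_left (norm_basisProj_le b F _) (norm_nonneg _)

end NuclearDet

/-! ### Trace class operators -/

section TraceClass

theorem hasSum_sumElim {α β M : Type*} [AddCommMonoid M] [TopologicalSpace M] [ContinuousAdd M]
    {f : α → M} {g : β → M} {a b : M} (hf : HasSum f a) (hg : HasSum g b) :
    HasSum (Sum.elim f g) (a + b) := by
  refine HasSum.add_isCompl Set.isCompl_range_inl_range_inr ?_ ?_
  · refine (Sum.inl_injective.hasSum_range_iff).2 ?_
    simpa using hf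
  · refine (Sum.inr_injective.hasSum_range_iff).2 ?_
    simpa using hg

variable {H : Type} [NormedAddCommGroup H] [InnerProductSpace ℂ H]

/-- Allows expansions over an arbitrary index type: a summable family of norms has countable
support, and extending an enumeration by zero changes no sum. -/
theorem isTraceClass_of_family {ι : Type*} {g f : ι → H} (h : Summable fun i => ‖g i‖ * ‖f i‖)
    {A : H →L[ℂ] H} (hA : ∀ x, HasSum (fun n => inner ℂ (g n) x • f n) (A x)) :
    IsTraceClass A := by
  set s : Set ι := Function.support fun i => ‖g i‖ * ‖f i‖ with hs
  have hc : s.Countable := h.countable_support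
  have : Countable s := hc.to_subtype
  obtain ⟨e, he⟩ := exists_injective_nat s
  refine ⟨Function.extend e (fun i => f i) 0, Function.extend e (fun i => g i) 0, ?_, fun x => ?_⟩
  · rw [← he.summable_iff]
    · have : ((fun n => ‖Function.extend e (fun i : s => f i) 0 n‖ *
          ‖Function.extend e (fun i : s => g i) 0 n‖) ∘ e) = fun i : s => ‖g i‖ * ‖f i‖ := by
        ext i
        simp [he.extend_apply, mul_comm]
      rw [this]
      exact h.subtype s
    · intro n hn
      rw [Function.extend_apply' _ _ _ (by simpa using hn)]
      simp
  · rw [← he.hasSum_iff]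
    · have : ((fun n => inner ℂ (Function.extend e (fun i : s => g i) 0 n) x •
          Function.extend e (fun i : s => f i) 0 n) ∘ e) =
          (fun i => inner ℂ (g i) x • f i) ∘ ((↑) : s → ι) := by
        ext i
        simp [he.extend_apply]
      rw [this, hasSum_subtype_iff_of_support_subset]
      · exact hA x
      · intro i hi
        simp only [hs, Function.mem_support] at hi ⊢
        contrapose! hi
        rcases mul_eq_zero.1 hi with h0 | h0
        · rw [norm_eq_zero.1 h0, inner_zero_left, zero_smul]
        · rw [norm_eq_zero.1 h0, smul_zero]
    · intro n hn
      rw [Function.extend_apply' _ _ _ (by simpa using hn)]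
      simp

/-- Upgrades pointwise convergence of the expansion to convergence in operator norm, which is what
compactness of the limit needs. -/
theorem hasSum_smulRight [CompleteSpace H] {ι : Type*} {g f : ι → H}
    (h : Summable fun i => ‖g i‖ * ‖f i‖)
    {A : H →L[ℂ] H} (hA : ∀ x, HasSum (fun n => inner ℂ (g n) x • f n) (A x)) :
    HasSum (fun n => (innerSL ℂ (g n)).smulRight (f n)) A := by
  have hs : Summable fun n => (innerSL ℂ (g n)).smulRight (f n) := by
    refine Summable.of_norm (h.congr fun n => ?_)
    rw [ContinuousLinearMap.norm_smulRight_apply, innerSL_apply_norm]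
  have : A = ∑' n, (innerSL ℂ (g n)).smulRight (f n) := by
    ext x
    refine (hA x).unique ?_
    have := hs.hasSum.mapL (ContinuousLinearMap.apply ℂ H x)
    simpa using this
  rw [this]
  exact hs.hasSum

theorem IsTraceClass.isCompactOperator [CompleteSpace H] {A : H →L[ℂ] H} (hA : IsTraceClass A) :
    IsCompactOperator A := by
  obtain ⟨f, g, hs, h⟩ := hA
  have := hasSum_smulRight (by simpa [mul_comm] using hs) h
  refine isCompactOperator_of_tendsto this (Eventually.of_forall fun F => ?_)
  refine (compactOperator (RingHom.id ℂ) H H).sum_mem fun n _ => ?_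
  have h1 : IsCompactOperator (innerSL ℂ (g n) : H →L[ℂ] ℂ) :=
    isCompactOperator_of_locallyCompactSpace_dom _
  have h2 := h1.clm_comp (ContinuousLinearMap.toSpanSingleton ℂ (f n))
  exact h2

/-- The Fredholm alternative for trace class perturbations of the identity. -/
theorem IsTraceClass.isUnit_one_sub [CompleteSpace H] {A : H →L[ℂ] H} (hA : IsTraceClass A)
    (h : ∀ φ, A φ = φ → φ = 0) : IsUnit (1 - A) := by
  rcases hA.isCompactOperator.hasEigenvalue_or_mem_resolventSet (one_ne_zero (α := ℂ)) with h1 | h1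
  · obtain ⟨φ, hφ⟩ := h1.exists_hasEigenvector
    refine absurd (h φ ?_) hφ.2
    simpa using hφ.apply_eq_smul
  · rw [spectrum.mem_resolventSet_iff] at h1
    simpa using h1

/-! ### Existence, uniqueness, multiplicativity and conjugation of Fredholm determinants. -/

open scoped Classical in
-- The finite sections do not mention `g` and `f`, so with uniqueness of limits `nuclearDet g f`
-- depends on the operator alone.
theorem isFredholmDet_of_family {ι : Type*} {g f : ι → H} (h : Summable fun i => ‖g i‖ * ‖f i‖)
    {T : H →L[ℂ] H} (hA : ∀ x, HasSum (fun n => inner ℂ (g n) x • f n) ((T - 1) x)) :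
    IsFredholmDet T (nuclearDet g f) := by
  refine ⟨isTraceClass_of_family h hA, fun κ b => ?_⟩
  convert tendsto_det_section b h (T - 1) hA using 4 with F
  ext i j
  have := orthonormal_iff_ite.1 b.orthonormal (i : κ) j
  rw [Matrix.add_apply, Matrix.of_apply, Matrix.of_apply, sub_apply, inner_sub_right,
    one_apply_eq_self, this, Matrix.one_apply]
  simp only [Subtype.ext_iff]
  ring

theorem IsTraceClass.exists_isFredholmDet {T : H →L[ℂ] H} (hT : IsTraceClass (T - 1)) :
    ∃ D, IsFredholmDet T D := by
  obtain ⟨f, g, hs, h⟩ := hT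
  exact ⟨_, isFredholmDet_of_family (by simpa [mul_comm] using hs) h⟩

theorem IsFredholmDet.unique [CompleteSpace H] {T : H →L[ℂ] H} {D D' : ℂ} (h : IsFredholmDet T D)
    (h' : IsFredholmDet T D') : D = D' := by
  obtain ⟨w, b, -⟩ := exists_hilbertBasis ℂ H
  exact tendsto_nhds_unique (h.2 w b) (h'.2 w b)

/-- The operator `∑ⱼ ⟪dⱼ, ·⟫ cⱼ`. -/
def finiteRankOp {σ : Type*} [Fintype σ] (d c : σ → H) : H →L[ℂ] H :=
  ∑ j, (innerSL ℂ (d j)).smulRight (c j)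

theorem finiteRankOp_apply {σ : Type*} [Fintype σ] (d c : σ → H) (x : H) :
    finiteRankOp d c x = ∑ j, inner ℂ (d j) x • c j := by
  simp [finiteRankOp]

open scoped Classical in
-- If `(g, f)` represents `T - 1` and `F = finiteRankOp d c`, the combined family represents `T (1 +
-- F) - 1`: the vectors `g` are replaced by `(1 + F)* g`. With `X = ⟪g, c⟫`, `Y = ⟪d, f⟫`, `M = ⟪g,
-- f⟫`, `Z = ⟪d, c⟫` its matrix is `(1, X; 0, 1) (1 + M, 0; Y, 1 + Z)`.
theorem det_one_add_gram_sumElim {ι σ : Type*} [Fintype σ] (g f : ι → H) (d c : σ → H)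
    (N : Finset ι) :
    (1 + Matrix.of fun i j : (N.disjSum (Finset.univ : Finset σ)) =>
      inner ℂ (Sum.elim (fun n => g n + ∑ l, inner ℂ (c l) (g n) • d l) d (i : ι ⊕ σ))
        (Sum.elim f c (j : ι ⊕ σ))).det =
    (1 + Matrix.of fun i j : N => inner ℂ (g i) (f j)).det *
      (1 + Matrix.of fun i j => inner ℂ (d i) (c j)).det := by
  let e : N ⊕ σ ≃ (N.disjSum (Finset.univ : Finset σ)) := Equiv.ofBijective
    (fun y => ⟨Sum.map Subtype.val id y, by rcases y with y | y <;> simp⟩) (by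
      constructor
      · rintro (⟨x, hx⟩ | x) (⟨y, hy⟩ | y) h <;> simp_all
      · rintro ⟨x | x, hx⟩
        · exact ⟨Sum.inl ⟨x, by simpa using hx⟩, rfl⟩
        · exact ⟨Sum.inr x, rfl⟩)
  rw [← Matrix.det_submatrix_equiv_self e]
  have hl : ((1 + Matrix.of fun i j : (N.disjSum (Finset.univ : Finset σ)) =>
      inner ℂ (Sum.elim (fun n => g n + ∑ l, inner ℂ (c l) (g n) • d l) d (i : ι ⊕ σ))
        (Sum.elim f c (j : ι ⊕ σ))).submatrix e e) =
      Matrix.fromBlocks 1 (Matrix.of fun (i : N) (j : σ) => inner ℂ (g i) (c j)) 0 1 *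
      Matrix.fromBlocks (1 + Matrix.of fun i j : N => inner ℂ (g i) (f j)) 0
        (Matrix.of fun (i : σ) (j : N) => inner ℂ (d i) (f j))
        (1 + Matrix.of fun i j => inner ℂ (d i) (c j)) := by
    rw [Matrix.fromBlocks_multiply]
    have h1 : ∀ i j, (1 : Matrix (N.disjSum (Finset.univ : Finset σ))
        (N.disjSum (Finset.univ : Finset σ)) ℂ) (e i) (e j) = (1 : Matrix _ _ ℂ) i j := by
      intro i j
      simp [Matrix.one_apply]
    have he1 : ∀ i : N, ((e (Sum.inl i)) : ι ⊕ σ) = Sum.inl (i : ι) := fun _ => rfl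
    have he2 : ∀ i : σ, ((e (Sum.inr i)) : ι ⊕ σ) = Sum.inr i := fun _ => rfl
    ext (i | i) (j | j) <;>
      simp only [Matrix.submatrix_apply, Matrix.add_apply, h1, Matrix.of_apply, he1, he2,
        Sum.elim_inl, Sum.elim_inr] <;>
      simp [Matrix.one_apply, Matrix.mul_apply,
        mul_add, Finset.sum_add_distrib, add_assoc] <;>
      exact Finset.sum_congr rfl fun _ _ => mul_comm _ _
  rw [hl, Matrix.det_mul, Matrix.det_fromBlocks_zero₂₁, Matrix.det_fromBlocks_zero₁₂]
  simp

/-- Index sets containing all of `σ` are cofinal, so limits may be taken along those to which the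
block factorization applies. -/
theorem tendsto_disjSum_univ_atTop {ι σ : Type*} [Fintype σ] :
    Tendsto (fun N : Finset ι => N.disjSum (Finset.univ : Finset σ)) atTop atTop := by
  refine tendsto_atTop_finset_of_monotone ?_ ?_
  · intro M N hMN
    exact Finset.disjSum_mono hMN le_rfl
  · rintro (n | l)
    · exact ⟨{n}, by simp⟩
    · exact ⟨∅, by simp⟩

open scoped Classical in
/-- Multiplicativity of the Fredholm determinant for a factor `1 + (finite rank)`. -/
theorem IsFredholmDet.mul_one_add_finiteRankOp [CompleteSpace H] {T : H →L[ℂ] H} {D : ℂ}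
    (hT : IsFredholmDet T D) {σ : Type*} [Fintype σ] (d c : σ → H) :
    IsFredholmDet (T * (1 + finiteRankOp d c))
      (D * (1 + Matrix.of fun i j => inner ℂ (d i) (c j)).det) := by
  obtain ⟨f, g, hs, h⟩ := hT.1
  replace hs : Summable fun n => ‖g n‖ * ‖f n‖ := by simpa [mul_comm] using hs
  obtain rfl := hT.unique (isFredholmDet_of_family hs h)
  -- `T (1 + F) - 1 = (T - 1)(1 + F) + F`, and `⟪g, (1 + F) x⟫ = ⟪(1 + F)* g, x⟫`.
  set g' : ℕ ⊕ σ → H := Sum.elim (fun n => g n + ∑ l, inner ℂ (c l) (g n) • d l) d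
  set f' : ℕ ⊕ σ → H := Sum.elim f c
  have hs' : Summable fun n => ‖g' n‖ * ‖f' n‖ := by
    have h1 : Summable fun n => ‖g n + ∑ l, inner ℂ (c l) (g n) • d l‖ * ‖f n‖ := by
      refine Summable.of_nonneg_of_le (fun _ => by positivity) (fun n => ?_)
        (hs.mul_left (1 + ∑ l, ‖c l‖ * ‖d l‖))
      rw [← mul_assoc]
      refine mul_le_mul_of_nonneg_right ?_ (norm_nonneg _)
      refine (norm_add_le _ _).trans ?_
      rw [add_mul, one_mul, Finset.sum_mul]
      gcongr
      refine (norm_sum_le _ _).trans (Finset.sum_le_sum fun l _ => ?_)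
      rw [norm_smul]
      calc ‖inner ℂ (c l) (g n)‖ * ‖d l‖ ≤ (‖c l‖ * ‖g n‖) * ‖d l‖ := by
            gcongr; exact norm_inner_le_norm _ _
        _ = _ := by ring
    have h2 : Summable fun l => ‖d l‖ * ‖c l‖ := (hasSum_fintype _).summable
    have := (hasSum_sumElim h1.hasSum h2.hasSum).summable
    refine this.congr ?_
    rintro (n | l) <;> rfl
  have hsum : ∀ x, HasSum (fun n => inner ℂ (g' n) x • f' n)
      ((T * (1 + finiteRankOp d c) - 1) x) := by
    intro x
    have h1 := h (x + finiteRankOp d c x)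
    have h2 := hasSum_fintype fun l => inner ℂ (d l) x • c l
    have h3 := hasSum_sumElim h1 h2
    convert h3 using 1
    · ext (n | l)
      · simp only [g', f', Sum.elim_inl]
        congr 1
        rw [finiteRankOp_apply, inner_add_left, inner_add_right, sum_inner, inner_sum]
        congr 1
        refine Finset.sum_congr rfl fun l _ => ?_
        rw [inner_smul_left, inner_smul_right, inner_conj_symm, mul_comm]
      · rfl
    · rw [← finiteRankOp_apply]
      simp only [sub_apply, mul_apply_eq_comp, add_apply, one_apply_eq_self]
      abel
  have hdet := isFredholmDet_of_family hs' hsum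
  have hlim := tendsto_disjSum_univ_atTop (ι := ℕ) (σ := σ)
  have h1 := (tendsto_det_one_add_gram hs').comp hlim
  have h2 := (tendsto_det_one_add_gram hs).mul_const
    (1 + Matrix.of fun i j => inner ℂ (d i) (c j)).det
  have h3 : nuclearDet g' f' = nuclearDet g f *
      (1 + Matrix.of fun i j => inner ℂ (d i) (c j)).det := by
    refine tendsto_nhds_unique h1 (h2.congr fun N => ?_)
    rw [← det_one_add_gram_sumElim g f d c N]
    simp only [Function.comp_apply, g', f']
    congr!
  rw [← h3]
  exact hdet

/-- Conjugation by a self-adjoint involution `J` and passage to the adjoint. -/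
theorem IsFredholmDet.conj_adjoint [CompleteSpace H] {T J : H →L[ℂ] H} {D : ℂ}
    (hT : IsFredholmDet T D) (hJ : J * J = 1) (hJ' : ContinuousLinearMap.adjoint J = J) :
    IsFredholmDet (J * ContinuousLinearMap.adjoint T * J) (conj D) := by
  have hJJ : ∀ x, J (J x) = x := fun x => congrArg (fun S : H →L[ℂ] H => S x) hJ
  have hJi : ∀ x y, inner ℂ (J x) y = inner ℂ x (J y) := fun x y => by
    conv_lhs => rw [← hJ']
    rw [ContinuousLinearMap.adjoint_inner_left]
  obtain ⟨f, g, hs, h⟩ := hT.1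
  have hn : ∀ x, ‖J x‖ = ‖x‖ := fun x => by
    rw [@norm_eq_sqrt_re_inner ℂ, hJi, hJJ, ← @norm_eq_sqrt_re_inner ℂ]
  refine ⟨isTraceClass_of_family (g := fun n => J (f n)) (f := fun n => J (g n))
    (by simpa [hn] using hs) fun x => ?_, fun ι b => ?_⟩
  -- The series converges absolutely; its sum is identified by pairing with an arbitrary `y` and
  -- conjugating the expansion of `T - 1`.
  · have hsum : Summable fun n => inner ℂ (J (f n)) x • J (g n) := by
      refine Summable.of_norm_bounded (hs.mul_right ‖x‖) fun n => ?_
      rw [norm_smul, hn]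
      calc _ ≤ ‖J (f n)‖ * ‖x‖ * ‖g n‖ := by gcongr; exact norm_inner_le_norm _ _
        _ = _ := by rw [hn]; ring
    convert hsum.hasSum using 1
    refine ext_inner_left ℂ fun y => ?_
    have h1 := ((h (J y)).mapL (innerSL ℂ (J x))).star
    have h2 := (hsum.hasSum).mapL (innerSL ℂ y)
    simp only [innerSL_apply_apply, inner_smul_right] at h1 h2
    refine HasSum.unique ?_ h2
    convert h1 using 1
    · ext n
      simp [hJi, mul_comm]
    · simp [inner_sub_right, ContinuousLinearMap.adjoint_inner_right, ← hJi, hJJ]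
  · let e : H ≃ₗᵢ[ℂ] H :=
      { toFun := J, map_add' := map_add J, map_smul' := map_smul J, invFun := J, left_inv := hJJ,
        right_inv := hJJ, norm_map' := hn }
    -- The section of `J T* J` in the basis `b` is the conjugate transpose of the section of `T` in
    -- the basis `J b`. This uses that the definition allows every basis.
    let b' : HilbertBasis ι ℂ H := HilbertBasis.ofRepr (e.trans b.repr)
    have hb' : ∀ i, b' i = J (b i) := by
      classical
      intro i
      rw [← b'.repr_symm_single, ← b.repr_symm_single]
      rfl
    have h1 := (Complex.continuous_conj.tendsto _).comp (hT.2 ι b')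
    refine h1.congr fun F => ?_
    classical
    simp only [Function.comp_apply]
    rw [← Matrix.det_transpose, RingHom.map_det]
    congr 1
    ext i j
    simp only [RingHom.mapMatrix_apply, Matrix.map_apply, Matrix.transpose_apply, Matrix.of_apply,
      hb', inner_conj_symm]
    rw [← ContinuousLinearMap.adjoint_inner_right, hJi]
    rfl

/-! ### Operations on trace class operators and eigenvectors of finite rank operators. -/

theorem isTraceClass_finiteRankOp {σ : Type*} [Fintype σ] (d c : σ → H) :
    IsTraceClass (finiteRankOp d c) := by
  refine isTraceClass_of_family (g := d) (f := c) (hasSum_fintype _).summable fun x => ?_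
  rw [finiteRankOp_apply]
  exact hasSum_fintype _

theorem IsTraceClass.add {A B : H →L[ℂ] H} (hA : IsTraceClass A) (hB : IsTraceClass B) :
    IsTraceClass (A + B) := by
  obtain ⟨f, g, hs, h⟩ := hA
  obtain ⟨f', g', hs', h'⟩ := hB
  refine isTraceClass_of_family (g := Sum.elim g g') (f := Sum.elim f f') ?_ fun x => ?_
  · refine (hasSum_sumElim hs.hasSum hs'.hasSum).summable.congr ?_
    rintro (n | n) <;> simp [mul_comm]
  · rw [add_apply]
    convert hasSum_sumElim (h x) (h' x) using 1
    ext (n | n) <;> rfl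

theorem IsTraceClass.mul_mul [CompleteSpace H] {A : H →L[ℂ] H} (hA : IsTraceClass A)
    (B C : H →L[ℂ] H) : IsTraceClass (B * A * C) := by
  obtain ⟨f, g, hs, h⟩ := hA
  refine isTraceClass_of_family (g := fun n => ContinuousLinearMap.adjoint C (g n))
    (f := fun n => B (f n)) ?_ fun x => ?_
  · refine Summable.of_nonneg_of_le (fun n => by positivity) (fun n => ?_)
      (hs.mul_left (‖ContinuousLinearMap.adjoint C‖ * ‖B‖))
    calc _ ≤ (‖ContinuousLinearMap.adjoint C‖ * ‖g n‖) * (‖B‖ * ‖f n‖) := by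
          gcongr <;> exact ContinuousLinearMap.le_opNorm _ _
      _ = _ := by ring
  · have := (h (C x)).mapL B
    simpa [ContinuousLinearMap.adjoint_inner_left] using this

theorem IsTraceClass.neg {A : H →L[ℂ] H} (hA : IsTraceClass A) : IsTraceClass (-A) := by
  obtain ⟨f, g, hs, h⟩ := hA
  refine ⟨fun n => -f n, g, by simpa using hs, fun x => ?_⟩
  simpa using (h x).neg

/-- A product of two Hilbert-Schmidt operators is trace class. -/
theorem isTraceClass_mul_of_summable_sq [CompleteSpace H] {κ : Type*} (b : HilbertBasis κ ℂ H)
    (X Y : H →L[ℂ] H) (hX : Summable fun i => ‖X (b i)‖ ^ 2)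
    (hY : Summable fun i => ‖ContinuousLinearMap.adjoint Y (b i)‖ ^ 2) : IsTraceClass (X * Y) := by
  refine isTraceClass_of_family (g := fun i => ContinuousLinearMap.adjoint Y (b i))
    (f := fun i => X (b i)) ?_ fun x => ?_
  · refine Summable.of_nonneg_of_le (fun n => by positivity) (fun n => ?_) (hX.add hY)
    nlinarith [sq_nonneg (‖X (b n)‖ - ‖ContinuousLinearMap.adjoint Y (b n)‖),
      sq_nonneg ‖X (b n)‖, sq_nonneg ‖ContinuousLinearMap.adjoint Y (b n)‖]
  · have := (b.hasSum_repr (Y x)).mapL X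
    simpa [b.repr_apply_apply, ContinuousLinearMap.adjoint_inner_left] using this

/-- The operator is compact, so a nonzero spectral value is an eigenvalue. -/
theorem exists_eigenvector_finiteRankOp_of_mem_spectrum [CompleteSpace H] {σ : Type*} [Fintype σ]
    {d c : σ → H} {x : ℂ} (hx : x ≠ 0) (h : x ∈ spectrum ℂ (finiteRankOp d c)) :
    ∃ φ, φ ≠ 0 ∧ finiteRankOp d c φ = x • φ := by
  rw [← (isTraceClass_finiteRankOp d c).isCompactOperator.hasEigenvalue_iff_mem_spectrum hx] at h
  obtain ⟨φ, hφ⟩ := h.exists_hasEigenvector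
  exact ⟨φ, hφ.2, hφ.apply_eq_smul⟩

/-- An eigenvector `v` of the Gram matrix lifts to `∑ vⱼ cⱼ`. Its inner products with the `dᵢ` are
`x vᵢ`, so it is nonzero when `x ≠ 0`. -/
theorem exists_eigenvector_finiteRankOp_of_matrix {σ : Type*} [Fintype σ] [DecidableEq σ]
    {d c : σ → H} {x : ℂ} (hx : x ≠ 0)
    (h : Module.End.HasEigenvalue
      (Matrix.toLin' (Matrix.of fun i j => inner ℂ (d i) (c j))) x) :
    ∃ φ, φ ≠ 0 ∧ finiteRankOp d c φ = x • φ := by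
  obtain ⟨v, hv⟩ := h.exists_hasEigenvector
  have h1 := hv.apply_eq_smul
  rw [Matrix.toLin'_apply] at h1
  have h2 : ∀ i, inner ℂ (d i) (∑ j, v j • c j) = x * v i := by
    intro i
    have := congrFun h1 i
    simp only [Matrix.mulVec, dotProduct, Matrix.of_apply, Pi.smul_apply, smul_eq_mul] at this
    rw [← this, inner_sum]
    exact Finset.sum_congr rfl fun _ _ => by rw [inner_smul_right, mul_comm]
  refine ⟨∑ j, v j • c j, fun h0 => hv.2 ?_, ?_⟩
  · ext i
    have := h2 i
    rw [h0, inner_zero_right] at this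
    simpa [hx] using this.symm
  · rw [finiteRankOp_apply, Finset.smul_sum]
    exact Finset.sum_congr rfl fun i _ => by rw [h2, mul_smul]

end TraceClass

/-! ### Indefinite integrals and the product rule -/

/-- Primitives are absolutely continuous with the integrand as derivative almost everywhere, so this
is integration by parts for absolutely continuous functions. -/
theorem integral_mul_primitive_real {f g : ℝ → ℝ} {a b : ℝ} (hf : IntervalIntegrable f volume a b)
    (hg : IntervalIntegrable g volume a b) :
    ∫ x in a..b, (f x * (∫ t in a..x, g t) + (∫ t in a..x, f t) * g x) =
      (∫ t in a..b, f t) * ∫ t in a..b, g t := by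
  have hF := hf.absolutelyContinuousOnInterval_intervalIntegral (c := a) Set.left_mem_uIcc
  have hG := hg.absolutelyContinuousOnInterval_intervalIntegral (c := a) Set.left_mem_uIcc
  have h := AbsolutelyContinuousOnInterval.integral_deriv_mul_eq_sub hF hG
  rw [intervalIntegral.integral_same, zero_mul, sub_zero] at h
  rw [← h]
  refine intervalIntegral.integral_congr_ae ?_
  filter_upwards [hf.ae_hasDerivAt_integral, hg.ae_hasDerivAt_integral] with x h1 h2 hx
  have hx' := Set.uIoc_subset_uIcc hx
  rw [(h1 hx' a Set.left_mem_uIcc).deriv, (h2 hx' a Set.left_mem_uIcc).deriv]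

theorem continuousOn_integral_left {f : ℝ → ℂ} {a b : ℝ} (hf : IntervalIntegrable f volume a b) :
    ContinuousOn (fun x => ∫ t in a..x, f t) (Set.uIcc a b) :=
  intervalIntegral.continuousOn_primitive_interval' hf Set.left_mem_uIcc

/-- Integration by parts for indefinite integrals. -/
theorem integral_mul_primitive {f g : ℝ → ℂ} {a b : ℝ} (hf : IntervalIntegrable f volume a b)
    (hg : IntervalIntegrable g volume a b) :
    ∫ x in a..b, (f x * (∫ t in a..x, g t) + (∫ t in a..x, f t) * g x) =
      (∫ t in a..b, f t) * ∫ t in a..b, g t := by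
  have key : ∀ {f g : ℝ → ℂ}, IntervalIntegrable f volume a b → IntervalIntegrable g volume a b →
      IntervalIntegrable (fun x => f x * (∫ t in a..x, g t) + (∫ t in a..x, f t) * g x)
        volume a b := fun hf hg =>
    (hf.mul_continuousOn (continuousOn_integral_left hg)).add
      (hg.continuousOn_mul (continuousOn_integral_left hf))
  have hsub : ∀ {f : ℝ → ℂ}, IntervalIntegrable f volume a b → ∀ x ∈ Set.uIcc a b,
      IntervalIntegrable f volume a x := fun hf x hx =>
    hf.mono_set (Set.uIcc_subset_uIcc Set.left_mem_uIcc hx)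
  -- Reduction to the real case by bilinearity: `base` treats complex multiples of real functions,
  -- `addl` adds in the first argument, and `swap` carries this over to the second.
  have addl : ∀ f₁ f₂ g : ℝ → ℂ, IntervalIntegrable f₁ volume a b →
      IntervalIntegrable f₂ volume a b →
      IntervalIntegrable g volume a b →
      ∫ x in a..b, (f₁ x * (∫ t in a..x, g t) + (∫ t in a..x, f₁ t) * g x) =
        (∫ t in a..b, f₁ t) * ∫ t in a..b, g t →
      ∫ x in a..b, (f₂ x * (∫ t in a..x, g t) + (∫ t in a..x, f₂ t) * g x) =
        (∫ t in a..b, f₂ t) * ∫ t in a..b, g t →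
      ∫ x in a..b, ((f₁ x + f₂ x) * (∫ t in a..x, g t) + (∫ t in a..x, (f₁ t + f₂ t)) * g x) =
        (∫ t in a..b, (f₁ t + f₂ t)) * ∫ t in a..b, g t := by
    intro f₁ f₂ g h₁ h₂ hg e₁ e₂
    rw [intervalIntegral.integral_add h₁ h₂, add_mul, ← e₁, ← e₂,
      ← intervalIntegral.integral_add (key h₁ hg) (key h₂ hg)]
    refine intervalIntegral.integral_congr fun x hx => ?_
    rw [intervalIntegral.integral_add (hsub h₁ x hx) (hsub h₂ x hx)]
    ring
  have base : ∀ (c d : ℂ) (f g : ℝ → ℝ), IntervalIntegrable f volume a b →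
      IntervalIntegrable g volume a b →
      ∫ x in a..b, ((c * (f x : ℂ)) * (∫ t in a..x, d * (g t : ℂ)) +
        (∫ t in a..x, c * (f t : ℂ)) * (d * (g x : ℂ))) =
        (∫ t in a..b, c * (f t : ℂ)) * ∫ t in a..b, d * (g t : ℂ) := by
    intro c d f g hf hg
    have := congrArg (fun r : ℝ => c * d * (r : ℂ)) (integral_mul_primitive_real hf hg)
    simp only [intervalIntegral.integral_const_mul, intervalIntegral.integral_ofReal] at this ⊢
    push_cast at this
    rw [← intervalIntegral.integral_ofReal, ← intervalIntegral.integral_const_mul] at this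
    calc _ = _ := ?_
      _ = _ := this
      _ = _ := by ring
    refine intervalIntegral.integral_congr fun x _ => ?_
    push_cast
    ring
  have swap : ∀ f g : ℝ → ℂ,
      ∫ x in a..b, (f x * (∫ t in a..x, g t) + (∫ t in a..x, f t) * g x) =
        (∫ t in a..b, f t) * ∫ t in a..b, g t →
      ∫ x in a..b, (g x * (∫ t in a..x, f t) + (∫ t in a..x, g t) * f x) =
        (∫ t in a..b, g t) * ∫ t in a..b, f t := by
    intro f g h
    rw [mul_comm, ← h]
    exact intervalIntegral.integral_congr fun x _ => by ring
  have hre : ∀ {f : ℝ → ℂ}, IntervalIntegrable f volume a b →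
      IntervalIntegrable (fun x => (f x).re) volume a b := fun hf =>
    ⟨hf.1.re, hf.2.re⟩
  have him : ∀ {f : ℝ → ℂ}, IntervalIntegrable f volume a b →
      IntervalIntegrable (fun x => (f x).im) volume a b := fun hf =>
    ⟨hf.1.im, hf.2.im⟩
  have hof : ∀ (c : ℂ) {f : ℝ → ℝ}, IntervalIntegrable f volume a b →
      IntervalIntegrable (fun x => c * (f x : ℂ)) volume a b := fun c f hf =>
    IntervalIntegrable.const_mul ⟨hf.1.ofReal, hf.2.ofReal⟩ c
  have hsplit : ∀ f : ℝ → ℂ, f = fun x => 1 * ((f x).re : ℂ) + Complex.I * ((f x).im : ℂ) := by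
    intro f
    ext x
    rw [one_mul, mul_comm, Complex.re_add_im]
  have half : ∀ (c : ℂ) (f : ℝ → ℝ), IntervalIntegrable f volume a b →
      ∫ x in a..b, (g x * (∫ t in a..x, c * (f t : ℂ)) + (∫ t in a..x, g t) * (c * (f x : ℂ))) =
        (∫ t in a..b, g t) * ∫ t in a..b, c * (f t : ℂ) := by
    intro c f hf
    rw [hsplit g]
    exact addl _ _ _ (hof _ (hre hg)) (hof _ (him hg)) (hof _ hf) (base _ _ _ _ (hre hg) hf)
      (base _ _ _ _ (him hg) hf)
  rw [hsplit f]
  exact addl _ _ _ (hof _ (hre hf)) (hof _ (him hf)) hg (swap _ _ (half _ _ (hre hf)))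
    (swap _ _ (half _ _ (him hf)))

/-- On the set `s` the function `u` is an indefinite integral of `u'`. -/
def HasIntDerivOn (s : Set ℝ) (u u' : ℝ → ℂ) : Prop :=
  ∀ x ∈ s, ∀ y ∈ s, IntervalIntegrable u' volume x y ∧ u y - u x = ∫ t in x..y, u' t

namespace HasIntDerivOn

variable {s : Set ℝ} {u u' v v' : ℝ → ℂ}

theorem add (hu : HasIntDerivOn s u u') (hv : HasIntDerivOn s v v') :
    HasIntDerivOn s (fun x => u x + v x) (fun x => u' x + v' x) := by
  intro x hx y hy
  obtain ⟨a, b⟩ := hu x hx y hy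
  obtain ⟨c, d⟩ := hv x hx y hy
  refine ⟨a.add c, ?_⟩
  rw [intervalIntegral.integral_add a c, ← b, ← d]
  ring

theorem const_mul (c : ℂ) (hu : HasIntDerivOn s u u') :
    HasIntDerivOn s (fun x => c * u x) (fun x => c * u' x) := by
  intro x hx y hy
  obtain ⟨a, b⟩ := hu x hx y hy
  refine ⟨a.const_mul c, ?_⟩
  rw [intervalIntegral.integral_const_mul, ← b]
  ring

theorem sub (hu : HasIntDerivOn s u u') (hv : HasIntDerivOn s v v') :
    HasIntDerivOn s (fun x => u x - v x) (fun x => u' x - v' x) := by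
  have := hu.add (hv.const_mul (-1))
  simpa [sub_eq_add_neg] using this

theorem star (hu : HasIntDerivOn s u u') :
    HasIntDerivOn s (fun x => starRingEnd ℂ (u x)) (fun x => starRingEnd ℂ (u' x)) := by
  intro x hx y hy
  obtain ⟨a, b⟩ := hu x hx y hy
  refine ⟨⟨?_, ?_⟩, ?_⟩
  · exact (Complex.conjCLE.toContinuousLinearMap).integrable_comp a.1
  · exact (Complex.conjCLE.toContinuousLinearMap).integrable_comp a.2
  · rw [← map_sub, b, intervalIntegral, intervalIntegral, map_sub, integral_conj, integral_conj]

theorem of_hasDerivAt (h : ∀ x, HasDerivAt u (u' x) x) (hc : Continuous u') :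
    HasIntDerivOn s u u' := fun x _ y _ =>
  ⟨hc.intervalIntegrable x y,
    (intervalIntegral.integral_eq_sub_of_hasDerivAt (fun t _ => h t)
      (hc.intervalIntegrable x y)).symm⟩

theorem continuousOn_uIcc (hs : s.OrdConnected) (hu : HasIntDerivOn s u u') {x y : ℝ} (hx : x ∈ s)
    (hy : y ∈ s) : ContinuousOn u (Set.uIcc x y) := by
  have h1 := continuousOn_integral_left (hu x hx y hy).1
  have h2 : ContinuousOn (fun t => u x + ∫ r in x..t, u' r) (Set.uIcc x y) :=
    continuousOn_const.add h1
  refine h2.congr fun t ht => ?_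
  have ht' := hs.uIcc_subset hx hy ht
  beta_reduce
  rw [← (hu x hx t ht').2]
  ring

theorem mul (hs : s.OrdConnected) (hu : HasIntDerivOn s u u') (hv : HasIntDerivOn s v v') :
    HasIntDerivOn s (fun x => u x * v x) (fun x => u' x * v x + u x * v' x) := by
  intro x hx y hy
  obtain ⟨a, b⟩ := hu x hx y hy
  obtain ⟨c, d⟩ := hv x hx y hy
  have cu := hu.continuousOn_uIcc hs hx hy
  have cv := hv.continuousOn_uIcc hs hx hy
  refine ⟨(a.mul_continuousOn cv).add (c.continuousOn_mul cu), ?_⟩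
  -- Writing `u` and `v` as their values at `x` plus primitives splits the integrand into the case
  -- of pure primitives and terms with constant factors.
  have h1 : ∫ t in x..y, (u' t * v t + u t * v' t) =
      ∫ t in x..y, ((u' t * (∫ r in x..t, v' r) + (∫ r in x..t, u' r) * v' t) +
        (v x * u' t + u x * v' t)) := by
    refine intervalIntegral.integral_congr fun t ht => ?_
    have ht' := hs.uIcc_subset hx hy ht
    rw [← (hu x hx t ht').2, ← (hv x hx t ht').2]
    ring
  rw [h1, intervalIntegral.integral_add, integral_mul_primitive a c,
    intervalIntegral.integral_add (a.const_mul _) (c.const_mul _),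
    intervalIntegral.integral_const_mul, intervalIntegral.integral_const_mul, ← b, ← d]
  · ring
  · exact (a.mul_continuousOn (continuousOn_integral_left c)).add
      (c.continuousOn_mul (continuousOn_integral_left a))
  · exact (a.const_mul _).add (c.const_mul _)

/-- An indefinite integral that vanishes on `s` has vanishing derivative. -/
theorem ae_eq_zero {a b : ℝ} (hab : a ≤ b) (hu : HasIntDerivOn (Set.Icc a b) u u')
    (h0 : ∀ x ∈ Set.Icc a b, u x = 0) : u' =ᵐ[volume.restrict (Set.Icc a b)] 0 := by
  have ha : a ∈ Set.Icc a b := Set.left_mem_Icc.2 hab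
  have hi := (hu a ha b (Set.right_mem_Icc.2 hab)).1
  rw [← restrict_Ioo_eq_restrict_Icc, EventuallyEq, ae_restrict_iff' measurableSet_Ioo]
  filter_upwards [hi.ae_hasDerivAt_integral] with x hx hxm
  rw [Set.uIcc_of_le hab] at hx
  have h1 := hx (Set.Ioo_subset_Icc_self hxm) a ha
  have h2 : HasDerivAt (fun x => ∫ t in a..x, u' t) 0 x := by
    refine (hasDerivAt_const x (0 : ℂ)).congr_of_eventuallyEq ?_
    filter_upwards [Ioo_mem_nhds hxm.1 hxm.2] with y hy
    have hy' := Set.Ioo_subset_Icc_self hy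
    rw [← (hu a ha y hy').2, h0 a ha, h0 y hy', sub_zero]
  exact h1.unique h2

theorem hasDerivAt {x : ℝ} (hu : HasIntDerivOn Set.univ u u') (hc : Continuous u') :
    HasDerivAt u (u' x) x := by
  have h1 := intervalIntegral.integral_hasDerivAt_right (hc.intervalIntegrable x x)
    (hc.stronglyMeasurableAtFilter _ _) hc.continuousAt
  have h2 := h1.const_add (u x)
  refine h2.congr_of_eventuallyEq (Eventually.of_forall fun y => ?_)
  beta_reduce
  rw [← (hu x trivial y trivial).2]
  ring

theorem continuous (hu : HasIntDerivOn Set.univ u u') : Continuous u := by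
  refine continuous_iff_continuousAt.2 fun x => ?_
  have h := hu.continuousOn_uIcc Set.ordConnected_univ (x := x - 1) (y := x + 1) trivial trivial
  rw [Set.uIcc_of_le (by linarith)] at h
  exact h.continuousAt (Icc_mem_nhds (by linarith) (by linarith))

end HasIntDerivOn

theorem HasSecondDerivOn.left {s : Set ℝ} {u u' w : ℝ → ℂ} (h : HasSecondDerivOn s u u' w) :
    HasIntDerivOn s u u' := fun x hx y hy => ⟨(h x hx y hy).1, (h x hx y hy).2.2.1⟩

theorem HasSecondDerivOn.right {s : Set ℝ} {u u' w : ℝ → ℂ} (h : HasSecondDerivOn s u u' w) :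
    HasIntDerivOn s u' w := fun x hx y hy => ⟨(h x hx y hy).2.1, (h x hx y hy).2.2.2⟩

theorem HasIntDerivOn.hasSecondDerivOn {s : Set ℝ} {u u' w : ℝ → ℂ} (h : HasIntDerivOn s u u')
    (h' : HasIntDerivOn s u' w) : HasSecondDerivOn s u u' w := fun x hx y hy =>
  ⟨(h x hx y hy).1, (h' x hx y hy).1, (h x hx y hy).2, (h' x hx y hy).2⟩

theorem HasSecondDerivOn.mono {s t : Set ℝ} {u u' w : ℝ → ℂ} (h : HasSecondDerivOn s u u' w)
    (hts : t ⊆ s) : HasSecondDerivOn t u u' w := fun x hx y hy => h x (hts hx) y (hts hy)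

/-- A continuous function that vanishes almost everywhere vanishes, and then so does its derivative;
this is applied to `u` and to `u'`. It makes the graphs of `-d²/dx²` single-valued. -/
theorem HasSecondDerivOn.ae_eq_zero {a b : ℝ} (hab : a < b) {u u' w : ℝ → ℂ}
    (h : HasSecondDerivOn (Set.Icc a b) u u' w) (h0 : u =ᵐ[volume.restrict (Set.Icc a b)] 0) :
    w =ᵐ[volume.restrict (Set.Icc a b)] 0 := by
  have ha : a ∈ Set.Icc a b := Set.left_mem_Icc.2 hab.le
  have hb : b ∈ Set.Icc a b := Set.right_mem_Icc.2 hab.le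
  have key : ∀ v v' : ℝ → ℂ, HasIntDerivOn (Set.Icc a b) v v' →
      v =ᵐ[volume.restrict (Set.Icc a b)] 0 → ∀ x ∈ Set.Icc a b, v x = 0 := by
    intro v v' hv hv0 x hx
    have hc := hv.continuousOn_uIcc Set.ordConnected_Icc ha hb
    rw [Set.uIcc_of_le hab.le] at hc
    exact Measure.eqOn_Icc_of_ae_eq volume hab.ne hv0 hc continuousOn_const hx
  exact h.right.ae_eq_zero hab.le (key _ _ h.right (h.left.ae_eq_zero hab.le (key _ _ h.left h0)))

/-! ### Plane waves -/

theorem planeWave_zero_apply (k : ℂ) (x : ℝ) :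
    planeWave 0 k x = Complex.exp (Complex.I * k * x) := by
  simp [planeWave]

theorem planeWave_one_apply (k : ℂ) (x : ℝ) :
    planeWave 1 k x = Complex.exp (-(Complex.I * k * x)) := by
  simp [planeWave]

theorem continuous_planeWave (j : Fin 2) (k : ℂ) : Continuous (planeWave j k) := by
  unfold planeWave
  fun_prop

theorem planeWave_mul_planeWave (k : ℂ) (x : ℝ) : planeWave 0 k x * planeWave 1 k x = 1 := by
  rw [planeWave_zero_apply, planeWave_one_apply, ← Complex.exp_add, add_neg_cancel,
    Complex.exp_zero]

theorem planeWave_ne_zero (j : Fin 2) (k : ℂ) (x : ℝ) : planeWave j k x ≠ 0 := Complex.exp_ne_zero _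

theorem planeWave_zero_neg (k : ℂ) (x : ℝ) : planeWave 0 k (-x) = planeWave 1 k x := by
  rw [planeWave_zero_apply, planeWave_one_apply]
  congr 1
  push_cast
  ring

theorem planeWave_one_neg (k : ℂ) (x : ℝ) : planeWave 1 k (-x) = planeWave 0 k x := by
  rw [← planeWave_zero_neg, neg_neg]

theorem conj_planeWave_zero (k : ℂ) (x : ℝ) : conj (planeWave 0 (conj k) x) = planeWave 1 k x := by
  rw [planeWave_zero_apply, planeWave_one_apply, ← Complex.exp_conj]
  congr 1
  simp

theorem conj_planeWave_one (k : ℂ) (x : ℝ) : conj (planeWave 1 (conj k) x) = planeWave 0 k x := by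
  rw [planeWave_zero_apply, planeWave_one_apply, ← Complex.exp_conj]
  congr 1
  simp

theorem hasDerivAt_planeWave_zero (k : ℂ) (x : ℝ) :
    HasDerivAt (planeWave 0 k) (Complex.I * k * planeWave 0 k x) x := by
  have h1 : HasDerivAt (fun t : ℝ => Complex.I * k * (t : ℂ)) (Complex.I * k) x := by
    simpa using (Complex.ofRealCLM.hasDerivAt (x := x)).const_mul (Complex.I * k)
  have h2 := h1.cexp
  simp_rw [← planeWave_zero_apply] at h2
  rwa [mul_comm] at h2

theorem hasDerivAt_planeWave_one (k : ℂ) (x : ℝ) :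
    HasDerivAt (planeWave 1 k) (-(Complex.I * k * planeWave 1 k x)) x := by
  have h1 : HasDerivAt (fun t : ℝ => -(Complex.I * k * (t : ℂ))) (-(Complex.I * k)) x := by
    simpa using (Complex.ofRealCLM.hasDerivAt (x := x)).const_mul (-(Complex.I * k))
  have h2 := h1.cexp
  simp_rw [← planeWave_one_apply] at h2
  rwa [mul_comm, neg_mul] at h2

theorem hasIntDerivOn_planeWave_zero (s : Set ℝ) (k : ℂ) :
    HasIntDerivOn s (planeWave 0 k) (fun x => Complex.I * k * planeWave 0 k x) :=
  .of_hasDerivAt (hasDerivAt_planeWave_zero k) (by have := continuous_planeWave 0 k; fun_prop)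

theorem hasIntDerivOn_planeWave_one (s : Set ℝ) (k : ℂ) :
    HasIntDerivOn s (planeWave 1 k) (fun x => -(Complex.I * k * planeWave 1 k x)) :=
  .of_hasDerivAt (hasDerivAt_planeWave_one k) (by have := continuous_planeWave 1 k; fun_prop)

/-- Linear combinations of plane waves solve `u'' = -k² u`. -/
theorem hasSecondDerivOn_planeWaves (s : Set ℝ) (k a b : ℂ) :
    HasSecondDerivOn s (fun x => a * planeWave 0 k x + b * planeWave 1 k x)
      (fun x => Complex.I * k * (a * planeWave 0 k x - b * planeWave 1 k x))
      (fun x => -(k ^ 2 * (a * planeWave 0 k x + b * planeWave 1 k x))) := by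
  have h0 := hasIntDerivOn_planeWave_zero s k
  have h1 := hasIntDerivOn_planeWave_one s k
  refine HasIntDerivOn.hasSecondDerivOn ?_ ?_
  · convert (h0.const_mul a).add (h1.const_mul b) using 1
    ext x
    ring
  · convert ((h0.const_mul a).sub (h1.const_mul b)).const_mul (Complex.I * k) using 1
    ext x
    linear_combination (-(k ^ 2 * (a * planeWave 0 k x + b * planeWave 1 k x))) * Complex.I_sq

/-! ### Green's identity and variation of constants -/

namespace HasSecondDerivOn

variable {s : Set ℝ} {u u' w v v' w' : ℝ → ℂ}

/-- The terms `u' v'` cancel. In integrated form this is Green's identity, the source of all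
symmetry and energy relations below. -/
theorem wronskian (hs : s.OrdConnected) (hu : HasSecondDerivOn s u u' w)
    (hv : HasSecondDerivOn s v v' w') :
    HasIntDerivOn s (fun x => u x * v' x - u' x * v x) (fun x => u x * w' x - w x * v x) := by
  convert (hu.left.mul hs hv.right).sub (hu.right.mul hs hv.left) using 1
  ext x
  ring

theorem star (hu : HasSecondDerivOn s u u' w) :
    HasSecondDerivOn s (fun x => conj (u x)) (fun x => conj (u' x)) (fun x => conj (w x)) :=
  hu.left.star.hasSecondDerivOn hu.right.star

/-- The combination `u' - ik u` annihilates `e^{ikx}`, so the quantity is `-2ik` times the local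
amplitude of `e^{-ikx}` and changes only through the source `u'' + k² u`. -/
theorem incoming (hs : s.OrdConnected) (hu : HasSecondDerivOn s u u' w) (k : ℂ) :
    HasIntDerivOn s (fun x => planeWave 0 k x * (u' x - Complex.I * k * u x))
      (fun x => planeWave 0 k x * (w x + k ^ 2 * u x)) := by
  convert (hasIntDerivOn_planeWave_zero s k).mul hs
    (hu.right.sub (hu.left.const_mul (Complex.I * k))) using 1
  ext x
  linear_combination planeWave 0 k x * k ^ 2 * u x * Complex.I_sq

/-- The mirror image: `2ik` times the local amplitude of `e^{ikx}`. -/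
theorem outgoing (hs : s.OrdConnected) (hu : HasSecondDerivOn s u u' w) (k : ℂ) :
    HasIntDerivOn s (fun x => planeWave 1 k x * (u' x + Complex.I * k * u x))
      (fun x => planeWave 1 k x * (w x + k ^ 2 * u x)) := by
  convert (hasIntDerivOn_planeWave_one s k).mul hs
    (hu.right.add (hu.left.const_mul (Complex.I * k))) using 1
  ext x
  linear_combination planeWave 1 k x * k ^ 2 * u x * Complex.I_sq

/-- The amplitude of `e^{ikx}` is transported from `a` and that of `e^{-ikx}` from `b`. With `a`,
`b` the ends of the box, outgoing conditions make both boundary terms vanish. -/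
theorem variation_of_constants (hs : s.OrdConnected) (hu : HasSecondDerivOn s u u' w) (k : ℂ)
    {a b x : ℝ} (ha : a ∈ s) (hb : b ∈ s) (hx : x ∈ s) :
    2 * Complex.I * k * u x =
      planeWave 0 k x * (planeWave 1 k a * (u' a + Complex.I * k * u a) +
        ∫ t in a..x, planeWave 1 k t * (w t + k ^ 2 * u t)) -
      planeWave 1 k x * (planeWave 0 k b * (u' b - Complex.I * k * u b) -
        ∫ t in x..b, planeWave 0 k t * (w t + k ^ 2 * u t)) := by
  rw [← (hu.outgoing hs k a ha x hx).2, ← (hu.incoming hs k x hx b hb).2]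
  linear_combination (-2 * Complex.I * k * u x) * planeWave_mul_planeWave k x

/-- Solutions of `u'' = -k² u` are linear combinations of plane waves. -/
theorem exists_eq_planeWaves (hs : s.OrdConnected) {k : ℂ} (hk : k ≠ 0)
    (hu : HasSecondDerivOn s u u' w) (hw : ∀ x ∈ s, ∀ y ∈ s,
      w =ᵐ[volume.restrict (Set.uIoc x y)] fun x => -(k ^ 2 * u x)) :
    ∃ a b : ℂ, ∀ x ∈ s, u x = a * planeWave 0 k x + b * planeWave 1 k x ∧
      u' x = Complex.I * k * (a * planeWave 0 k x - b * planeWave 1 k x) := by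
  rcases s.eq_empty_or_nonempty with rfl | ⟨x₀, hx₀⟩
  · exact ⟨0, 0, by simp⟩
  have hk2 : 2 * Complex.I * k ≠ 0 := by simp [hk]
  set p := planeWave 0 k x₀ * (u' x₀ - Complex.I * k * u x₀)
  set q := planeWave 1 k x₀ * (u' x₀ + Complex.I * k * u x₀)
  refine ⟨q / (2 * Complex.I * k), -p / (2 * Complex.I * k), fun x hx => ?_⟩
  have hz : ∀ j, ∫ t in x₀..x, planeWave j k t * (w t + k ^ 2 * u t) = 0 := by
    intro j
    rw [intervalIntegral.integral_zero_ae]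
    have := hw x₀ hx₀ x hx
    rw [EventuallyEq, ae_restrict_iff' measurableSet_uIoc] at this
    filter_upwards [this] with t ht htm
    rw [ht htm]
    ring
  have hq := (hu.outgoing hs k x₀ hx₀ x hx).2
  have hp := (hu.incoming hs k x₀ hx₀ x hx).2
  rw [hz, sub_eq_zero] at hq hp
  beta_reduce at hq hp
  have hpw := planeWave_mul_planeWave k x
  rw [show planeWave 1 k x₀ * (u' x₀ + Complex.I * k * u x₀) = q from rfl] at hq
  rw [show planeWave 0 k x₀ * (u' x₀ - Complex.I * k * u x₀) = p from rfl] at hp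
  constructor
  · rw [div_mul_eq_mul_div, div_mul_eq_mul_div, ← add_div, eq_div_iff hk2]
    rw [← hq, ← hp]
    linear_combination (-2 * Complex.I * k * u x) * hpw
  · rw [div_mul_eq_mul_div, div_mul_eq_mul_div, ← sub_div, mul_div_assoc', eq_div_iff hk2]
    rw [← hq, ← hp]
    linear_combination (-2 * Complex.I * k * u' x) * hpw

end HasSecondDerivOn

/-! ### The outgoing solution of `u'' + k² u = h` -/

/-- The kernel of the free resolvent `(k² + d²/dx²)⁻¹`. -/
def freeKernel (k : ℂ) (x y : ℝ) : ℂ :=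
  1 / (2 * Complex.I * k) * Complex.exp (Complex.I * k * ((|x - y| : ℝ) : ℂ))

theorem freeKernel_of_le (k : ℂ) {x y : ℝ} (h : y ≤ x) :
    freeKernel k x y = 1 / (2 * Complex.I * k) * (planeWave 0 k x * planeWave 1 k y) := by
  rw [freeKernel, abs_of_nonneg (by linarith), planeWave_zero_apply, planeWave_one_apply,
    ← Complex.exp_add]
  congr 2
  push_cast
  ring

theorem freeKernel_of_ge (k : ℂ) {x y : ℝ} (h : x ≤ y) :
    freeKernel k x y = 1 / (2 * Complex.I * k) * (planeWave 1 k x * planeWave 0 k y) := by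
  rw [freeKernel, abs_of_nonpos (by linarith), planeWave_zero_apply, planeWave_one_apply,
    ← Complex.exp_add]
  congr 2
  push_cast
  ring

/-- The outgoing solution of `u'' + k² u = h` on the line. -/
def freeSol (k : ℂ) (h : ℝ → ℂ) (x : ℝ) : ℂ :=
  1 / (2 * Complex.I * k) * (planeWave 0 k x * (∫ y in Set.Iic x, planeWave 1 k y * h y) +
    planeWave 1 k x * ∫ y in Set.Ioi x, planeWave 0 k y * h y)

/-- The derivative of `freeSol`. -/
def freeSolDeriv (k : ℂ) (h : ℝ → ℂ) (x : ℝ) : ℂ :=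
  1 / 2 * (planeWave 0 k x * (∫ y in Set.Iic x, planeWave 1 k y * h y) -
    planeWave 1 k x * ∫ y in Set.Ioi x, planeWave 0 k y * h y)

/-- The integrability needed for `freeSol k h`. -/
def FreeIntegrable (k : ℂ) (h : ℝ → ℂ) : Prop :=
  ∀ x, IntegrableOn (fun y => planeWave 1 k y * h y) (Set.Iic x) ∧
    IntegrableOn (fun y => planeWave 0 k y * h y) (Set.Ioi x)

theorem hasIntDerivOn_integral_Iic {g : ℝ → ℂ} (hg : ∀ x, IntegrableOn g (Set.Iic x)) :
    HasIntDerivOn Set.univ (fun x => ∫ y in Set.Iic x, g y) g := fun x _ y _ =>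
  ⟨⟨(hg y).mono_set Set.Ioc_subset_Iic_self, (hg x).mono_set Set.Ioc_subset_Iic_self⟩,
    intervalIntegral.integral_Iic_sub_Iic (hg x) (hg y)⟩

theorem hasIntDerivOn_integral_Ioi {g : ℝ → ℂ} (hg : ∀ x, IntegrableOn g (Set.Ioi x)) :
    HasIntDerivOn Set.univ (fun x => ∫ y in Set.Ioi x, g y) (fun y => -g y) := by
  intro x _ y _
  have hi : IntervalIntegrable g volume x y :=
    ⟨(hg x).mono_set Set.Ioc_subset_Ioi_self, (hg y).mono_set Set.Ioc_subset_Ioi_self⟩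
  refine ⟨hi.neg, ?_⟩
  rw [intervalIntegral.integral_neg, ← intervalIntegral.integral_Ioi_sub_Ioi' (hg x) (hg y)]
  ring

/-- The contributions of the two moving endpoints cancel in `u'` and add up to `h` in `u''`, because
the plane waves are reciprocal to each other. -/
theorem hasSecondDerivOn_freeSol {k : ℂ} (hk : k ≠ 0) {h : ℝ → ℂ} (hh : FreeIntegrable k h) :
    HasSecondDerivOn Set.univ (freeSol k h) (freeSolDeriv k h)
      (fun x => h x - k ^ 2 * freeSol k h x) := by
  have hP := (hasIntDerivOn_planeWave_zero Set.univ k).mul Set.ordConnected_univ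
    (hasIntDerivOn_integral_Iic fun x => (hh x).1)
  have hQ := (hasIntDerivOn_planeWave_one Set.univ k).mul Set.ordConnected_univ
    (hasIntDerivOn_integral_Ioi fun x => (hh x).2)
  refine HasIntDerivOn.hasSecondDerivOn ?_ ?_
  · convert (hP.add hQ).const_mul (1 / (2 * Complex.I * k)) using 1
    · rfl
    ext x
    rw [freeSolDeriv]
    field_simp
    ring
  · convert (hP.sub hQ).const_mul (1 / 2) using 1
    · rfl
    ext x
    have hpw := planeWave_mul_planeWave k x
    have hI := Complex.I_sq
    have hI0 := Complex.I_ne_zero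
    rw [freeSol]
    field_simp
    linear_combination (-2 * h x * Complex.I) * hpw -
      k * (planeWave 0 k x * (∫ y in Set.Iic x, planeWave 1 k y * h y) +
    planeWave 1 k x * ∫ y in Set.Ioi x, planeWave 0 k y * h y) * hI

theorem freeSol_eq_integral {k : ℂ} {h : ℝ → ℂ} (hh : FreeIntegrable k h) (x : ℝ) :
    freeSol k h x = ∫ y, freeKernel k x y * h y := by
  have h1 : ∫ y in Set.Iic x, freeKernel k x y * h y = ∫ y in Set.Iic x,
      1 / (2 * Complex.I * k) * planeWave 0 k x * (planeWave 1 k y * h y) :=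
    setIntegral_congr_fun measurableSet_Iic fun y hy => by
      rw [freeKernel_of_le k hy]; ring
  have h2 : ∫ y in Set.Ioi x, freeKernel k x y * h y = ∫ y in Set.Ioi x,
      1 / (2 * Complex.I * k) * planeWave 1 k x * (planeWave 0 k y * h y) :=
    setIntegral_congr_fun measurableSet_Ioi fun y hy => by
      rw [freeKernel_of_ge k (le_of_lt hy)]; ring
  have i1 : IntegrableOn (fun y => freeKernel k x y * h y) (Set.Iic x) :=
    IntegrableOn.congr_fun ((hh x).1.const_mul (1 / (2 * Complex.I * k) * planeWave 0 k x))
      (fun y hy => by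
      rw [freeKernel_of_le k hy]; ring) measurableSet_Iic
  have i2 : IntegrableOn (fun y => freeKernel k x y * h y) (Set.Ioi x) :=
    IntegrableOn.congr_fun ((hh x).2.const_mul (1 / (2 * Complex.I * k) * planeWave 1 k x))
      (fun y hy => by
      rw [freeKernel_of_ge k (le_of_lt hy)]; ring) measurableSet_Ioi
  rw [← intervalIntegral.integral_Iic_add_Ioi i1 i2, h1, h2, integral_const_mul,
    integral_const_mul, freeSol]
  ring

/-- A function supported on `[-L, L]` and integrable there. -/
theorem freeIntegrable_indicator (L : ℝ) (k : ℂ) {h : ℝ → ℂ}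
    (hh : IntegrableOn h (Set.Icc (-L) L)) :
    FreeIntegrable k ((Set.Icc (-L) L).indicator h) := by
  have key : ∀ j, Integrable (fun y => planeWave j k y * (Set.Icc (-L) L).indicator h y) := by
    intro j
    have h1 : (fun y => planeWave j k y * (Set.Icc (-L) L).indicator h y) =
        (Set.Icc (-L) L).indicator fun y => planeWave j k y * h y := by
      ext y
      by_cases hy : y ∈ Set.Icc (-L) L <;> simp [hy]
    rw [h1, integrable_indicator_iff measurableSet_Icc]
    exact hh.continuousOn_mul (continuous_planeWave j k).continuousOn isCompact_Icc
  exact fun x => ⟨(key 1).integrableOn, (key 0).integrableOn⟩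

section Box

variable {L : ℝ} {k : ℂ} {h : ℝ → ℂ}

theorem planeWave_mul_indicator (j : Fin 2) :
    (fun y => planeWave j k y * (Set.Icc (-L) L).indicator h y) =
    (Set.Icc (-L) L).indicator fun y => planeWave j k y * h y := by
  ext y
  by_cases hy : y ∈ Set.Icc (-L) L <;> simp [hy]

theorem setIntegral_planeWave_indicator (j : Fin 2) {s : Set ℝ} :
    ∫ y in s, planeWave j k y * (Set.Icc (-L) L).indicator h y =
      ∫ y in s ∩ Set.Icc (-L) L, planeWave j k y * h y := by
  rw [planeWave_mul_indicator, setIntegral_indicator measurableSet_Icc]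

/-- Right of the support of the source only the outgoing wave survives; its amplitude is what later
becomes a scattering coefficient. -/
theorem freeSol_of_ge {x : ℝ} (hx : L ≤ x) :
    freeSol k ((Set.Icc (-L) L).indicator h) x = 1 / (2 * Complex.I * k) *
      (∫ y in Set.Icc (-L) L, planeWave 1 k y * h y) * planeWave 0 k x ∧
    freeSolDeriv k ((Set.Icc (-L) L).indicator h) x = 1 / 2 *
      (∫ y in Set.Icc (-L) L, planeWave 1 k y * h y) * planeWave 0 k x := by
  have h1 : Set.Iic x ∩ Set.Icc (-L) L = Set.Icc (-L) L := by
    rw [Set.inter_eq_right]; exact fun y hy => hy.2.trans hx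
  have h2 : Set.Ioi x ∩ Set.Icc (-L) L = ∅ := by
    ext y; simp only [Set.mem_inter_iff, Set.mem_Ioi, Set.mem_Icc, Set.mem_empty_iff_false]
    constructor
    · rintro ⟨h1, h2, h3⟩; linarith
    · exact False.elim
  rw [freeSol, freeSolDeriv, setIntegral_planeWave_indicator, setIntegral_planeWave_indicator,
    h1, h2, setIntegral_empty]
  constructor <;> ring

theorem freeSol_of_le {x : ℝ} (hx : x ≤ -L) :
    freeSol k ((Set.Icc (-L) L).indicator h) x = 1 / (2 * Complex.I * k) *
      (∫ y in Set.Icc (-L) L, planeWave 0 k y * h y) * planeWave 1 k x ∧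
    freeSolDeriv k ((Set.Icc (-L) L).indicator h) x = -(1 / 2 *
      (∫ y in Set.Icc (-L) L, planeWave 0 k y * h y) * planeWave 1 k x) := by
  have h0 : Set.Ici x ∩ Set.Icc (-L) L = Set.Icc (-L) L := by
    rw [Set.inter_eq_right]; exact fun y hy => hx.trans hy.1
  have h1 : ∫ y in Set.Ioi x, planeWave 0 k y * (Set.Icc (-L) L).indicator h y =
      ∫ y in Set.Icc (-L) L, planeWave 0 k y * h y := by
    rw [← integral_Ici_eq_integral_Ioi, setIntegral_planeWave_indicator, h0]
  -- For `x = -L` the intersection is the single point `-L`, which is a null set.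
  have h2 : ∫ y in Set.Iic x ∩ Set.Icc (-L) L, planeWave 1 k y * h y = 0 := by
    refine setIntegral_measure_zero _ (measure_mono_null (t := {x}) ?_ Real.volume_singleton)
    rintro y ⟨h1, h2, h3⟩
    rw [Set.mem_Iic] at h1
    exact le_antisymm h1 (by linarith)
  rw [freeSol, freeSolDeriv, h1, setIntegral_planeWave_indicator, h2]
  constructor <;> ring

theorem freeSol_of_mem {x : ℝ} (hx : x ∈ Set.Icc (-L) L) :
    freeSol k ((Set.Icc (-L) L).indicator h) x = 1 / (2 * Complex.I * k) *
      (planeWave 0 k x * (∫ y in (-L)..x, planeWave 1 k y * h y) +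
        planeWave 1 k x * ∫ y in x..L, planeWave 0 k y * h y) := by
  have h1 : Set.Iic x ∩ Set.Icc (-L) L = Set.Icc (-L) x := by
    ext y
    simp only [Set.mem_inter_iff, Set.mem_Iic, Set.mem_Icc]
    exact ⟨fun ⟨a, b, _⟩ => ⟨b, a⟩, fun ⟨a, b⟩ => ⟨b, a, b.trans hx.2⟩⟩
  have h2 : Set.Ioi x ∩ Set.Icc (-L) L = Set.Ioc x L := by
    ext y
    simp only [Set.mem_inter_iff, Set.mem_Ioi, Set.mem_Icc, Set.mem_Ioc]
    exact ⟨fun ⟨a, _, b⟩ => ⟨a, b⟩, fun ⟨a, b⟩ => ⟨a, hx.1.trans a.le, b⟩⟩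
  rw [freeSol, setIntegral_planeWave_indicator, setIntegral_planeWave_indicator,
    h1, h2, intervalIntegral.integral_of_le hx.1, intervalIntegral.integral_of_le hx.2,
    integral_Icc_eq_integral_Ioc]

/-- The outgoing boundary conditions determine the solution of `u'' + k² u = h` on `[-L, L]`. -/
theorem eq_freeSol_of_outgoing (hL : 0 < L) (hk : k ≠ 0) {u u' w : ℝ → ℂ}
    (hu : HasSecondDerivOn (Set.Icc (-L) L) u u' w)
    (hw : ∀ᵐ t ∂(volume.restrict (Set.Icc (-L) L)), w t + k ^ 2 * u t = h t)
    (h1 : u' L = Complex.I * k * u L) (h2 : u' (-L) = -(Complex.I * k * u (-L)))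
    {x : ℝ} (hx : x ∈ Set.Icc (-L) L) :
    u x = freeSol k ((Set.Icc (-L) L).indicator h) x := by
  have hl : -L ∈ Set.Icc (-L) L := ⟨le_rfl, by linarith⟩
  have hr : L ∈ Set.Icc (-L) L := ⟨by linarith, le_rfl⟩
  have hk2 : 2 * Complex.I * k ≠ 0 := by simp [hk]
  have hv := hu.variation_of_constants Set.ordConnected_Icc k hl hr hx
  have hi : ∀ j, ∀ a ∈ Set.Icc (-L) L, ∀ b ∈ Set.Icc (-L) L,
      ∫ t in a..b, planeWave j k t * (w t + k ^ 2 * u t) = ∫ t in a..b, planeWave j k t * h t := by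
    intro j a ha b hb
    refine intervalIntegral.integral_congr_ae_restrict ?_
    have hsub : Set.uIoc a b ⊆ Set.Icc (-L) L :=
      Set.uIoc_subset_uIcc.trans (Set.ordConnected_Icc.uIcc_subset ha hb)
    filter_upwards [ae_restrict_of_ae_restrict_of_subset hsub hw] with t ht
    rw [ht]
  rw [hi 1 _ hl _ hx, hi 0 _ hx _ hr, h1, h2] at hv
  rw [freeSol_of_mem hx, one_div, inv_mul_eq_div, eq_div_iff hk2]
  linear_combination hv

end Box

/-! ### Multiplication operators -/

/-- Lebesgue measure on `[-L, L]`. -/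
abbrev boxMeasure (L : ℝ) : Measure ℝ := volume.restrict (Set.Icc (-L) L)

theorem mulOp_coeFn {L : ℝ} {f : ℝ → ℂ} (hf : MemLp f ∞ (boxMeasure L)) (φ : BoxSpace L) :
    mulOp L f φ =ᵐ[boxMeasure L] fun x => f x * φ x := by
  rw [mulOp, dif_pos hf]
  have h1 := (ContinuousLinearMap.mul ℂ ℂ).coeFn_holder (r := 2) (hf.toLp f) φ
  filter_upwards [h1, hf.coeFn_toLp] with x h1 h2
  rw [ContinuousLinearMap.holderL_apply_apply, h1, h2]
  rfl

theorem L2_norm_sq {α : Type*} [MeasurableSpace α] {μ : Measure α} (f : Lp ℂ 2 μ) :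
    ‖f‖ ^ 2 = ∫ x, ‖f x‖ ^ 2 ∂μ := by
  have h : ((‖f‖ ^ 2 : ℝ) : ℂ) = ((∫ x, ‖f x‖ ^ 2 ∂μ : ℝ) : ℂ) := by
    have := inner_self_eq_norm_sq_to_K (𝕜 := ℂ) f
    push_cast
    rw [← integral_complex_ofReal]
    refine this.symm.trans ?_
    rw [L2.inner_def]
    refine integral_congr_ae (Eventually.of_forall fun x => ?_)
    simp only [RCLike.inner_apply']
    rw [RCLike.conj_mul]
    norm_cast
  exact_mod_cast h

theorem adjoint_mulOp_of_real {L : ℝ} {f : ℝ → ℂ} (hf : MemLp f ∞ (boxMeasure L))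
    (hr : ∀ x, conj (f x) = f x) : ContinuousLinearMap.adjoint (mulOp L f) = mulOp L f := by
  symm
  rw [ContinuousLinearMap.eq_adjoint_iff]
  intro φ ψ
  rw [L2.inner_def, L2.inner_def]
  refine integral_congr_ae ?_
  filter_upwards [mulOp_coeFn hf φ, mulOp_coeFn hf ψ] with x h1 h2
  rw [h1, h2, RCLike.inner_apply', RCLike.inner_apply', map_mul, hr]
  ring

theorem exists_ae_bound {V : ℝ → ℝ} (hV : MemLp V ∞ volume) : ∃ C, ∀ᵐ x, |V x| ≤ C := by
  refine ⟨(eLpNormEssSup V volume).toReal,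
    (ae_le_eLpNormEssSup (f := V)).mono fun x hx => ?_⟩
  have h2 : eLpNormEssSup V volume ≠ ∞ := by
    rw [← eLpNorm_exponent_top]; exact hV.2.ne
  have := ENNReal.toReal_mono h2 hx
  simpa using this

theorem memLp_sqrtAbs {V : ℝ → ℝ} (hV : MemLp V ∞ volume) (L : ℝ) :
    MemLp (fun x => (Real.sqrt |V x| : ℂ)) ∞ (boxMeasure L) := by
  have h1 : AEStronglyMeasurable (fun x => (Real.sqrt |V x| : ℂ)) volume :=
    (by fun_prop : Continuous fun r : ℝ => ((Real.sqrt |r| : ℝ) : ℂ)).comp_aestronglyMeasurable hV.1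
  obtain ⟨C, hC⟩ := exists_ae_bound hV
  refine MemLp.restrict _ (memLp_top_of_bound h1 (Real.sqrt C) ?_)
  filter_upwards [hC] with x hx
  rw [Complex.norm_real, Real.norm_of_nonneg (Real.sqrt_nonneg _)]
  exact Real.sqrt_le_sqrt hx

theorem memLp_sign {V : ℝ → ℝ} (hV : MemLp V ∞ volume) (L : ℝ) :
    MemLp (fun x => if V x < 0 then (-1 : ℂ) else 1) ∞ (boxMeasure L) := by
  have hm : Measurable fun r : ℝ => if r < 0 then (-1 : ℂ) else 1 :=
    Measurable.ite measurableSet_Iio measurable_const measurable_const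
  have h1 : AEStronglyMeasurable (fun x => if V x < 0 then (-1 : ℂ) else 1) volume :=
    (hm.comp_aemeasurable hV.1.aemeasurable).aestronglyMeasurable
  refine MemLp.restrict _ (memLp_top_of_bound h1 1 (Eventually.of_forall fun x => ?_))
  split_ifs <;> simp

section PotentialOps

variable {V : ℝ → ℝ}

theorem sqrtAbsOp_coeFn (hV : MemLp V ∞ volume) (L : ℝ) (φ : BoxSpace L) :
    sqrtAbsOp V L φ =ᵐ[boxMeasure L] fun x => (Real.sqrt |V x| : ℂ) * φ x :=
  mulOp_coeFn (memLp_sqrtAbs hV L) φ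

theorem signOp_coeFn (hV : MemLp V ∞ volume) (L : ℝ) (φ : BoxSpace L) :
    signOp V L φ =ᵐ[boxMeasure L] fun x => (if V x < 0 then (-1 : ℂ) else 1) * φ x :=
  mulOp_coeFn (memLp_sign hV L) φ

theorem adjoint_sqrtAbsOp (hV : MemLp V ∞ volume) (L : ℝ) :
    ContinuousLinearMap.adjoint (sqrtAbsOp V L) = sqrtAbsOp V L :=
  adjoint_mulOp_of_real (memLp_sqrtAbs hV L) fun _ => Complex.conj_ofReal _

theorem adjoint_signOp (hV : MemLp V ∞ volume) (L : ℝ) :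
    ContinuousLinearMap.adjoint (signOp V L) = signOp V L :=
  adjoint_mulOp_of_real (memLp_sign hV L) fun x => by split_ifs <;> simp

theorem signOp_mul_signOp (hV : MemLp V ∞ volume) (L : ℝ) : signOp V L * signOp V L = 1 := by
  ext1 φ
  refine Lp.ext ?_
  filter_upwards [signOp_coeFn hV L (signOp V L φ), signOp_coeFn hV L φ] with x h1 h2
  rw [mul_apply_eq_comp, h1, h2, one_apply_eq_self]
  split_ifs <;> simp

/-- `√|V| J √|V|` is the multiplication by `V`. -/
theorem sqrtAbs_sign_sqrtAbs_coeFn (hV : MemLp V ∞ volume) (L : ℝ) (φ : BoxSpace L) :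
    sqrtAbsOp V L (signOp V L (sqrtAbsOp V L φ)) =ᵐ[boxMeasure L] fun x => (V x : ℂ) * φ x := by
  filter_upwards [signOp_coeFn hV L (sqrtAbsOp V L φ), sqrtAbsOp_coeFn hV L φ,
    sqrtAbsOp_coeFn hV L (signOp V L (sqrtAbsOp V L φ))] with x h1 h2 h3
  rw [h3, h1, h2]
  have h4 : (Real.sqrt |V x| : ℂ) * (Real.sqrt |V x| : ℂ) = ((|V x| : ℝ) : ℂ) := by
    rw [← Complex.ofReal_mul, Real.mul_self_sqrt (abs_nonneg _)]
  split_ifs with h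
  · rw [abs_of_neg h] at *
    push_cast at *
    linear_combination (-φ x) * h4
  · rw [abs_of_nonneg (not_lt.1 h)] at *
    linear_combination φ x * h4

end PotentialOps

/-! ### Integral operators with bounded kernels -/

/-- `T` is the integral operator with kernel `g`. -/
def HasKernel (L : ℝ) (T : BoxSpace L →L[ℂ] BoxSpace L) (g : ℝ → ℝ → ℂ) : Prop :=
  ∀ f : BoxSpace L, T f =ᵐ[boxMeasure L] fun x => ∫ y in Set.Icc (-L) L, g x y * f y

theorem HasKernel.unique {L : ℝ} {T T' : BoxSpace L →L[ℂ] BoxSpace L} {g : ℝ → ℝ → ℂ}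
    (h : HasKernel L T g) (h' : HasKernel L T' g) : T = T' := by
  ext1 f
  exact Lp.ext ((h f).trans (h' f).symm)

/-- An operator is determined by its kernel, so the choice made in `kernelOp` is any operator known
to have the kernel. -/
theorem HasKernel.kernelOp {L : ℝ} {T : BoxSpace L →L[ℂ] BoxSpace L} {g : ℝ → ℝ → ℂ}
    (h : HasKernel L T g) : kernelOp L g = T := by
  have hex : ∃ T : BoxSpace L →L[ℂ] BoxSpace L, ∀ f : BoxSpace L,
      T f =ᵐ[volume.restrict (Set.Icc (-L) L)]
        fun x => ∫ y in Set.Icc (-L) L, g x y * (f : ℝ → ℂ) y := ⟨T, h⟩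
  rw [FermiGas.kernelOp, dif_pos hex]
  exact HasKernel.unique hex.choose_spec h

/-- Jointly measurable kernels bounded by `C`. -/
structure BddKernel (C : ℝ) (g : ℝ → ℝ → ℂ) : Prop where
  meas : StronglyMeasurable (Function.uncurry g)
  bound : ∀ x y, ‖g x y‖ ≤ C

namespace BddKernel

variable {C : ℝ} {g : ℝ → ℝ → ℂ}

theorem nonneg (hg : BddKernel C g) : 0 ≤ C := (norm_nonneg _).trans (hg.bound 0 0)

theorem adj (hg : BddKernel C g) : BddKernel C fun x y => conj (g y x) where
  meas := Complex.continuous_conj.comp_stronglyMeasurable (hg.meas.comp_measurable measurable_swap)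
  bound x y := by simpa using hg.bound y x

theorem memLp (hg : BddKernel C g) (L x : ℝ) : MemLp (fun y => conj (g x y)) 2 (boxMeasure L) :=
  MemLp.of_bound (Complex.continuous_conj.comp_stronglyMeasurable
    (hg.meas.comp_measurable measurable_prodMk_left)).aestronglyMeasurable C
    (Eventually.of_forall fun y => by simpa using hg.bound x y)

/-- The vector representing the functional `f ↦ ∫ g x y f y`. -/
def vec (hg : BddKernel C g) (L x : ℝ) : BoxSpace L := (hg.memLp L x).toLp _

theorem integral_eq_inner (hg : BddKernel C g) (L x : ℝ) (f : BoxSpace L) :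
    ∫ y in Set.Icc (-L) L, g x y * f y = inner ℂ (hg.vec L x) f := by
  rw [L2.inner_def]
  refine integral_congr_ae ?_
  filter_upwards [(hg.memLp L x).coeFn_toLp] with y hy
  rw [vec, hy, RCLike.inner_apply', Complex.conj_conj]

theorem exists_norm_vec_le (hg : BddKernel C g) (L : ℝ) :
    ∃ M : ℝ, 0 ≤ M ∧ ∀ x, ‖hg.vec L x‖ ≤ M := by
  refine ⟨_, ?_, fun x => Lp.norm_le_of_ae_bound hg.nonneg ?_⟩
  · have := hg.nonneg
    positivity
  · filter_upwards [(hg.memLp L x).coeFn_toLp] with y hy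
    rw [vec, hy]
    simpa using hg.bound x y

theorem memLp_integral (hg : BddKernel C g) (L : ℝ) (f : BoxSpace L) :
    MemLp (fun x => ∫ y in Set.Icc (-L) L, g x y * f y) 2 (boxMeasure L) := by
  obtain ⟨M, -, hM⟩ := hg.exists_norm_vec_le L
  refine MemLp.of_bound ?_ (M * ‖f‖) (Eventually.of_forall fun x => ?_)
  · have h1 : StronglyMeasurable (Function.uncurry fun x y => g x y * f y) :=
      hg.meas.mul ((Lp.stronglyMeasurable f).comp_measurable measurable_snd)
    exact h1.integral_prod_right.aestronglyMeasurable
  · rw [hg.integral_eq_inner]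
    exact (norm_inner_le_norm _ _).trans (mul_le_mul_of_nonneg_right (hM x) (norm_nonneg _))

theorem exists_hasKernel (hg : BddKernel C g) (L : ℝ) : ∃ T, HasKernel L T g := by
  obtain ⟨M, hM0, hM⟩ := hg.exists_norm_vec_le L
  let T : BoxSpace L →ₗ[ℂ] BoxSpace L :=
    { toFun := fun f => (hg.memLp_integral L f).toLp _
      map_add' := fun f₁ f₂ => by
        rw [← MemLp.toLp_add]
        refine MemLp.toLp_congr _ _ (Eventually.of_forall fun x => ?_)
        simp only [Pi.add_apply, hg.integral_eq_inner, inner_add_right]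
      map_smul' := fun c f => by
        rw [RingHom.id_apply, ← MemLp.toLp_const_smul]
        refine MemLp.toLp_congr _ _ (Eventually.of_forall fun x => ?_)
        simp only [Pi.smul_apply, hg.integral_eq_inner, inner_smul_right, smul_eq_mul] }
  refine ⟨T.mkContinuous ((measureUnivNNReal (boxMeasure L) : ℝ) ^ (2 : ℝ≥0∞).toReal⁻¹ * M) ?_, ?_⟩
  · intro f
    rw [mul_assoc]
    refine Lp.norm_le_of_ae_bound (by positivity) ?_
    filter_upwards [(hg.memLp_integral L f).coeFn_toLp] with x hx
    change ‖((hg.memLp_integral L f).toLp _ : ℝ → ℂ) x‖ ≤ _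
    rw [hx, hg.integral_eq_inner]
    exact (norm_inner_le_norm _ _).trans (mul_le_mul_of_nonneg_right (hM x) (norm_nonneg _))
  · exact fun f => (hg.memLp_integral L f).coeFn_toLp

theorem hasKernel_kernelOp (hg : BddKernel C g) (L : ℝ) : HasKernel L (kernelOp L g) g := by
  obtain ⟨T, hT⟩ := hg.exists_hasKernel L
  rw [hT.kernelOp]
  exact hT

/-- Fubini's theorem, applicable because the kernel is bounded and `L²` functions on the box are
integrable. -/
theorem adjoint (hg : BddKernel C g) {L : ℝ} {T : BoxSpace L →L[ℂ] BoxSpace L}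
    (hT : HasKernel L T g) :
    HasKernel L (ContinuousLinearMap.adjoint T) fun x y => conj (g y x) := by
  obtain ⟨T', hT'⟩ := hg.adj.exists_hasKernel L
  suffices T' = ContinuousLinearMap.adjoint T by rwa [← this]
  rw [ContinuousLinearMap.eq_adjoint_iff]
  intro f h
  have e1 : inner ℂ (T' f) h = ∫ y in Set.Icc (-L) L, ∫ x in Set.Icc (-L) L,
      conj (f x) * g x y * h y := by
    rw [L2.inner_def]
    refine integral_congr_ae ?_
    filter_upwards [hT' f] with y hy
    rw [hy, RCLike.inner_apply', ← integral_conj, ← integral_mul_const]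
    refine integral_congr_ae (Eventually.of_forall fun x => ?_)
    simp only [map_mul, Complex.conj_conj]
    ring
  have e2 : inner ℂ f (T h) = ∫ x in Set.Icc (-L) L, ∫ y in Set.Icc (-L) L,
      conj (f x) * g x y * h y := by
    rw [L2.inner_def]
    refine integral_congr_ae ?_
    filter_upwards [hT h] with x hx
    rw [hx, RCLike.inner_apply', ← integral_const_mul]
    refine integral_congr_ae (Eventually.of_forall fun y => ?_)
    simp only
    ring
  rw [e1, e2]
  refine (integral_integral_swap ?_).symm
  have hf : Integrable (fun x => conj (f x)) (boxMeasure L) :=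
    Complex.conjCLE.toContinuousLinearMap.integrable_comp
      ((Lp.memLp f).integrable one_le_two)
  have hh : Integrable (fun x => h x) (boxMeasure L) := (Lp.memLp h).integrable one_le_two
  have h1 := (hf.mul_prod hh).bdd_mul (c := C) hg.meas.aestronglyMeasurable
    (Eventually.of_forall fun p => hg.bound p.1 p.2)
  refine h1.congr (Eventually.of_forall fun p => ?_)
  simp only [Function.uncurry]
  ring

/-- Integral operators with bounded kernels are Hilbert-Schmidt. -/
theorem summable_norm_sq (hg : BddKernel C g) {L : ℝ} {T : BoxSpace L →L[ℂ] BoxSpace L}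
    (hT : HasKernel L T g) {κ : Type*} (b : HilbertBasis κ ℂ (BoxSpace L)) :
    Summable fun i => ‖T (b i)‖ ^ 2 := by
  obtain ⟨M, hM0, hM⟩ := hg.exists_norm_vec_le L
  refine summable_of_sum_le (c := ∫ _ in Set.Icc (-L) L, M ^ 2) (fun i => sq_nonneg _) fun F => ?_
  have h1 : ∀ i, ‖T (b i)‖ ^ 2 = ∫ x in Set.Icc (-L) L, ‖inner ℂ (hg.vec L x) (b i)‖ ^ 2 := by
    intro i
    rw [L2_norm_sq]
    refine integral_congr_ae ?_
    filter_upwards [hT (b i)] with x hx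
    rw [hx, hg.integral_eq_inner]
  have h2 : ∀ i, Integrable (fun x => ‖inner ℂ (hg.vec L x) (b i)‖ ^ 2) (boxMeasure L) := by
    intro i
    have := (hg.memLp_integral L (b i)).integrable_norm_pow (by norm_num)
    simpa [hg.integral_eq_inner] using this
  simp_rw [h1]
  rw [← integral_finsetSum _ fun i _ => h2 i]
  refine integral_mono (integrable_finsetSum _ fun i _ => h2 i) (integrable_const _) fun x => ?_
  -- Bessel's inequality for the row of the kernel at `x`; integrating over the box bounds all
  -- finite sums at once.
  have h3 := b.orthonormal.sum_inner_products_le (x := hg.vec L x) (s := F)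
  simp only [fun i => norm_inner_symm (𝕜 := ℂ) (hg.vec L x) (b i)]
  exact h3.trans (pow_le_pow_left₀ (norm_nonneg _) (hM x) 2)

end BddKernel

/-! ### Resolvents of operators given by their graphs -/

section Resolvent

variable {H : Type} [NormedAddCommGroup H] [InnerProductSpace ℂ H]

theorem IsResolventAt.unique {T : H →ₗ.[ℂ] H} {z : ℂ} {R R' : H →L[ℂ] H} (h : IsResolventAt T z R)
    (h' : IsResolventAt T z R') : R = R' := by
  ext1 f
  obtain ⟨hm, hf⟩ := h.1 f
  have := h'.2 ⟨R f, hm⟩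
  simp only [hf] at this
  exact this.symm

theorem IsResolventAt.unboundedResolvent_eq {T : H →ₗ.[ℂ] H} {z : ℂ} {R : H →L[ℂ] H}
    (h : IsResolventAt T z R) : unboundedResolvent T z = R := by
  have hex : ∃ R : H →L[ℂ] H, IsResolventAt T z R := ⟨R, h⟩
  rw [unboundedResolvent, dif_pos hex]
  exact hex.choose_spec.unique h

/-- Reduces resolvent questions to membership in the graph; single-valuedness ensures that
`toLinearPMap` really has the given graph. -/
theorem isResolventAt_toLinearPMap_iff {g : Submodule ℂ (H × H)} (hg : ∀ p ∈ g, p.1 = 0 → p.2 = 0)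
    {z : ℂ} {R : H →L[ℂ] H} :
    IsResolventAt g.toLinearPMap z R ↔
      (∀ f, (R f, z • R f - f) ∈ g) ∧ ∀ p ∈ g, R (z • p.1 - p.2) = p.1 := by
  have hval : ∀ p ∈ g, ∃ h : p.1 ∈ g.toLinearPMap.domain, g.toLinearPMap ⟨p.1, h⟩ = p.2 := by
    intro p hp
    have : p ∈ g.toLinearPMap.graph := by rwa [Submodule.toLinearPMap_graph_eq g hg]
    rw [LinearPMap.mem_graph_iff] at this
    obtain ⟨y, h1, h2⟩ := this
    refine ⟨h1 ▸ y.2, ?_⟩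
    rw [← h2]
    congr 1
    exact Subtype.ext h1.symm
  have hmem : ∀ φ : g.toLinearPMap.domain, ((φ : H), g.toLinearPMap φ) ∈ g := fun φ =>
    Submodule.mem_graph_toLinearPMap hg φ
  constructor
  · rintro ⟨h1, h2⟩
    refine ⟨fun f => ?_, fun p hp => ?_⟩
    · obtain ⟨hm, hf⟩ := h1 f
      have := hmem ⟨R f, hm⟩
      have h3 : z • R f - f = g.toLinearPMap ⟨R f, hm⟩ := by
        rw [sub_eq_iff_eq_add, ← sub_eq_iff_eq_add', hf]
      rw [h3]
      exact this
    · obtain ⟨hm, hf⟩ := hval p hp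
      have := h2 ⟨p.1, hm⟩
      rwa [hf] at this
  · rintro ⟨h1, h2⟩
    refine ⟨fun f => ?_, fun φ => h2 _ (hmem φ)⟩
    obtain ⟨hm, hf⟩ := hval _ (h1 f)
    refine ⟨hm, ?_⟩
    simp only at hf
    rw [hf]
    abel

end Resolvent

theorem boxGraph_singleValued (A B : Matrix (Fin 2) (Fin 2) ℂ) {L : ℝ} (hL : 0 < L) :
    ∀ p ∈ boxGraph A B L, p.1 = 0 → p.2 = 0 := by
  rintro ⟨p, q⟩ ⟨u, u', hpu, hu, -⟩ h0
  simp only at h0 hpu hu ⊢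
  subst h0
  have h1 : u =ᵐ[boxMeasure L] 0 := hpu.symm.trans (Lp.coeFn_zero _ _ _)
  have h2 := hu.ae_eq_zero (by linarith) h1
  refine Lp.ext ?_
  filter_upwards [h2, Lp.coeFn_zero ℂ 2 (boxMeasure L)] with x h3 h4
  rw [h4]
  simpa using h3

theorem lineGraph_singleValued : ∀ p ∈ lineGraph, p.1 = 0 → p.2 = 0 := by
  rintro ⟨p, q⟩ ⟨u, u', hpu, hu⟩ h0
  simp only at h0 hpu hu ⊢
  subst h0
  have h1 : u =ᵐ[volume] 0 := hpu.symm.trans (Lp.coeFn_zero _ _ _)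
  have h2 : ∀ n : ℕ, ∀ᵐ x ∂(volume.restrict (Set.Icc (-(n + 1 : ℝ)) (n + 1))),
      -(q : ℝ → ℂ) x = 0 := fun n =>
    (hu.mono (Set.subset_univ _)).ae_eq_zero (by have : (0 : ℝ) ≤ n := n.cast_nonneg; linarith)
      (ae_restrict_of_ae h1)
  rw [← ae_restrict_iUnion_iff] at h2
  have h3 : (⋃ n : ℕ, Set.Icc (-(n + 1 : ℝ)) (n + 1)) = Set.univ := by
    refine Set.eq_univ_of_forall fun x => ?_
    obtain ⟨n, hn⟩ := exists_nat_ge |x|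
    refine Set.mem_iUnion.2 ⟨n, ?_⟩
    rw [abs_le] at hn
    constructor <;> linarith [hn.1, hn.2]
  rw [h3, Measure.restrict_univ] at h2
  refine Lp.ext ?_
  filter_upwards [h2, Lp.coeFn_zero ℂ 2 (volume : Measure ℝ)] with x h3 h4
  rw [h4]
  simpa using h3

/-! ### The Schur test for exponentially decaying kernels -/

/-- The Cauchy-Schwarz inequality for the splitting `s² F = s · (s F)`. -/
theorem lintegral_mul_sq_le {α : Type*} [MeasurableSpace α] {μ : Measure α} {s F : α → ℝ≥0∞}
    (hs : AEMeasurable s μ) (hF : AEMeasurable F μ) :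
    (∫⁻ y, s y ^ 2 * F y ∂μ) ^ 2 ≤ (∫⁻ y, s y ^ 2 ∂μ) * ∫⁻ y, s y ^ 2 * F y ^ 2 ∂μ := by
  have h := ENNReal.lintegral_mul_le_Lp_mul_Lq μ Real.HolderConjugate.two_two hs (hs.mul hF)
  have h1 : ∫⁻ y, s y ^ 2 * F y ∂μ = ∫⁻ y, (s * (s * F)) y ∂μ :=
    lintegral_congr fun y => by simp only [Pi.mul_apply]; ring
  rw [h1]
  refine (pow_le_pow_left' h 2).trans (le_of_eq ?_)
  rw [mul_pow, ← ENNReal.rpow_two, ← ENNReal.rpow_two, ← ENNReal.rpow_mul, ← ENNReal.rpow_mul]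
  norm_num
  congr 1
  exact lintegral_congr fun y => by ring

theorem integrable_exp_neg_mul_abs {κ : ℝ} (hκ : 0 < κ) :
    Integrable fun x : ℝ => Real.exp (-κ * |x|) := by
  rw [← integrableOn_univ, ← Set.Iic_union_Ioi (a := (0 : ℝ)), integrableOn_union]
  constructor
  · refine (integrableOn_exp_mul_Iic hκ 0).congr_fun (fun x hx => ?_) measurableSet_Iic
    rw [abs_of_nonpos hx, neg_mul_neg]
  · refine (integrableOn_exp_mul_Ioi (neg_lt_zero.2 hκ) 0).congr_fun (fun x hx => ?_)
      measurableSet_Ioi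
    rw [abs_of_pos hx]

/-- Schur's test: Cauchy-Schwarz with the kernel as weight, then Tonelli. The row and column
integrals of the convolution kernel both equal the integral of `e^{-κ|x|}`. -/
theorem eLpNorm_le_of_exp_kernel {κ : ℝ} {c : ℝ≥0∞} {f u : ℝ → ℂ} (hf : Measurable f)
    (hu : ∀ x, ‖u x‖ₑ ≤ c * ∫⁻ y, ENNReal.ofReal (Real.exp (-κ * |x - y|)) * ‖f y‖ₑ) :
    eLpNorm u 2 volume ≤
      c * (∫⁻ x : ℝ, ENNReal.ofReal (Real.exp (-κ * |x|))) * eLpNorm f 2 volume := by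
  set M := ∫⁻ x : ℝ, ENNReal.ofReal (Real.exp (-κ * |x|)) with hM
  -- Half the exponent, so that the square of `s` is the kernel.
  set s : ℝ → ℝ → ℝ≥0∞ := fun x y => ENNReal.ofReal (Real.exp (-(κ / 2) * |x - y|))
  have hs2 : ∀ x y, s x y ^ 2 = ENNReal.ofReal (Real.exp (-κ * |x - y|)) := by
    intro x y
    rw [← ENNReal.ofReal_pow (Real.exp_pos _).le, ← Real.exp_nat_mul]
    congr 2
    push_cast
    ring
  have hsm : Measurable (Function.uncurry s) := by
    refine ENNReal.measurable_ofReal.comp (Continuous.measurable ?_)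
    fun_prop
  have hM1 : ∀ y, ∫⁻ x, s x y ^ 2 = M := fun y => by
    simp_rw [hs2]
    exact lintegral_sub_right_eq_self (fun x => ENNReal.ofReal (Real.exp (-κ * |x|))) y
  have hM2 : ∀ x, ∫⁻ y, s x y ^ 2 = M := fun x => by
    rw [← hM1 x]
    refine lintegral_congr fun y => ?_
    rw [hs2, hs2, abs_sub_comm]
  have hsq : ∫⁻ x, ‖u x‖ₑ ^ 2 ≤ (c * M) ^ 2 * ∫⁻ y, ‖f y‖ₑ ^ 2 := by
    calc ∫⁻ x, ‖u x‖ₑ ^ 2 ≤ ∫⁻ x, c ^ 2 * (M * ∫⁻ y, s x y ^ 2 * ‖f y‖ₑ ^ 2) := by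
          refine lintegral_mono fun x => (pow_le_pow_left' (hu x) 2).trans ?_
          simp_rw [← hs2]
          rw [mul_pow, ← hM2 x]
          gcongr
          exact lintegral_mul_sq_le (hsm.comp measurable_prodMk_left).aemeasurable
            hf.enorm.aemeasurable
      _ = c ^ 2 * (M * ∫⁻ x, ∫⁻ y, s x y ^ 2 * ‖f y‖ₑ ^ 2) := by
          have hm : Measurable fun x => ∫⁻ y, s x y ^ 2 * ‖f y‖ₑ ^ 2 :=
            Measurable.lintegral_prod_right
              (f := fun x y => s x y ^ 2 * ‖f y‖ₑ ^ 2)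
              ((hsm.pow_const 2).mul ((hf.comp measurable_snd).enorm.pow_const 2))
          rw [lintegral_const_mul _ (hm.const_mul _), lintegral_const_mul _ hm]
      _ = c ^ 2 * (M * ∫⁻ y, M * ‖f y‖ₑ ^ 2) := by
          rw [lintegral_lintegral_swap]
          · congr 2
            refine lintegral_congr fun y => ?_
            have hm : Measurable fun x => s x y ^ 2 :=
              (hsm.comp measurable_prodMk_right).pow_const 2
            rw [lintegral_mul_const _ hm, hM1]
          · exact ((hsm.pow_const 2).mul ((hf.comp measurable_snd).enorm.pow_const 2)).aemeasurable
      _ = _ := by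
          rw [lintegral_const_mul _ (hf.enorm.pow_const 2)]
          ring
  rw [eLpNorm_eq_lintegral_rpow_enorm_toReal two_ne_zero ENNReal.ofNat_ne_top,
    eLpNorm_eq_lintegral_rpow_enorm_toReal two_ne_zero ENNReal.ofNat_ne_top]
  simp only [ENNReal.toReal_ofNat, ENNReal.rpow_two]
  refine (ENNReal.rpow_le_rpow hsq (by norm_num)).trans (le_of_eq ?_)
  rw [ENNReal.mul_rpow_of_nonneg _ _ (by norm_num), ← ENNReal.rpow_two, ← ENNReal.rpow_mul]
  norm_num

/-! ### The free resolvent on the line -/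

theorem norm_planeWave_zero (k : ℂ) (x : ℝ) : ‖planeWave 0 k x‖ = Real.exp (-k.im * x) := by
  rw [planeWave_zero_apply, Complex.norm_exp]
  simp

theorem norm_planeWave_one (k : ℂ) (x : ℝ) : ‖planeWave 1 k x‖ = Real.exp (k.im * x) := by
  rw [planeWave_one_apply, Complex.norm_exp]
  simp

theorem norm_freeKernel (k : ℂ) (x y : ℝ) :
    ‖freeKernel k x y‖ = 1 / (2 * ‖k‖) * Real.exp (-k.im * |x - y|) := by
  rw [freeKernel, norm_mul, Complex.norm_exp]
  simp

/-- For `Im k > 0` each plane wave is square integrable on the half line on which it is integrated.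
-/
theorem freeIntegrable_of_memLp {k : ℂ} (hk : 0 < k.im) {f : ℝ → ℂ} (hf : MemLp f 2 volume) :
    FreeIntegrable k f := by
  intro x
  constructor
  · refine MemLp.integrable_mul (p := 2) (q := 2) ?_ (hf.restrict _)
    rw [memLp_two_iff_integrable_sq_norm (continuous_planeWave 1 k).aestronglyMeasurable]
    refine (integrableOn_exp_mul_Iic (a := 2 * k.im) (by linarith) x).congr_fun (fun y _ => ?_)
      measurableSet_Iic
    simp only [norm_planeWave_one, ← Real.exp_nat_mul]
    congr 1
    push_cast
    ring
  · refine MemLp.integrable_mul (p := 2) (q := 2) ?_ (hf.restrict _)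
    rw [memLp_two_iff_integrable_sq_norm (continuous_planeWave 0 k).aestronglyMeasurable]
    refine (integrableOn_exp_mul_Ioi (a := -(2 * k.im)) (by linarith) x).congr_fun (fun y _ => ?_)
      measurableSet_Ioi
    simp only [norm_planeWave_zero, ← Real.exp_nat_mul]
    congr 1
    push_cast
    ring

theorem ne_zero_of_im_pos {k : ℂ} (hk : 0 < k.im) : k ≠ 0 := by
  rintro rfl
  simp at hk

/-- A square integrable combination of plane waves vanishes. -/
theorem planeWaves_eq_zero_of_memLp {k : ℂ} (hk : 0 < k.im) {a b : ℂ}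
    (h : MemLp (fun x => a * planeWave 0 k x + b * planeWave 1 k x) 2 volume) : a = 0 ∧ b = 0 := by
  -- For an `L²` function the set where its modulus is at least `1` has finite measure, whereas a
  -- nonzero amplitude makes the modulus grow exponentially on a half line.
  have hfin := h.meas_ge_lt_top' two_ne_zero ENNReal.ofNat_ne_top (ε := 1) one_ne_zero
  have key : ∀ p q : ℂ, p ≠ 0 →
      ∃ X : ℝ, ∀ x, X ≤ x → 1 ≤ ‖p‖ * Real.exp (k.im * x) - ‖q‖ * Real.exp (-k.im * x) := by
    intro p q hp
    have hp' : 0 < ‖p‖ := norm_pos_iff.2 hp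
    have h1 : Tendsto (fun x : ℝ => ‖p‖ * Real.exp (k.im * x) - ‖q‖ * Real.exp (-k.im * x)) atTop
        atTop := by
      have e1 : Tendsto (fun x : ℝ => ‖p‖ * Real.exp (k.im * x)) atTop atTop :=
        (Real.tendsto_exp_atTop.comp (tendsto_id.const_mul_atTop hk)).const_mul_atTop hp'
      have e2 : Tendsto (fun x : ℝ => -(‖q‖ * Real.exp (-k.im * x))) atTop (𝓝 (-(‖q‖ * 0))) := by
        refine (Tendsto.const_mul _ (Real.tendsto_exp_atBot.comp ?_)).neg
        exact tendsto_id.const_mul_atTop_of_neg (neg_lt_zero.2 hk)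
      simpa [sub_eq_add_neg] using e1.atTop_add e2
    obtain ⟨X, hX⟩ := (h1.eventually_ge_atTop 1).exists_forall_of_atTop
    exact ⟨X, hX⟩
  constructor
  · by_contra ha
    obtain ⟨X, hX⟩ := key a b ha
    have hsub : Set.Iic (-X) ⊆
        {x | (1 : ℝ≥0∞) ≤ ‖a * planeWave 0 k x + b * planeWave 1 k x‖₊} := by
      intro x hx
      have h1 := hX (-x) (by rw [Set.mem_Iic] at hx; linarith)
      have h2 : (1 : ℝ) ≤ ‖a * planeWave 0 k x + b * planeWave 1 k x‖ := by
        refine h1.trans ?_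
        have h3 := norm_sub_le_norm_add (a * planeWave 0 k x) (b * planeWave 1 k x)
        rw [norm_mul, norm_mul, norm_planeWave_zero, norm_planeWave_one] at h3
        rwa [mul_neg, neg_mul_neg, ← neg_mul]
      exact_mod_cast h2
    have := (measure_mono hsub).trans_lt hfin
    simp at this
  · by_contra hb
    obtain ⟨X, hX⟩ := key b a hb
    have hsub : Set.Ici X ⊆
        {x | (1 : ℝ≥0∞) ≤ ‖a * planeWave 0 k x + b * planeWave 1 k x‖₊} := by
      intro x hx
      have h1 := hX x hx
      have h2 : (1 : ℝ) ≤ ‖a * planeWave 0 k x + b * planeWave 1 k x‖ := by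
        refine h1.trans ?_
        have h3 := norm_sub_le_norm_add (b * planeWave 1 k x) (a * planeWave 0 k x)
        rw [norm_mul, norm_mul, norm_planeWave_zero, norm_planeWave_one, add_comm (b * _)] at h3
        exact h3
      exact_mod_cast h2
    have := (measure_mono hsub).trans_lt hfin
    simp at this

/-- Convolution with the outgoing kernel is bounded by Schur's test and solves the equation. It is
also a left inverse: the difference of two square integrable solutions is a square integrable
combination of plane waves, hence zero. -/
theorem exists_isResolventAt_lineHamiltonian {k : ℂ} (hk : 0 < k.im) :
    ∃ R : LineSpace →L[ℂ] LineSpace, IsResolventAt lineHamiltonian (k ^ 2) R ∧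
      ∀ f : LineSpace, R f =ᵐ[volume] freeSol k f := by
  have hk0 := ne_zero_of_im_pos hk
  have hI : ∀ f : LineSpace, FreeIntegrable k f := fun f => freeIntegrable_of_memLp hk (Lp.memLp f)
  have hode := fun f : LineSpace => hasSecondDerivOn_freeSol hk0 (hI f)
  set M := ∫⁻ x : ℝ, ENNReal.ofReal (Real.exp (-k.im * |x|)) with hM
  have hMt : M ≠ ∞ := by
    have := (integrable_exp_neg_mul_abs hk).lintegral_lt_top
    exact this.ne
  set c : ℝ≥0∞ := ENNReal.ofReal (1 / (2 * ‖k‖))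
  have hbd : ∀ f : LineSpace, eLpNorm (freeSol k f) 2 volume ≤ c * M * eLpNorm f 2 volume := by
    intro f
    refine eLpNorm_le_of_exp_kernel (Lp.stronglyMeasurable f).measurable fun x => ?_
    rw [freeSol_eq_integral (hI f)]
    refine (enorm_integral_le_lintegral_enorm _).trans ?_
    rw [← lintegral_const_mul' _ _ ENNReal.ofReal_ne_top]
    refine lintegral_mono fun y => ?_
    rw [enorm_mul, ← mul_assoc, ← ENNReal.ofReal_mul (by positivity), ← norm_freeKernel,
      ofReal_norm]
  have hmem : ∀ f : LineSpace, MemLp (freeSol k f) 2 volume := fun f =>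
    ⟨(hode f).left.continuous.aestronglyMeasurable, (hbd f).trans_lt
      (ENNReal.mul_lt_top (ENNReal.mul_lt_top ENNReal.ofReal_lt_top hMt.lt_top) (Lp.memLp f).2)⟩
  have hadd : ∀ (f₁ f₂ : LineSpace) (x : ℝ),
      freeSol k (f₁ + f₂ : LineSpace) x = freeSol k f₁ x + freeSol k f₂ x := by
    intro f₁ f₂ x
    have e : ∀ (j : Fin 2) (s : Set ℝ), ∫ y in s, planeWave j k y * (f₁ + f₂ : LineSpace) y =
        ∫ y in s, (planeWave j k y * f₁ y + planeWave j k y * f₂ y) := by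
      intro j s
      refine integral_congr_ae (ae_restrict_of_ae ?_)
      filter_upwards [Lp.coeFn_add f₁ f₂] with y hy
      rw [hy, Pi.add_apply, mul_add]
    simp only [freeSol, e]
    rw [integral_add (hI f₁ x).1 (hI f₂ x).1, integral_add (hI f₁ x).2 (hI f₂ x).2]
    ring
  have hsmul : ∀ (a : ℂ) (f : LineSpace) (x : ℝ),
      freeSol k (a • f : LineSpace) x = a * freeSol k f x := by
    intro a f x
    have e : ∀ (j : Fin 2) (s : Set ℝ), ∫ y in s, planeWave j k y * (a • f : LineSpace) y =
        ∫ y in s, a * (planeWave j k y * f y) := by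
      intro j s
      refine integral_congr_ae (ae_restrict_of_ae ?_)
      filter_upwards [Lp.coeFn_smul a f] with y hy
      rw [hy, Pi.smul_apply, smul_eq_mul]
      ring
    simp only [freeSol, e, integral_const_mul]
    ring
  let T : LineSpace →ₗ[ℂ] LineSpace :=
    { toFun := fun f => (hmem f).toLp _
      map_add' := fun f₁ f₂ => by
        rw [← MemLp.toLp_add]
        exact MemLp.toLp_congr _ _ (Eventually.of_forall fun x => hadd f₁ f₂ x)
      map_smul' := fun a f => by
        rw [RingHom.id_apply, ← MemLp.toLp_const_smul]
        exact MemLp.toLp_congr _ _ (Eventually.of_forall fun x => hsmul a f x) }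
  have hT : ∀ f, T f =ᵐ[volume] freeSol k f := fun f => (hmem f).coeFn_toLp
  let R : LineSpace →L[ℂ] LineSpace := T.mkContinuous (c * M).toReal fun f => by
    change ‖(hmem f).toLp _‖ ≤ _
    rw [Lp.norm_toLp, Lp.norm_def, ← ENNReal.toReal_mul]
    exact ENNReal.toReal_mono (ENNReal.mul_ne_top (ENNReal.mul_ne_top ENNReal.ofReal_ne_top hMt)
      (Lp.memLp f).2.ne) (hbd f)
  have hgraph : ∀ f, (R f, (k ^ 2) • R f - f) ∈ lineGraph := by
    intro f
    refine ⟨freeSol k f, freeSolDeriv k f, hT f, ?_⟩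
    refine (hode f).congr_ae Set.ordConnected_univ ?_
    rw [Measure.restrict_univ]
    filter_upwards [hT f, Lp.coeFn_sub ((k ^ 2) • R f) f, Lp.coeFn_smul (k ^ 2) (R f)]
      with x h1 h2 h3
    rw [h2, Pi.sub_apply, h3, Pi.smul_apply, smul_eq_mul]
    change _ = -(k ^ 2 * (T f : ℝ → ℂ) x - _)
    rw [h1]
    ring
  refine ⟨R, (isResolventAt_toLinearPMap_iff lineGraph_singleValued).2 ⟨hgraph, ?_⟩, hT⟩
  intro p hp
  set f := (k ^ 2) • p.1 - p.2
  have hq := lineGraph.sub_mem hp (hgraph f)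
  have h2 : p - (R f, (k ^ 2) • R f - f) = (p.1 - R f, (k ^ 2) • (p.1 - R f)) := by
    refine Prod.ext rfl ?_
    simp only [f, Prod.snd_sub, smul_sub]
    abel
  rw [h2] at hq
  set q := p.1 - R f
  obtain ⟨u, u', hu1, hu2⟩ := hq
  simp only at hu1 hu2
  obtain ⟨a, b, hab⟩ := hu2.exists_eq_planeWaves Set.ordConnected_univ hk0 fun x _ y _ => by
    refine ae_restrict_of_ae ?_
    filter_upwards [hu1, Lp.coeFn_smul (k ^ 2) q] with t h3 h4
    rw [h4, Pi.smul_apply, smul_eq_mul, h3]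
  have hm : MemLp (fun x => a * planeWave 0 k x + b * planeWave 1 k x) 2 volume := by
    refine (memLp_congr_ae ?_).1 (Lp.memLp q)
    filter_upwards [hu1] with x hx
    rw [hx, (hab x trivial).1]
  obtain ⟨rfl, rfl⟩ := planeWaves_eq_zero_of_memLp hk hm
  have h0 : q = 0 := by
    refine Lp.ext ?_
    filter_upwards [hu1, Lp.coeFn_zero ℂ 2 (volume : Measure ℝ)] with x h3 h4
    rw [h3, (hab x trivial).1, h4]
    simp
  exact (sub_eq_zero.1 h0).symm

/-! ### The free resolvent compressed to the box -/

theorem bddKernel_freeKernel {k : ℂ} (hk : 0 ≤ k.im) :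
    BddKernel (1 / (2 * ‖k‖)) (freeKernel k) where
  meas := by
    refine Continuous.stronglyMeasurable ?_
    unfold Function.uncurry freeKernel
    fun_prop
  bound x y := by
    rw [norm_freeKernel]
    refine mul_le_of_le_one_right (by positivity) (Real.exp_le_one_iff.2 ?_)
    have := mul_nonneg hk (abs_nonneg (x - y))
    linarith

theorem integrableOn_box {L : ℝ} (f : BoxSpace L) : IntegrableOn f (Set.Icc (-L) L) :=
  (Lp.memLp f).integrable one_le_two

theorem freeIntegrable_box {L : ℝ} (k : ℂ) (f : BoxSpace L) :
    FreeIntegrable k ((Set.Icc (-L) L).indicator f) :=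
  freeIntegrable_indicator L k (integrableOn_box f)

theorem freeSol_indicator_eq_integral {L : ℝ} (k : ℂ) (f : BoxSpace L) (x : ℝ) :
    freeSol k ((Set.Icc (-L) L).indicator f) x = ∫ y in Set.Icc (-L) L, freeKernel k x y * f y := by
  rw [freeSol_eq_integral (freeIntegrable_box k f), ← integral_indicator measurableSet_Icc]
  congr 1
  ext y
  by_cases hy : y ∈ Set.Icc (-L) L <;> simp [hy]

theorem adjoint_restrictBox_coeFn {L : ℝ} (f : BoxSpace L) :
    ContinuousLinearMap.adjoint (restrictBox L) f =ᵐ[volume] (Set.Icc (-L) L).indicator f := by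
  have hm : MemLp ((Set.Icc (-L) L).indicator f) 2 volume :=
    (memLp_indicator_iff_restrict measurableSet_Icc).2 (Lp.memLp f)
  suffices ContinuousLinearMap.adjoint (restrictBox L) f = hm.toLp _ by
    rw [this]
    exact hm.coeFn_toLp
  refine ext_inner_right ℂ fun h => ?_
  rw [ContinuousLinearMap.adjoint_inner_left, L2.inner_def, L2.inner_def]
  have e0 : ∫ x, inner ℂ (hm.toLp _ x) (h x) =
      ∫ x, inner ℂ ((Set.Icc (-L) L).indicator f x) (h x) := by
    refine integral_congr_ae ?_
    filter_upwards [hm.coeFn_toLp] with x hx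
    rw [hx]
  rw [e0, ← setIntegral_eq_integral_of_forall_compl_eq_zero (s := Set.Icc (-L) L)
    (f := fun x => inner ℂ ((Set.Icc (-L) L).indicator f x) (h x))]
  · refine integral_congr_ae ?_
    filter_upwards [LpToLpRestrictCLM_coeFn ℂ (Set.Icc (-L) L) h,
      ae_restrict_mem measurableSet_Icc] with x hx hxm
    rw [restrictBox, hx, Set.indicator_of_mem hxm]
  · intro x hx
    rw [Set.indicator_of_notMem hx, inner_zero_left]

/-- Both branches of the definition, the compressed resolvent and its boundary value, are given by
the outgoing solution; from here on real and nonreal `k` are treated alike. -/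
theorem freeBoxResolvent_coeFn {k : ℂ} (hk : 0 ≤ k.im) (L : ℝ) (f : BoxSpace L) :
    freeBoxResolvent L k f =ᵐ[boxMeasure L] freeSol k ((Set.Icc (-L) L).indicator f) := by
  rw [freeBoxResolvent]
  split_ifs with h
  · filter_upwards [(bddKernel_freeKernel hk).hasKernel_kernelOp L f] with x hx
    rw [freeSol_indicator_eq_integral]
    exact hx
  · obtain ⟨R, hR, hRf⟩ := exists_isResolventAt_lineHamiltonian (lt_of_le_of_ne hk (Ne.symm h))
    rw [hR.unboundedResolvent_eq]
    have h1 := LpToLpRestrictCLM_coeFn ℂ (Set.Icc (-L) L)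
      (R (ContinuousLinearMap.adjoint (restrictBox L) f))
    filter_upwards [h1, ae_restrict_of_ae (hRf (ContinuousLinearMap.adjoint (restrictBox L) f))]
      with x h1 h2
    refine h1.trans (h2.trans ?_)
    have e : ∀ (j : Fin 2) (s : Set ℝ),
        ∫ y in s, planeWave j k y * ContinuousLinearMap.adjoint (restrictBox L) f y =
        ∫ y in s, planeWave j k y * (Set.Icc (-L) L).indicator f y := by
      intro j s
      refine integral_congr_ae (ae_restrict_of_ae ?_)
      filter_upwards [adjoint_restrictBox_coeFn f] with y hy
      rw [hy]
    simp only [freeSol, e]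

theorem hasKernel_freeBoxResolvent {k : ℂ} (hk : 0 ≤ k.im) (L : ℝ) :
    HasKernel L (freeBoxResolvent L k) (freeKernel k) := fun f => by
  filter_upwards [freeBoxResolvent_coeFn hk L f] with x hx
  rw [hx, freeSol_indicator_eq_integral]

/-- The kernel is symmetric in `x` and `y`, and conjugating it replaces `k` by `-conj k`, the root
of `z̄` in the closed upper half plane. -/
theorem adjoint_freeBoxResolvent {k : ℂ} (hk : 0 ≤ k.im) (L : ℝ) :
    ContinuousLinearMap.adjoint (freeBoxResolvent L k) = freeBoxResolvent L (-conj k) := by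
  refine ((bddKernel_freeKernel hk).adjoint (hasKernel_freeBoxResolvent hk L)).unique ?_
  have h := hasKernel_freeBoxResolvent (k := -conj k) (by simpa using hk) L
  convert h using 3 with x y
  rw [freeKernel, freeKernel, map_mul, ← Complex.exp_conj, abs_sub_comm]
  simp [Complex.conj_ofNat]

/-- The inner product conjugates its first argument and `e^{i k̄ y}` becomes `e^{-iky}`; hence the
exchange of the indices `0` and `1`. -/
theorem inner_eps_zero {L : ℝ} (k : ℂ) (f : BoxSpace L) :
    inner ℂ (eps L 0 (conj k)) f = ∫ y in Set.Icc (-L) L, planeWave 1 k y * f y := by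
  rw [L2.inner_def]
  refine integral_congr_ae ?_
  filter_upwards [(memLp_planeWave L 0 (conj k)).coeFn_toLp] with x hx
  rw [eps, hx, RCLike.inner_apply', conj_planeWave_zero]

theorem inner_eps_one {L : ℝ} (k : ℂ) (f : BoxSpace L) :
    inner ℂ (eps L 1 (conj k)) f = ∫ y in Set.Icc (-L) L, planeWave 0 k y * f y := by
  rw [L2.inner_def]
  refine integral_congr_ae ?_
  filter_upwards [(memLp_planeWave L 1 (conj k)).coeFn_toLp] with x hx
  rw [eps, hx, RCLike.inner_apply', conj_planeWave_one]

/-! ### The trace class property of the compressed free resolvent. -/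

/-- The kernel `∂ₓ e^{ik|x-y|} / (2ik)`. -/
def freeKernelDeriv (k : ℂ) (x y : ℝ) : ℂ :=
  (if y ≤ x then Complex.I * k else -(Complex.I * k)) * freeKernel k x y

theorem bddKernel_freeKernelDeriv {k : ℂ} (hk : 0 ≤ k.im) :
    BddKernel (‖k‖ * (1 / (2 * ‖k‖))) (freeKernelDeriv k) where
  meas := by
    refine StronglyMeasurable.mul ?_ (bddKernel_freeKernel hk).meas
    exact (Measurable.ite (measurableSet_le measurable_snd measurable_fst) measurable_const
      measurable_const).stronglyMeasurable
  bound x y := by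
    rw [freeKernelDeriv, norm_mul]
    refine mul_le_mul (le_of_eq ?_) ((bddKernel_freeKernel hk).bound x y) (norm_nonneg _)
      (norm_nonneg _)
    split_ifs <;> simp

theorem freeSolDeriv_indicator_eq_integral {L : ℝ} {k : ℂ} (hk0 : k ≠ 0) (f : BoxSpace L) (x : ℝ) :
    freeSolDeriv k ((Set.Icc (-L) L).indicator f) x =
      ∫ y in Set.Icc (-L) L, freeKernelDeriv k x y * f y := by
  have hh := freeIntegrable_box k f
  set h := (Set.Icc (-L) L).indicator f with hdef
  have e : ∫ y in Set.Icc (-L) L, freeKernelDeriv k x y * f y =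
      ∫ y, freeKernelDeriv k x y * h y := by
    rw [← integral_indicator measurableSet_Icc]
    congr 1
    ext y
    by_cases hy : y ∈ Set.Icc (-L) L <;> simp [hy, hdef]
  have hk2 : 2 * Complex.I * k ≠ 0 := by simp [hk0]
  have c1 : ∀ y ∈ Set.Iic x, freeKernelDeriv k x y * h y =
      1 / 2 * planeWave 0 k x * (planeWave 1 k y * h y) := by
    intro y hy
    rw [freeKernelDeriv, if_pos (show y ≤ x from hy), freeKernel_of_le k hy]
    field_simp
  have c2 : ∀ y ∈ Set.Ioi x, freeKernelDeriv k x y * h y =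
      -(1 / 2) * planeWave 1 k x * (planeWave 0 k y * h y) := by
    intro y hy
    rw [freeKernelDeriv, if_neg (not_le.2 hy), freeKernel_of_ge k (le_of_lt hy)]
    field_simp
  have i1 : IntegrableOn (fun y => freeKernelDeriv k x y * h y) (Set.Iic x) :=
    IntegrableOn.congr_fun ((hh x).1.const_mul (1 / 2 * planeWave 0 k x))
      (fun y hy => (c1 y hy).symm) measurableSet_Iic
  have i2 : IntegrableOn (fun y => freeKernelDeriv k x y * h y) (Set.Ioi x) :=
    IntegrableOn.congr_fun ((hh x).2.const_mul (-(1 / 2) * planeWave 1 k x))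
      (fun y hy => (c2 y hy).symm) measurableSet_Ioi
  rw [e, ← intervalIntegral.integral_Iic_add_Ioi i1 i2, setIntegral_congr_fun measurableSet_Iic c1,
    setIntegral_congr_fun measurableSet_Ioi c2, integral_const_mul, integral_const_mul,
    freeSolDeriv]
  ring

/-- On the box this is the kernel of integration from `-L`, the first factor of the resolvent in
`isTraceClass_freeBoxResolvent`. -/
theorem bddKernel_volterra : BddKernel 1 fun x y : ℝ => if y ≤ x then (1 : ℂ) else 0 where
  meas := (Measurable.ite (measurableSet_le measurable_snd measurable_fst) measurable_const
      measurable_const).stronglyMeasurable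
  bound x y := by split_ifs <;> simp

theorem eps_zero_zero_coeFn (L : ℝ) : eps L 0 0 =ᵐ[boxMeasure L] fun _ => 1 := by
  filter_upwards [(memLp_planeWave L 0 0).coeFn_toLp] with x hx
  rw [eps, hx, planeWave_zero_apply]
  simp

/-- Write `u(x) = u(-L) + ∫_{-L}^x u'`. The integral is a product of two operators with bounded
kernels, hence of two Hilbert-Schmidt operators; `f ↦ u(-L)` contributes rank one. -/
theorem isTraceClass_freeBoxResolvent {k : ℂ} (hk0 : k ≠ 0) (hk : 0 ≤ k.im) (L : ℝ) :
    IsTraceClass (freeBoxResolvent L k) := by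
  obtain ⟨X, hX⟩ := bddKernel_volterra.exists_hasKernel L
  obtain ⟨Y, hY⟩ := (bddKernel_freeKernelDeriv hk).exists_hasKernel L
  obtain ⟨w, b, -⟩ := exists_hilbertBasis ℂ (BoxSpace L)
  have hXY : IsTraceClass (X * Y) := isTraceClass_mul_of_summable_sq b X Y
    (bddKernel_volterra.summable_norm_sq hX b)
    ((bddKernel_freeKernelDeriv hk).adj.summable_norm_sq
      ((bddKernel_freeKernelDeriv hk).adjoint hY) b)
  -- Left of the source the solution is a pure `e^{-ikx}`, so `u(-L)` equals `c ∫ e^{iky} f`.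
  set c : ℂ := 1 / (2 * Complex.I * k) * planeWave 1 k (-L)
  have key : freeBoxResolvent L k = X * Y + finiteRankOp (fun _ : Fin 1 => eps L 1 (conj k))
      (fun _ => c • eps L 0 0) := by
    ext1 f
    refine Lp.ext ?_
    set h := (Set.Icc (-L) L).indicator f with hdef
    have hYf : Y f =ᵐ[boxMeasure L] freeSolDeriv k h := by
      filter_upwards [hY f] with x hx
      rw [hx, hdef, freeSolDeriv_indicator_eq_integral hk0]
    rw [add_apply, mul_apply_eq_comp, finiteRankOp_apply, Fin.sum_univ_one, smul_smul]
    filter_upwards [freeBoxResolvent_coeFn hk L f, hX (Y f),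
      Lp.coeFn_add (X (Y f)) ((inner ℂ (eps L 1 (conj k)) f * c) • eps L 0 0),
      Lp.coeFn_smul (inner ℂ (eps L 1 (conj k)) f * c) (eps L 0 0), eps_zero_zero_coeFn L,
      ae_restrict_mem measurableSet_Icc] with x h1 h2 h3 h4 h5 hx
    rw [h1, h3, Pi.add_apply, h2, h4, Pi.smul_apply, h5, smul_eq_mul, mul_one, inner_eps_one]
    have e1 : ∫ y in Set.Icc (-L) L, (if y ≤ x then (1 : ℂ) else 0) * Y f y =
        ∫ y in (-L)..x, freeSolDeriv k h y := by
      have e2 : ∫ y in Set.Icc (-L) L, (if y ≤ x then (1 : ℂ) else 0) * Y f y =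
          ∫ y in Set.Icc (-L) L, (Set.Iic x).indicator (freeSolDeriv k h) y := by
        refine integral_congr_ae ?_
        filter_upwards [hYf] with y hy
        by_cases hyx : y ≤ x <;> simp [hyx, hy]
      have e3 : Set.Icc (-L) L ∩ Set.Iic x = Set.Icc (-L) x := by
        ext y
        simp only [Set.mem_inter_iff, Set.mem_Iic, Set.mem_Icc]
        exact ⟨fun ⟨⟨a, _⟩, c⟩ => ⟨a, c⟩, fun ⟨a, b⟩ => ⟨⟨a, b.trans hx.2⟩, b⟩⟩
      rw [e2, setIntegral_indicator measurableSet_Iic, e3, integral_Icc_eq_integral_Ioc,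
        intervalIntegral.integral_of_le hx.1]
    have e4 := ((hasSecondDerivOn_freeSol hk0 (freeIntegrable_box k f)).left (-L) trivial x
      trivial).2
    rw [e1, hdef, ← e4, (freeSol_of_le (le_refl (-L))).1]
    ring
  rw [key]
  exact hXY.add (isTraceClass_finiteRankOp _ _)

/-! ### Self-adjoint boundary conditions -/

section Lagrangian

variable {A B : Matrix (Fin 2) (Fin 2) ℂ}

open scoped ComplexOrder in
-- The matrix is `(A | B)(A | B)*`, which has the same rank as `(A | B)`.
theorem isUnit_mul_conjTranspose_add (hrank : (Matrix.fromCols A B).rank = 2) :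
    IsUnit (A * Aᴴ + B * Bᴴ) := by
  have h1 : Matrix.fromCols A B * (Matrix.fromCols A B)ᴴ = A * Aᴴ + B * Bᴴ := by
    rw [Matrix.conjTranspose_fromCols_eq_fromRows_conjTranspose, Matrix.fromCols_mul_fromRows]
  have h2 : (A * Aᴴ + B * Bᴴ).rank = 2 := by
    rw [← h1, Matrix.rank_self_mul_conjTranspose, hrank]
  rw [← Matrix.mulVec_surjective_iff_isUnit]
  have h3 : LinearMap.range (A * Aᴴ + B * Bᴴ).mulVecLin = ⊤ := by
    refine Submodule.eq_top_of_finrank_eq ?_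
    rw [Module.finrank_fin_fun]
    exact h2
  exact LinearMap.range_eq_top.1 h3

/-- The boundary values admitted by `A x = B y` form a Lagrangian subspace. -/
theorem exists_of_mulVec_eq (hAB : A * Bᴴ = B * Aᴴ) (hrank : (Matrix.fromCols A B).rank = 2)
    {x y : Fin 2 → ℂ} (h : A *ᵥ x - B *ᵥ y = 0) : ∃ v, x = Bᴴ *ᵥ v ∧ y = Aᴴ *ᵥ v := by
  have hP := isUnit_mul_conjTranspose_add hrank
  set P := A * Aᴴ + B * Bᴴ with hPdef
  -- The only candidate: applying `B` to `x = B* v` and `A` to `y = A* v` and adding gives `P v = B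
  -- x + A y`.
  set v := P⁻¹ *ᵥ (B *ᵥ x + A *ᵥ y) with hv
  have hPv : P *ᵥ v = B *ᵥ x + A *ᵥ y := by
    rw [hv, Matrix.mulVec_mulVec, Matrix.mul_nonsing_inv _ ((Matrix.isUnit_iff_isUnit_det _).1 hP),
      Matrix.one_mulVec]
  set r := x - Bᴴ *ᵥ v
  set s := y - Aᴴ *ᵥ v
  have h1 : A *ᵥ r - B *ᵥ s = 0 := by
    simp only [r, s, Matrix.mulVec_sub, Matrix.mulVec_mulVec, hAB]
    rw [← h]
    abel
  have h2 : B *ᵥ r + A *ᵥ s = 0 := by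
    simp only [r, s, Matrix.mulVec_sub, Matrix.mulVec_mulVec]
    have h3 : (A * Aᴴ) *ᵥ v + (B * Bᴴ) *ᵥ v = B *ᵥ x + A *ᵥ y := by
      rw [← Matrix.add_mulVec, ← hPdef, hPv]
    rw [sub_add_sub_comm, ← h3]
    abel
  -- The remainder `(r, s)` lies in the kernel of `Q`. The relation `A B* = B A*` removes the
  -- off-diagonal blocks of `Q Q*`, so `Q` is invertible.
  set Q := Matrix.fromBlocks A (-B) B A
  have hQ : Q * Qᴴ = Matrix.fromBlocks P 0 0 P := by
    rw [Matrix.fromBlocks_conjTranspose, Matrix.fromBlocks_multiply]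
    simp only [Matrix.conjTranspose_neg, neg_mul, mul_neg, neg_neg, hAB, add_neg_cancel, hPdef]
    rw [add_comm (B * Bᴴ)]
  have hQdet : Q.det ≠ 0 := by
    intro h0
    have := congrArg Matrix.det hQ
    rw [Matrix.det_mul, h0, zero_mul, Matrix.det_fromBlocks_zero₂₁] at this
    have hPd := ((Matrix.isUnit_iff_isUnit_det _).1 hP).ne_zero
    exact mul_ne_zero hPd hPd this.symm
  have hz : Sum.elim r s = 0 := by
    refine Matrix.eq_zero_of_mulVec_eq_zero hQdet ?_
    rw [Matrix.fromBlocks_mulVec]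
    simp only [Sum.elim_comp_inl, Sum.elim_comp_inr, Matrix.neg_mulVec, ← sub_eq_add_neg, h1, h2]
    ext (i | i) <;> rfl
  refine ⟨v, ?_, ?_⟩
  · refine sub_eq_zero.1 (funext fun i => ?_)
    exact congrFun hz (Sum.inl i)
  · refine sub_eq_zero.1 (funext fun i => ?_)
    exact congrFun hz (Sum.inr i)

/-- In the parametrization `(B* v, A* v)` the two sides are the forms of `B A*` and `A B*`. This
cancels the boundary terms in Green's identity. -/
theorem boundary_form_symm (hAB : A * Bᴴ = B * Aᴴ) (hrank : (Matrix.fromCols A B).rank = 2)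
    {x₁ y₁ x₂ y₂ : Fin 2 → ℂ} (h₁ : A *ᵥ x₁ - B *ᵥ y₁ = 0) (h₂ : A *ᵥ x₂ - B *ᵥ y₂ = 0) :
    star x₁ ⬝ᵥ y₂ = star y₁ ⬝ᵥ x₂ := by
  obtain ⟨v, rfl, rfl⟩ := exists_of_mulVec_eq hAB hrank h₁
  obtain ⟨w, rfl, rfl⟩ := exists_of_mulVec_eq hAB hrank h₂
  rw [Matrix.star_mulVec, Matrix.star_mulVec, Matrix.conjTranspose_conjTranspose,
    Matrix.conjTranspose_conjTranspose, ← Matrix.dotProduct_mulVec, ← Matrix.dotProduct_mulVec,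
    Matrix.mulVec_mulVec, Matrix.mulVec_mulVec, hAB]

/-- A null vector `w` of the adjoint matrix gives admissible boundary values `x = B* w`, `y = A* w`
with `y = i k̄ x`. Symmetry of the boundary form then says `Re k ‖x‖² = 0`, so `x = y = 0` and the
rank condition gives `w = 0`. -/
theorem isUnit_bc (hAB : A * Bᴴ = B * Aᴴ) (hrank : (Matrix.fromCols A B).rank = 2) {k : ℂ}
    (hk : k.re ≠ 0) : IsUnit (Complex.I • A - k • B) := by
  set N := Complex.I • A - k • B with hN
  rw [Matrix.isUnit_iff_isUnit_det, isUnit_iff_ne_zero]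
  intro hdet
  have hdet' : Nᴴ.det = 0 := by rw [Matrix.det_conjTranspose, hdet, star_zero]
  obtain ⟨w, hw, hNw⟩ := Matrix.exists_mulVec_eq_zero_iff.2 hdet'
  set x := Bᴴ *ᵥ w with hx
  set y := Aᴴ *ᵥ w with hy
  have h1 : -Complex.I • y - conj k • x = 0 := by
    rw [← hNw, hN, Matrix.conjTranspose_sub, Matrix.conjTranspose_smul, Matrix.conjTranspose_smul,
      Matrix.sub_mulVec, Matrix.smul_mulVec, Matrix.smul_mulVec]
    simp [hx, hy]
  have hxy : A *ᵥ x - B *ᵥ y = 0 := by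
    rw [hx, hy, Matrix.mulVec_mulVec, Matrix.mulVec_mulVec, hAB, sub_self]
  have h2 := boundary_form_symm hAB hrank hxy hxy
  have h3 : ∀ i, y i = Complex.I * conj k * x i := by
    intro i
    have := congrFun h1 i
    simp only [Pi.sub_apply, Pi.smul_apply, smul_eq_mul, Pi.zero_apply] at this
    linear_combination Complex.I * this + y i * Complex.I_sq
  have h4 : (2 * k.re : ℂ) * ((Complex.normSq (x 0) + Complex.normSq (x 1) : ℝ) : ℂ) = 0 := by
    simp only [dotProduct, Fin.sum_univ_two, Pi.star_apply, RCLike.star_def, h3, map_mul,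
      Complex.conj_I, Complex.conj_conj] at h2
    have h5 : (2 * k.re : ℂ) = k + conj k := by rw [Complex.add_conj]; push_cast; ring
    rw [h5, Complex.ofReal_add, Complex.normSq_eq_conj_mul_self, Complex.normSq_eq_conj_mul_self]
    linear_combination (-Complex.I) * h2 +
      (k + conj k) * (conj (x 0) * x 0 + conj (x 1) * x 1) * Complex.I_sq
  have h5 : Complex.normSq (x 0) + Complex.normSq (x 1) = 0 := by
    rcases mul_eq_zero.1 h4 with h | h
    · exact absurd (by exact_mod_cast (mul_eq_zero.1 h).resolve_left two_ne_zero) hk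
    · exact_mod_cast h
  have h6 : Complex.normSq (x 0) = 0 ∧ Complex.normSq (x 1) = 0 :=
    (add_eq_zero_iff_of_nonneg (Complex.normSq_nonneg _) (Complex.normSq_nonneg _)).1 h5
  have hx0 : x = 0 := by
    ext i
    fin_cases i
    · exact Complex.normSq_eq_zero.1 h6.1
    · exact Complex.normSq_eq_zero.1 h6.2
  have hy0 : y = 0 := by
    ext i
    rw [h3, hx0]
    simp
  refine hw (Matrix.eq_zero_of_mulVec_eq_zero (M := A * Aᴴ + B * Bᴴ) ?_ ?_)
  · exact ((Matrix.isUnit_iff_isUnit_det _).1 (isUnit_mul_conjTranspose_add hrank)).ne_zero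
  · rw [Matrix.add_mulVec, ← Matrix.mulVec_mulVec, ← Matrix.mulVec_mulVec, ← hx, ← hy, hx0, hy0]
    simp

end Lagrangian

/-! ### The resolvent on the box -/

section BoxResolvent

variable {A B : Matrix (Fin 2) (Fin 2) ℂ} {L : ℝ}

theorem integral_Icc_eq_interval (hL : 0 < L) (f : ℝ → ℂ) :
    ∫ x in Set.Icc (-L) L, f x = ∫ x in (-L)..L, f x := by
  rw [integral_Icc_eq_integral_Ioc, intervalIntegral.integral_of_le (by linarith)]

/-- `H_L` is symmetric. -/
theorem boxGraph_symm (hAB : A * Bᴴ = B * Aᴴ) (hrank : (Matrix.fromCols A B).rank = 2)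
    (hL : 0 < L) {p q : BoxSpace L × BoxSpace L} (hp : p ∈ boxGraph A B L)
    (hq : q ∈ boxGraph A B L) : inner ℂ p.2 q.1 = inner ℂ p.1 q.2 := by
  obtain ⟨u, u', hpu, hu, hub⟩ := hp
  obtain ⟨v, v', hqv, hv, hvb⟩ := hq
  have hl : -L ∈ Set.Icc (-L) L := ⟨le_rfl, by linarith⟩
  have hr : L ∈ Set.Icc (-L) L := ⟨by linarith, le_rfl⟩
  have hw := (hu.star.wronskian Set.ordConnected_Icc hv (-L) hl L hr)
  have hs := boundary_form_symm hAB hrank hub hvb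
  simp only [dotProduct, Fin.sum_univ_two, Pi.star_apply, RCLike.star_def, Matrix.cons_val_zero,
    Matrix.cons_val_one, map_neg] at hs
  have h0 : ∫ x in Set.Icc (-L) L, (conj (u x) * -(q.2 x) - conj (-(p.2 x)) * v x) = 0 := by
    rw [integral_Icc_eq_interval hL, ← hw.2]
    linear_combination -hs
  rw [← sub_eq_zero, L2.inner_def, L2.inner_def, ← integral_sub (L2.integrable_inner p.2 q.1)
    (L2.integrable_inner p.1 q.2), ← h0]
  refine integral_congr_ae ?_
  filter_upwards [hpu, hqv] with x h1 h2
  rw [RCLike.inner_apply', RCLike.inner_apply', h1, h2, map_neg]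
  ring

theorem adjoint_boxResolvent (hAB : A * Bᴴ = B * Aᴴ) (hrank : (Matrix.fromCols A B).rank = 2)
    (hL : 0 < L) {z : ℂ} {R R' : BoxSpace L →L[ℂ] BoxSpace L}
    (hR : IsResolventAt (boxHamiltonian A B L) z R)
    (hR' : IsResolventAt (boxHamiltonian A B L) (conj z) R') :
    ContinuousLinearMap.adjoint R = R' := by
  symm
  rw [ContinuousLinearMap.eq_adjoint_iff]
  intro f h
  have h1 := ((isResolventAt_toLinearPMap_iff (boxGraph_singleValued A B hL)).1 hR).1 h
  have h2 := ((isResolventAt_toLinearPMap_iff (boxGraph_singleValued A B hL)).1 hR').1 f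
  have h3 := boxGraph_symm hAB hrank hL h2 h1
  simp only [inner_sub_left, inner_sub_right, inner_smul_left, inner_smul_right,
    Complex.conj_conj] at h3
  linear_combination h3

/-- The energy identity for `H_L`: symmetric boundary conditions leave no boundary term. -/
theorem im_inner_boxResolvent (hAB : A * Bᴴ = B * Aᴴ) (hrank : (Matrix.fromCols A B).rank = 2)
    (hL : 0 < L) {z : ℂ} {R : BoxSpace L →L[ℂ] BoxSpace L}
    (hR : IsResolventAt (boxHamiltonian A B L) z R) (ψ : BoxSpace L) :
    (inner ℂ ψ (R ψ) : ℂ).im = -z.im * ‖R ψ‖ ^ 2 := by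
  have h1 := ((isResolventAt_toLinearPMap_iff (boxGraph_singleValued A B hL)).1 hR).1 ψ
  have h2 := boxGraph_symm hAB hrank hL h1 h1
  simp only [inner_sub_left, inner_sub_right, inner_smul_left, inner_smul_right,
    inner_self_eq_norm_sq_to_K] at h2
  rw [← inner_conj_symm (R ψ) ψ] at h2
  have h3 := congrArg Complex.im h2
  simp only [Complex.sub_im, Complex.mul_im, Complex.conj_im, Complex.conj_re] at h3
  have h4 : (((‖R ψ‖ : ℂ)) ^ 2).im = 0 := by norm_cast
  have h5 : (((‖R ψ‖ : ℂ)) ^ 2).re = ‖R ψ‖ ^ 2 := by norm_cast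
  simp only [Complex.coe_algebraMap, h4, h5, mul_zero, zero_add] at h3
  linarith

theorem dFac_eq (L : ℝ) (k : ℂ) : dFac L k = planeWave 0 k L ^ 2 := by
  rw [dFac, planeWave_zero_apply, ← Complex.exp_nat_mul]
  congr 1
  push_cast
  ring

theorem bcMatrix_mul {k : ℂ} (hU : IsUnit (Complex.I • A - k • B)) :
    (Complex.I • A - k • B) * bcMatrix A B k = Complex.I • A + k • B := by
  rw [bcMatrix, ← mul_assoc, Matrix.mul_nonsing_inv _ ((Matrix.isUnit_iff_isUnit_det _).1 hU),
    one_mul]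

/-- The boundary condition for `freeSol + a e^{ikx} + b e^{-ikx}`; `p`, `q` are the boundary data
of `freeSol`. -/
theorem boundary_value {k : ℂ} (hk0 : k ≠ 0) (hU : IsUnit (Complex.I • A - k • B))
    (e e' : ℂ) (he : e * e' = 1) (v w : Fin 2 → ℂ) :
    Complex.I • (A *ᵥ ![1 / (2 * Complex.I * k) * w 0 * e + (v 0 * e + v 1 * e'),
        1 / (2 * Complex.I * k) * w 1 * e + (v 0 * e' + v 1 * e)] -
      B *ᵥ ![-(1 / 2 * w 0 * e + Complex.I * k * (v 0 * e - v 1 * e')),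
        -(1 / 2 * w 1 * e) + Complex.I * k * (v 0 * e' - v 1 * e)]) =
    e' • ((Complex.I • A - k • B) *ᵥ ((e ^ 2 / (2 * Complex.I * k)) • w +
      (e ^ 2 • (1 : Matrix (Fin 2) (Fin 2) ℂ) + bcMatrix A B k * sigmaX) *ᵥ v)) := by
  rw [Matrix.mulVec_add, Matrix.mulVec_mulVec, Matrix.mul_add, ← mul_assoc, bcMatrix_mul hU,
    Matrix.mul_smul, mul_one, div_eq_mul_one_div (e ^ 2)]
  have hk2 : 2 * Complex.I * k ≠ 0 := by simp [hk0]
  set c := 1 / (2 * Complex.I * k) with hc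
  have h2 : (1 / 2 : ℂ) = c * (Complex.I * k) := by rw [hc]; field_simp
  have hI := Complex.I_sq
  have h1 : e ^ 2 * e' = e := by linear_combination e * he
  ext i
  simp only [h2, sigmaX, Matrix.mulVec, dotProduct, Fin.sum_univ_two, Pi.smul_apply, Pi.sub_apply,
    Pi.add_apply, smul_eq_mul, Matrix.add_apply, Matrix.sub_apply, Matrix.smul_apply,
    Matrix.mul_apply, Matrix.of_apply, Matrix.cons_val_zero, Matrix.cons_val_one,
    Matrix.cons_val']
  linear_combination (k * B i 0 * (c * w 0 * e + v 0 * e - v 1 * e') +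
    k * B i 1 * (c * w 1 * e - v 0 * e' + v 1 * e)) * hI -
    ((Complex.I * A i 0 - k * B i 0) * (c * w 0 + v 0) +
      (Complex.I * A i 1 - k * B i 1) * (c * w 1 + v 1)) * h1

theorem dOp_apply (A B : Matrix (Fin 2) (Fin 2) ℂ) (L : ℝ) (k : ℂ) (f : BoxSpace L) :
    dOp A B L k f = ∑ j, (1 / (2 * Complex.I * k) * dFac L k *
      (gMat A B L k *ᵥ fun l => inner ℂ (eps L l (conj k)) f) j) • eps L j k := by
  simp only [dOp, Matrix.mulVec, dotProduct, Fin.sum_univ_two, smul_apply, add_apply,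
    ContinuousLinearMap.smulRight_apply, innerSL_apply_apply]
  module

theorem eps_coeFn (L : ℝ) (j : Fin 2) (k : ℂ) : eps L j k =ᵐ[boxMeasure L] planeWave j k :=
  (memLp_planeWave L j k).coeFn_toLp

/-- Plane waves satisfying the boundary conditions span the kernel of `k² - H_L`. -/
theorem planeWaves_mem_boxGraph {k : ℂ} (hk0 : k ≠ 0) (hU : IsUnit (Complex.I • A - k • B))
    (v : Fin 2 → ℂ) (hv : (dFac L k • (1 : Matrix (Fin 2) (Fin 2) ℂ) +
      bcMatrix A B k * sigmaX) *ᵥ v = 0) :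
    (v 0 • eps L 0 k + v 1 • eps L 1 k, (k ^ 2) • (v 0 • eps L 0 k + v 1 • eps L 1 k)) ∈
      boxGraph A B L := by
  have hc : (v 0 • eps L 0 k + v 1 • eps L 1 k : BoxSpace L) =ᵐ[boxMeasure L]
      fun x => v 0 * planeWave 0 k x + v 1 * planeWave 1 k x := by
    filter_upwards [Lp.coeFn_add (v 0 • eps L 0 k) (v 1 • eps L 1 k),
      Lp.coeFn_smul (v 0) (eps L 0 k), Lp.coeFn_smul (v 1) (eps L 1 k), eps_coeFn L 0 k, eps_coeFn L 1 k] with x h1 h2 h3 h4 h5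
    rw [h1, Pi.add_apply, h2, h3, Pi.smul_apply, Pi.smul_apply, h4, h5]
    rfl
  refine ⟨_, _, hc, (hasSecondDerivOn_planeWaves _ k (v 0) (v 1)).congr_ae Set.ordConnected_Icc ?_,
    ?_⟩
  · filter_upwards [hc, Lp.coeFn_smul (k ^ 2) (v 0 • eps L 0 k + v 1 • eps L 1 k)] with x h1 h2
    rw [h2, Pi.smul_apply, h1, smul_eq_mul]
  · have h := boundary_value (A := A) (B := B) hk0 hU (planeWave 0 k L) (planeWave 1 k L)
      (planeWave_mul_planeWave k L) v 0
    rw [← dFac_eq, hv] at h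
    simp only [Pi.zero_apply, mul_zero, zero_mul, zero_add, smul_zero, Matrix.mulVec_zero,
      neg_zero] at h
    rw [smul_eq_zero] at h
    simpa only [planeWave_zero_neg, planeWave_one_neg] using h.resolve_left Complex.I_ne_zero

/-- The value and the derivative at the interior point `0` give `v₀ + v₁ = 0` and `v₀ - v₁ = 0`. -/
theorem planeWaves_eq_zero (hL : 0 < L) {k : ℂ} (hk0 : k ≠ 0) {v : Fin 2 → ℂ}
    (h : (v 0 • eps L 0 k + v 1 • eps L 1 k : BoxSpace L) = 0) : v = 0 := by
  have hc : (fun x => v 0 * planeWave 0 k x + v 1 * planeWave 1 k x) =ᵐ[boxMeasure L]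
      fun _ => 0 := by
    filter_upwards [Lp.coeFn_add (v 0 • eps L 0 k) (v 1 • eps L 1 k),
      Lp.coeFn_smul (v 0) (eps L 0 k), Lp.coeFn_smul (v 1) (eps L 1 k), eps_coeFn L 0 k, eps_coeFn L 1 k,
      Lp.coeFn_zero ℂ 2 (boxMeasure L)] with x h1 h2 h3 h4 h5 h6
    rw [h, h6, Pi.add_apply, h2, h3, Pi.smul_apply, Pi.smul_apply, h4, h5] at h1
    exact h1.symm
  have hcont : Continuous fun x => v 0 * planeWave 0 k x + v 1 * planeWave 1 k x := by
    have := continuous_planeWave 0 k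
    have := continuous_planeWave 1 k
    fun_prop
  have h0 := Measure.eqOn_Icc_of_ae_eq volume (by linarith : -L ≠ L) hc hcont.continuousOn
    continuousOn_const
  have e1 := h0 (show (0 : ℝ) ∈ Set.Icc (-L) L from ⟨by linarith, hL.le⟩)
  have hd := ((hasDerivAt_planeWave_zero k 0).const_mul (v 0)).add
    ((hasDerivAt_planeWave_one k 0).const_mul (v 1))
  have hd0 : HasDerivAt (fun x => v 0 * planeWave 0 k x + v 1 * planeWave 1 k x) 0 0 := by
    refine (hasDerivAt_const (0 : ℝ) (0 : ℂ)).congr_of_eventuallyEq ?_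
    filter_upwards [Icc_mem_nhds (show -L < 0 by linarith) hL] with x hx
    exact h0 hx
  have e2 := hd.unique hd0
  have p0 : planeWave 0 k 0 = 1 := by simp [planeWave]
  have p1 : planeWave 1 k 0 = 1 := by simp [planeWave]
  simp only [p0, p1, mul_one] at e1 e2
  have e3 : v 0 - v 1 = 0 := by
    have : Complex.I * k * (v 0 - v 1) = 0 := by linear_combination e2
    exact (mul_eq_zero.1 this).resolve_left (by simp [hk0])
  ext i
  fin_cases i
  · change v 0 = 0
    linear_combination (e1 + e3) / 2
  · change v 1 = 0
    linear_combination (e1 - e3) / 2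

theorem isUnit_gMat_of_forall {k : ℂ} (h : ∀ v : Fin 2 → ℂ,
      (dFac L k • (1 : Matrix (Fin 2) (Fin 2) ℂ) + bcMatrix A B k * sigmaX) *ᵥ v = 0 → v = 0) :
    IsUnit (dFac L k • (1 : Matrix (Fin 2) (Fin 2) ℂ) + bcMatrix A B k * sigmaX) := by
  rw [Matrix.isUnit_iff_isUnit_det, isUnit_iff_ne_zero]
  intro h0
  obtain ⟨v, hv, hv0⟩ := Matrix.exists_mulVec_eq_zero_iff.2 h0
  exact hv (h v hv0)

/-- A null vector would be the coefficient vector of an eigenfunction of `H_L` with eigenvalue `k²`.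
-/
theorem isUnit_of_notMem_spectrum (hL : 0 < L) {k : ℂ} (hk0 : k ≠ 0)
    (hU : IsUnit (Complex.I • A - k • B)) (hz : k ^ 2 ∉ unboundedSpectrum (boxHamiltonian A B L)) :
    IsUnit (dFac L k • (1 : Matrix (Fin 2) (Fin 2) ℂ) + bcMatrix A B k * sigmaX) := by
  refine isUnit_gMat_of_forall fun v hv => ?_
  simp only [unboundedSpectrum, Set.mem_ofPred_eq, not_not] at hz
  obtain ⟨R, hR⟩ := hz
  have h1 := ((isResolventAt_toLinearPMap_iff (boxGraph_singleValued A B hL)).1 hR).2 _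
    (planeWaves_mem_boxGraph hk0 hU v hv)
  simp only [sub_self, map_zero] at h1
  exact planeWaves_eq_zero hL hk0 h1.symm

/-- A symmetric operator has no nonreal eigenvalue. This covers nonreal energies without assuming
that they lie in the resolvent set. -/
theorem isUnit_of_im_ne_zero (hAB : A * Bᴴ = B * Aᴴ) (hrank : (Matrix.fromCols A B).rank = 2)
    (hL : 0 < L) {k : ℂ} (hk0 : k ≠ 0)
    (hU : IsUnit (Complex.I • A - k • B)) (hz : (k ^ 2).im ≠ 0) :
    IsUnit (dFac L k • (1 : Matrix (Fin 2) (Fin 2) ℂ) + bcMatrix A B k * sigmaX) := by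
  refine isUnit_gMat_of_forall fun v hv => planeWaves_eq_zero hL hk0 ?_
  have h1 := planeWaves_mem_boxGraph (L := L) hk0 hU v hv
  set φ : BoxSpace L := v 0 • eps L 0 k + v 1 • eps L 1 k
  have h2 := boxGraph_symm hAB hrank hL h1 h1
  simp only [inner_smul_left, inner_smul_right] at h2
  have h3 : (conj (k ^ 2) - k ^ 2) * inner ℂ φ φ = 0 := by linear_combination h2
  rcases mul_eq_zero.1 h3 with h | h
  · rw [sub_eq_zero] at h
    exact absurd (Complex.conj_eq_iff_im.1 h) hz
  · exact inner_self_eq_zero.1 h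

theorem hasSecondDerivOn_box {k : ℂ} (hk0 : k ≠ 0) (f : BoxSpace L) :
    HasSecondDerivOn (Set.Icc (-L) L) (freeSol k ((Set.Icc (-L) L).indicator f))
      (freeSolDeriv k ((Set.Icc (-L) L).indicator f))
      (fun x => f x - k ^ 2 * freeSol k ((Set.Icc (-L) L).indicator f) x) := by
  have h := (hasSecondDerivOn_freeSol hk0 (freeIntegrable_box k f)).mono
    (Set.subset_univ (Set.Icc (-L) L))
  refine h.congr_ae Set.ordConnected_Icc ?_
  filter_upwards [ae_restrict_mem measurableSet_Icc] with x hx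
  rw [Set.indicator_of_mem hx]

/-- `(k² - H_L)⁻¹ = R_{∞,L} - D_L`. -/
theorem isResolventAt_box (hL : 0 < L) {k : ℂ} (hk0 : k ≠ 0) (hk : 0 ≤ k.im)
    (hU : IsUnit (Complex.I • A - k • B))
    (hG : IsUnit (dFac L k • (1 : Matrix (Fin 2) (Fin 2) ℂ) + bcMatrix A B k * sigmaX)) :
    IsResolventAt (boxHamiltonian A B L) (k ^ 2) (freeBoxResolvent L k - dOp A B L k) := by
  set R := freeBoxResolvent L k - dOp A B L k
  have hgraph : ∀ f, (R f, (k ^ 2) • R f - f) ∈ boxGraph A B L := by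
    intro f
    set h := (Set.Icc (-L) L).indicator f with hdef
    set w : Fin 2 → ℂ := fun l => inner ℂ (eps L l (conj k)) f with hw
    -- The plane wave coefficients that make the bracket in `boundary_value` vanish, as computed in
    -- `hGv`.
    set v : Fin 2 → ℂ := -((1 / (2 * Complex.I * k) * dFac L k) • (gMat A B L k *ᵥ w)) with hv
    have hc : R f =ᵐ[boxMeasure L]
        fun x => freeSol k h x + (v 0 * planeWave 0 k x + v 1 * planeWave 1 k x) := by
      have e : R f = freeBoxResolvent L k f + (v 0 • eps L 0 k + v 1 • eps L 1 k) := by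
        simp only [R, sub_apply, dOp_apply, Fin.sum_univ_two, hv, Pi.neg_apply, Pi.smul_apply,
          smul_eq_mul, hw]
        module
      rw [e]
      filter_upwards [Lp.coeFn_add (freeBoxResolvent L k f) (v 0 • eps L 0 k + v 1 • eps L 1 k),
        Lp.coeFn_add (v 0 • eps L 0 k) (v 1 • eps L 1 k), Lp.coeFn_smul (v 0) (eps L 0 k),
        Lp.coeFn_smul (v 1) (eps L 1 k), eps_coeFn L 0 k, eps_coeFn L 1 k,
        freeBoxResolvent_coeFn hk L f] with x h0 h1 h2 h3 h4 h5 h6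
      rw [h0, Pi.add_apply, h6, h1, Pi.add_apply, h2, h3, Pi.smul_apply, Pi.smul_apply, h4, h5]
      rfl
    refine ⟨_, _, hc, HasSecondDerivOn.congr_ae Set.ordConnected_Icc
      ((hasSecondDerivOn_box hk0 f).add (hasSecondDerivOn_planeWaves _ k (v 0) (v 1))) ?_, ?_⟩
    · filter_upwards [hc, Lp.coeFn_sub ((k ^ 2) • R f) f, Lp.coeFn_smul (k ^ 2) (R f)]
        with x h1 h2 h3
      rw [h2, Pi.sub_apply, h3, Pi.smul_apply, h1, smul_eq_mul, Pi.add_apply]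
      ring
    · have hb := boundary_value (A := A) (B := B) hk0 hU (planeWave 0 k L) (planeWave 1 k L)
        (planeWave_mul_planeWave k L) v w
      have hGv : (dFac L k • (1 : Matrix (Fin 2) (Fin 2) ℂ) + bcMatrix A B k * sigmaX) *ᵥ v =
          -((dFac L k / (2 * Complex.I * k)) • w) := by
        rw [hv, Matrix.mulVec_neg, Matrix.mulVec_smul, Matrix.mulVec_mulVec, gMat,
          Matrix.mul_nonsing_inv _ ((Matrix.isUnit_iff_isUnit_det _).1 hG), Matrix.one_mulVec]
        congr 2
        ring
      rw [← dFac_eq, hGv, add_neg_cancel, Matrix.mulVec_zero, smul_zero, smul_eq_zero] at hb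
      have hb' := hb.resolve_left Complex.I_ne_zero
      have w0 : w 0 = ∫ y in Set.Icc (-L) L, planeWave 1 k y * f y := inner_eps_zero k f
      have w1 : w 1 = ∫ y in Set.Icc (-L) L, planeWave 0 k y * f y := inner_eps_one k f
      simp only [Pi.add_apply, hdef, (freeSol_of_ge (le_refl L)).1, (freeSol_of_ge (le_refl L)).2,
        (freeSol_of_le (le_refl (-L))).1, (freeSol_of_le (le_refl (-L))).2, planeWave_zero_neg,
        planeWave_one_neg, ← w0, ← w1]
      exact hb'
  refine (isResolventAt_toLinearPMap_iff (boxGraph_singleValued A B hL)).2 ⟨hgraph, ?_⟩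
  intro p hp
  set f := (k ^ 2) • p.1 - p.2
  -- For the left inverse: `p.1 - R f` satisfies the boundary conditions and the homogeneous
  -- equation, so it is a combination of plane waves, and the two invertible matrices in
  -- `boundary_value` annihilate its coefficients.
  have hq := (boxGraph A B L).sub_mem hp (hgraph f)
  have h2 : p - (R f, (k ^ 2) • R f - f) = (p.1 - R f, (k ^ 2) • (p.1 - R f)) := by
    refine Prod.ext rfl ?_
    simp only [f, Prod.snd_sub, smul_sub]
    abel
  rw [h2] at hq
  set q := p.1 - R f
  obtain ⟨u, u', hu1, hu2, hu3⟩ := hq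
  simp only at hu1 hu2
  obtain ⟨a, b, hab⟩ := hu2.exists_eq_planeWaves Set.ordConnected_Icc hk0 fun x hx y hy => by
    have hsub : Set.uIoc x y ⊆ Set.Icc (-L) L :=
      Set.uIoc_subset_uIcc.trans (Set.ordConnected_Icc.uIcc_subset hx hy)
    refine ae_restrict_of_ae_restrict_of_subset hsub ?_
    filter_upwards [hu1, Lp.coeFn_smul (k ^ 2) q] with t h3 h4
    rw [h4, Pi.smul_apply, smul_eq_mul, h3]
  have hl : -L ∈ Set.Icc (-L) L := ⟨le_rfl, by linarith⟩
  have hr : L ∈ Set.Icc (-L) L := ⟨by linarith, le_rfl⟩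
  have hb := boundary_value (A := A) (B := B) hk0 hU (planeWave 0 k L) (planeWave 1 k L)
    (planeWave_mul_planeWave k L) ![a, b] 0
  simp only [Pi.zero_apply, mul_zero, zero_mul, zero_add, smul_zero, neg_zero,
    Matrix.cons_val_zero, Matrix.cons_val_one, ← dFac_eq] at hb
  rw [(hab L hr).1, (hab L hr).2, (hab _ hl).1, (hab _ hl).2, planeWave_zero_neg,
    planeWave_one_neg] at hu3
  rw [hu3, smul_zero] at hb
  have hb1 := (smul_eq_zero.1 hb.symm).resolve_left (planeWave_ne_zero 1 k L)
  have hb2 := Matrix.eq_zero_of_mulVec_eq_zero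
    ((Matrix.isUnit_iff_isUnit_det _).1 hU).ne_zero hb1
  have hb3 := Matrix.eq_zero_of_mulVec_eq_zero
    ((Matrix.isUnit_iff_isUnit_det _).1 hG).ne_zero hb2
  have ha0 : a = 0 := congrFun hb3 0
  have hb0 : b = 0 := congrFun hb3 1
  have h0 : q = 0 := by
    refine Lp.ext ?_
    filter_upwards [hu1, Lp.coeFn_zero ℂ 2 (boxMeasure L), ae_restrict_mem measurableSet_Icc]
      with x h3 h4 hx
    rw [h3, (hab x hx).1, h4, ha0, hb0]
    simp
  exact (sub_eq_zero.1 h0).symm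

end BoxResolvent

/-! ### The free resolvent on the box: energy identity and Birman-Schwinger operators -/

section FreeBS

variable {V : ℝ → ℝ} {L : ℝ} {k : ℂ}

theorem freeSolDeriv_right (hk0 : k ≠ 0) (h : ℝ → ℂ) :
    freeSolDeriv k ((Set.Icc (-L) L).indicator h) L =
      Complex.I * k * freeSol k ((Set.Icc (-L) L).indicator h) L := by
  rw [(freeSol_of_ge le_rfl).1, (freeSol_of_ge le_rfl).2]
  field_simp

theorem freeSolDeriv_left (hk0 : k ≠ 0) (h : ℝ → ℂ) :
    freeSolDeriv k ((Set.Icc (-L) L).indicator h) (-L) =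
      -(Complex.I * k * freeSol k ((Set.Icc (-L) L).indicator h) (-L)) := by
  rw [(freeSol_of_le le_rfl).1, (freeSol_of_le le_rfl).2]
  field_simp

/-- Green's identity for `conj u` and `u`. The outgoing conditions at `±L` turn the boundary terms
into the radiated flux, which is proportional to `Re k`. -/
theorem im_inner_freeBoxResolvent (hL : 0 < L) (hk0 : k ≠ 0) (hk : 0 ≤ k.im) (ψ : BoxSpace L) :
    (inner ℂ ψ (freeBoxResolvent L k ψ) : ℂ).im =
      -k.re * (‖freeSol k ((Set.Icc (-L) L).indicator ψ) L‖ ^ 2 +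
        ‖freeSol k ((Set.Icc (-L) L).indicator ψ) (-L)‖ ^ 2) -
      (k ^ 2).im * ‖freeBoxResolvent L k ψ‖ ^ 2 := by
  set u := freeSol k ((Set.Icc (-L) L).indicator ψ) with hu
  set φ := freeBoxResolvent L k ψ with hφ
  have hφu : φ =ᵐ[boxMeasure L] u := freeBoxResolvent_coeFn hk L ψ
  have hd := hasSecondDerivOn_box hk0 ψ
  have hl : -L ∈ Set.Icc (-L) L := ⟨le_rfl, by linarith⟩
  have hr : L ∈ Set.Icc (-L) L := ⟨by linarith, le_rfl⟩
  have hw := (hd.star.wronskian Set.ordConnected_Icc hd (-L) hl L hr).2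
  beta_reduce at hw
  rw [freeSolDeriv_right hk0, freeSolDeriv_left hk0, ← hu, ← integral_Icc_eq_interval hL] at hw
  have hI : inner ℂ φ ψ - inner ℂ ψ φ + (conj (k ^ 2) - k ^ 2) * inner ℂ φ φ =
      ∫ x in Set.Icc (-L) L, (conj (u x) * (ψ x - k ^ 2 * u x) -
        conj (ψ x - k ^ 2 * u x) * u x) := by
    have h1 := L2.integrable_inner (𝕜 := ℂ) φ ψ
    have h2 := L2.integrable_inner (𝕜 := ℂ) ψ φ
    have h3 := (L2.integrable_inner (𝕜 := ℂ) φ φ).const_mul (conj (k ^ 2) - k ^ 2)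
    rw [L2.inner_def, L2.inner_def, L2.inner_def, ← integral_const_mul, ← integral_sub h1 h2]
    refine (integral_add (h1.sub h2) h3).symm.trans ?_
    refine integral_congr_ae ?_
    filter_upwards [hφu] with x hx
    simp only [Pi.sub_apply, RCLike.inner_apply', hx, map_sub, map_mul]
    ring
  rw [← hw, ← inner_conj_symm φ ψ, inner_self_eq_norm_sq_to_K] at hI
  have h1 : ∀ c : ℂ, conj c * c = ((‖c‖ ^ 2 : ℝ) : ℂ) := fun c => by
    rw [← Complex.normSq_eq_conj_mul_self, Complex.normSq_eq_norm_sq]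
  have h2 : conj (u L) * (Complex.I * k * u L) - conj (Complex.I * k * u L) * u L -
      (conj (u (-L)) * -(Complex.I * k * u (-L)) - conj (-(Complex.I * k * u (-L))) * u (-L)) =
      Complex.I * (k + conj k) * ((‖u L‖ ^ 2 + ‖u (-L)‖ ^ 2 : ℝ) : ℂ) := by
    rw [Complex.ofReal_add, ← h1, ← h1]
    simp only [map_mul, map_neg, Complex.conj_I]
    ring
  rw [h2] at hI
  have h3 := congrArg Complex.im hI
  have h4 : ∀ r : ℝ, ((r : ℂ) ^ 2) = ((r ^ 2 : ℝ) : ℂ) := fun r => by push_cast; rfl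
  simp only [Complex.coe_algebraMap, h4, Complex.add_im, Complex.sub_im, Complex.mul_im,
    Complex.conj_im, Complex.conj_re, Complex.ofReal_im, Complex.ofReal_re, Complex.I_re,
    Complex.I_im, Complex.add_re, Complex.sub_re, Complex.mul_re] at h3
  linarith

theorem isTraceClass_freeBS (hk0 : k ≠ 0) (hk : 0 ≤ k.im) : IsTraceClass (freeBS V L k) := by
  have h := (isTraceClass_freeBoxResolvent hk0 hk L).mul_mul (sqrtAbsOp V L)
    (sqrtAbsOp V L * signOp V L)
  rwa [← mul_assoc] at h

theorem freeBS_apply (φ : BoxSpace L) : freeBS V L k φ =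
    sqrtAbsOp V L (freeBoxResolvent L k (sqrtAbsOp V L (signOp V L φ))) := rfl

theorem inner_sqrtAbsOp (hV : MemLp V ∞ volume) (φ ψ : BoxSpace L) :
    inner ℂ (sqrtAbsOp V L φ) ψ = inner ℂ φ (sqrtAbsOp V L ψ) := by
  rw [← ContinuousLinearMap.adjoint_inner_right, adjoint_sqrtAbsOp hV]

theorem inner_signOp (hV : MemLp V ∞ volume) (φ ψ : BoxSpace L) :
    inner ℂ (signOp V L φ) ψ = inner ℂ φ (signOp V L ψ) := by
  rw [← ContinuousLinearMap.adjoint_inner_right, adjoint_signOp hV]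

theorem im_inner_signOp (hV : MemLp V ∞ volume) (φ : BoxSpace L) :
    (inner ℂ (signOp V L φ) φ : ℂ).im = 0 := by
  rw [← Complex.conj_eq_iff_im, inner_conj_symm, inner_signOp hV]

/-- Since `Im k² = 2 Re k Im k` and `Im k ≥ 0`, flux and dissipation have the same sign, so both
vanish. -/
theorem norm_eq_zero_of_energy {a b : ℝ} (ha : 0 ≤ a) (hk : 0 ≤ k.im) (hz : (k ^ 2).im ≠ 0)
    (h : -k.re * a - (k ^ 2).im * b ^ 2 = 0) : b = 0 := by
  have e : (k ^ 2).im = 2 * k.re * k.im := by rw [pow_two, Complex.mul_im]; ring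
  rw [e] at hz h
  have hr : k.re ≠ 0 := fun h => hz (by rw [h]; ring)
  have hi : 0 < k.im := lt_of_le_of_ne hk fun h => hz (by rw [← h]; ring)
  have h1 : k.re * (a + 2 * k.im * b ^ 2) = 0 := by linarith
  have h2 := (mul_eq_zero.1 h1).resolve_left hr
  have h3 : b ^ 2 = 0 := by
    have : 0 ≤ 2 * k.im * b ^ 2 := by positivity
    have h4 : 2 * k.im * b ^ 2 = 0 := by linarith
    exact (mul_eq_zero.1 h4).resolve_left (by positivity)
  exact pow_eq_zero_iff two_ne_zero |>.1 h3

/-- A continuous function controlled by its own integral vanishes. -/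
theorem eq_zero_of_le_integral {v : ℝ → ℝ} {a b C : ℝ} (hv : Continuous v) (hv0 : ∀ x, 0 ≤ v x)
    (h : ∀ x ∈ Set.Icc a b, v x ≤ C * ∫ t in a..x, v t) : ∀ x ∈ Set.Icc a b, v x = 0 := by
  have hF : ∀ x, HasDerivAt (fun x => ∫ t in a..x, v t) (v x) x := fun x =>
    intervalIntegral.integral_hasDerivAt_right (hv.intervalIntegrable _ _)
      (hv.stronglyMeasurableAtFilter _ _) hv.continuousAt
  intro x hx
  have hFnn : ∀ y ∈ Set.Icc a b, 0 ≤ ∫ t in a..y, v t := fun y hy =>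
    intervalIntegral.integral_nonneg hy.1 fun t _ => hv0 t
  -- Grönwall's inequality for the primitive of `v`, which starts at zero.
  have h0 := norm_le_gronwallBound_of_norm_deriv_right_le (f := fun x => ∫ t in a..x, v t) (f' := v)
    (δ := 0) (K := C) (ε := 0) (a := a) (b := b) (fun y _ => (hF y).continuousAt.continuousWithinAt)
    (fun y _ => (hF y).hasDerivWithinAt) (by simp) (fun y hy => by
      have hy' := Set.Ico_subset_Icc_self hy
      rw [Real.norm_of_nonneg (hv0 y), Real.norm_of_nonneg (hFnn y hy'), add_zero]
      exact h y hy') x hx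
  rw [gronwallBound_ε0_δ0, norm_le_zero_iff] at h0
  have := h x hx
  rw [h0, mul_zero] at this
  exact le_antisymm this (hv0 x)

theorem continuous_freeSol_box (hk0 : k ≠ 0) (ψ : BoxSpace L) :
    Continuous (freeSol k ((Set.Icc (-L) L).indicator ψ)) :=
  (hasSecondDerivOn_freeSol hk0 (freeIntegrable_box k ψ)).left.continuous

/-- Unique continuation for a solution with vanishing boundary values (real `k`). -/
theorem freeSol_eq_zero_of_real (hV : MemLp V ∞ volume) (hL : 0 < L) (hk0 : k ≠ 0) (hk : k.im = 0)
    {ψ : BoxSpace L}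
    (hψ : ψ =ᵐ[boxMeasure L] fun x => V x * freeSol k ((Set.Icc (-L) L).indicator ψ) x)
    (h0 : freeSol k ((Set.Icc (-L) L).indicator ψ) (-L) = 0) :
    ∀ x ∈ Set.Icc (-L) L, freeSol k ((Set.Icc (-L) L).indicator ψ) x = 0 := by
  set u := freeSol k ((Set.Icc (-L) L).indicator ψ) with hu
  have hcu : Continuous u := continuous_freeSol_box hk0 ψ
  obtain ⟨C, hC⟩ := exists_ae_bound hV
  have hd := hasSecondDerivOn_box hk0 ψ
  have hl : -L ∈ Set.Icc (-L) L := ⟨le_rfl, by linarith⟩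
  have hn : ∀ j x, ‖planeWave j k x‖ = 1 := by
    intro j x
    fin_cases j
    · simp [norm_planeWave_zero, hk]
    · simp [norm_planeWave_one, hk]
  have key : ∀ x ∈ Set.Icc (-L) L, ‖u x‖ ≤ (C / ‖k‖) * ∫ t in (-L)..x, ‖u t‖ := by
    intro x hx
    -- Both amplitudes are transported from `-L`, where `u` vanishes and, by the outgoing condition,
    -- so does `u'`. The two integrals contribute `C ∫ |u|` each, and dividing by `2 |k|` gives the
    -- constant `C / |k|`.
    have h1 := hd.variation_of_constants Set.ordConnected_Icc k hl hl hx
    rw [freeSolDeriv_left hk0, ← hu, h0] at h1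
    have hb : ∀ j, ‖∫ t in (-L)..x, planeWave j k t * (ψ t - k ^ 2 * u t + k ^ 2 * u t)‖ ≤
        C * ∫ t in (-L)..x, ‖u t‖ := by
      intro j
      rw [← intervalIntegral.integral_const_mul]
      refine intervalIntegral.norm_integral_le_of_norm_le hx.1 ?_
        ((hcu.norm.const_mul C).intervalIntegrable _ _)
      have h2 := (ae_restrict_iff' measurableSet_Icc).1 hψ
      filter_upwards [h2, hC] with t h2 h3 ht
      rw [sub_add_cancel, norm_mul, hn, one_mul, h2 ⟨ht.1.le, ht.2.trans hx.2⟩, norm_mul,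
        Complex.norm_real]
      exact mul_le_mul_of_nonneg_right h3 (norm_nonneg _)
    rw [intervalIntegral.integral_symm (-L) x] at h1
    simp only [mul_zero, neg_zero, add_zero, zero_add, sub_zero, sub_neg_eq_add] at h1
    have h3 := congrArg norm h1
    rw [norm_mul, norm_mul, norm_mul, Complex.norm_I] at h3
    have h4 := (norm_sub_le (planeWave 0 k x *
        ∫ t in (-L)..x, planeWave 1 k t * (ψ t - k ^ 2 * u t + k ^ 2 * u t))
      (planeWave 1 k x * ∫ t in (-L)..x, planeWave 0 k t * (ψ t - k ^ 2 * u t + k ^ 2 * u t)))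
    simp only [norm_mul, hn, one_mul] at h4
    have hkp : 0 < ‖k‖ := norm_pos_iff.2 hk0
    rw [div_mul_eq_mul_div, le_div_iff₀ hkp]
    have h5 := hb 0
    have h6 := hb 1
    have h7 : ‖(2 : ℂ)‖ = 2 := by simp
    rw [h7] at h3
    nlinarith [h3, h4, h5, h6]
  intro x hx
  exact norm_eq_zero.1 (eq_zero_of_le_integral hcu.norm (fun x => norm_nonneg _) key x hx)

/-- The Neumann series bound for a strongly negative energy. -/
theorem freeSol_eq_zero_of_large (hV : Integrable V volume) (hL : 0 < L) (hk0 : k ≠ 0)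
    (hk : 0 ≤ k.im) (hk2 : ∫ x, |V x| < 2 * ‖k‖) {ψ : BoxSpace L}
    (hψ : ψ =ᵐ[boxMeasure L] fun x => V x * freeSol k ((Set.Icc (-L) L).indicator ψ) x) :
    ∀ x ∈ Set.Icc (-L) L, freeSol k ((Set.Icc (-L) L).indicator ψ) x = 0 := by
  set u := freeSol k ((Set.Icc (-L) L).indicator ψ) with hu
  have hcu : Continuous u := continuous_freeSol_box hk0 ψ
  obtain ⟨x₀, hx₀, hmax⟩ := (isCompact_Icc (a := -L) (b := L)).exists_isMaxOn
    ⟨L, by constructor <;> linarith⟩ hcu.norm.continuousOn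
  have hmax' : ∀ x ∈ Set.Icc (-L) L, ‖u x‖ ≤ ‖u x₀‖ := fun x hx => hmax hx
  have hkp : 0 < ‖k‖ := norm_pos_iff.2 hk0
  -- At a maximum of `|u|` the integral equation gives `|u(x₀)| ≤ ‖V‖₁ / (2|k|) · |u(x₀)|`, with a
  -- factor less than one.
  have h1 : ‖u x₀‖ ≤ ∫ y in Set.Icc (-L) L, (1 / (2 * ‖k‖) * ‖u x₀‖) * |V y| := by
    have e : u x₀ = ∫ y in Set.Icc (-L) L, freeKernel k x₀ y * ψ y :=
      freeSol_indicator_eq_integral k ψ x₀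
    conv_lhs => rw [e]
    refine norm_integral_le_of_norm_le (hV.abs.integrableOn.const_mul _) ?_
    filter_upwards [hψ, ae_restrict_mem measurableSet_Icc] with y hy hym
    rw [norm_mul, hy, norm_mul, Complex.norm_real, Real.norm_eq_abs]
    calc ‖freeKernel k x₀ y‖ * (|V y| * ‖u y‖) ≤ 1 / (2 * ‖k‖) * (|V y| * ‖u x₀‖) := by
          refine mul_le_mul ((bddKernel_freeKernel hk).bound _ _) ?_ (by positivity) (by positivity)
          exact mul_le_mul_of_nonneg_left (hmax' y hym) (abs_nonneg _)
      _ = _ := by ring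
  rw [integral_const_mul] at h1
  have h2 : ∫ y in Set.Icc (-L) L, |V y| ≤ ∫ y, |V y| :=
    setIntegral_le_integral hV.abs (Eventually.of_forall fun _ => abs_nonneg _)
  have h3 : ‖u x₀‖ = 0 := by
    by_contra hne
    have hpos : 0 < ‖u x₀‖ := lt_of_le_of_ne (norm_nonneg _) (Ne.symm hne)
    have h4 : 1 / (2 * ‖k‖) * ‖u x₀‖ * ∫ y in Set.Icc (-L) L, |V y| <
        1 / (2 * ‖k‖) * ‖u x₀‖ * (2 * ‖k‖) :=
      mul_lt_mul_of_pos_left (h2.trans_lt hk2) (by positivity)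
    have h5 : 1 / (2 * ‖k‖) * ‖u x₀‖ * (2 * ‖k‖) = ‖u x₀‖ := by field_simp
    linarith
  intro x hx
  exact norm_eq_zero.1 (le_antisymm ((hmax' x hx).trans h3.le) (norm_nonneg _))

/-- By the Fredholm alternative only injectivity is at stake. If `K_∞ φ = φ` and `ψ = √|V| J φ`,
then `⟪ψ, R ψ⟫ = ⟪J φ, φ⟫` is real, and the energy identity applies. It gives `R ψ = 0` at once for
nonreal `z` and zero boundary values for `z > 0`; the remaining energies lie below `-‖V‖₁² / 4`. -/
theorem isUnit_one_sub_freeBS (hV : Integrable V volume) (hVb : MemLp V ∞ volume) (hL : 0 < L)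
    (hk0 : k ≠ 0) (hk : 0 ≤ k.im)
    (h : ¬ ((k ^ 2).im = 0 ∧ -(1 / 4) * (∫ x, |V x|) ^ 2 ≤ (k ^ 2).re ∧ (k ^ 2).re ≤ 0)) :
    IsUnit (1 - freeBS V L k) := by
  refine (isTraceClass_freeBS hk0 hk).isUnit_one_sub fun φ hφ => ?_
  rw [freeBS_apply] at hφ
  set ψ := sqrtAbsOp V L (signOp V L φ) with hψ
  suffices freeBoxResolvent L k ψ = 0 by rw [← hφ, this, map_zero]
  have hre : (inner ℂ ψ (freeBoxResolvent L k ψ) : ℂ).im = 0 := by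
    rw [hψ, inner_sqrtAbsOp hVb, ← hψ, hφ, im_inner_signOp hVb]
  rw [im_inner_freeBoxResolvent hL hk0 hk] at hre
  by_cases hz : (k ^ 2).im = 0
  · set u := freeSol k ((Set.Icc (-L) L).indicator ψ) with hu
    have hRu : freeBoxResolvent L k ψ =ᵐ[boxMeasure L] u := freeBoxResolvent_coeFn hk L ψ
    have hψu : ψ =ᵐ[boxMeasure L] fun x => V x * u x := by
      have h1 := sqrtAbs_sign_sqrtAbs_coeFn hVb L (freeBoxResolvent L k ψ)
      rw [hφ, ← hψ] at h1
      filter_upwards [h1, hRu] with x h1 h2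
      rw [h1, h2]
    have hzero : ∀ x ∈ Set.Icc (-L) L, u x = 0 := by
      have e1 : (k ^ 2).im = 2 * k.re * k.im := by rw [pow_two, Complex.mul_im]; ring
      have e2 : (k ^ 2).re = k.re ^ 2 - k.im ^ 2 := by rw [pow_two, Complex.mul_re]; ring
      by_cases hi : k.im = 0
      · have hkr : k.re ≠ 0 := fun h => hk0 (Complex.ext h hi)
        refine freeSol_eq_zero_of_real hVb hL hk0 hi hψu ?_
        rw [hz, zero_mul, sub_zero] at hre
        have h1 := (mul_eq_zero.1 hre).resolve_left (neg_ne_zero.2 hkr)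
        have h2 := (add_eq_zero_iff_of_nonneg (sq_nonneg _) (sq_nonneg _)).1 h1
        exact norm_eq_zero.1 (pow_eq_zero_iff two_ne_zero |>.1 h2.2)
      · have hr : k.re = 0 := by
          rw [e1] at hz
          rcases mul_eq_zero.1 hz with h | h
          · linarith
          · exact absurd h hi
        refine freeSol_eq_zero_of_large hV hL hk0 hk ?_ hψu
        have hn : ‖k‖ = k.im := by
          rw [← Complex.re_add_im k, hr]
          simp [abs_of_nonneg hk]
        -- On the imaginary axis `z = -|k|²`, so `z < -‖V‖₁² / 4` is the contraction condition `‖V‖₁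
        -- < 2|k|`.
        have h1 : (k ^ 2).re < -(1 / 4) * (∫ x, |V x|) ^ 2 := by
          by_contra hcon
          exact h ⟨hz, not_lt.1 hcon, by rw [e2, hr]; nlinarith [sq_nonneg k.im]⟩
        rw [e2, hr] at h1
        rw [hn]
        refine lt_of_pow_lt_pow_left₀ 2 (by positivity) ?_
        nlinarith [h1]
    refine Lp.ext ?_
    filter_upwards [hRu, Lp.coeFn_zero ℂ 2 (boxMeasure L), ae_restrict_mem measurableSet_Icc]
      with x h1 h2 hx
    rw [h1, hzero x hx, h2]
    rfl
  · exact norm_eq_zero.1 (norm_eq_zero_of_energy (by positivity) hk hz hre)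

end FreeBS

/-! ### Scattering theory of the truncated potential -/

section Scattering

variable {V : ℝ → ℝ} {L : ℝ} {k : ℂ}

/-- A solution `f = V (a e^{ikx} + b e^{-ikx} + R_{∞,L} f)` of the Lippmann-Schwinger equation
gives a solution of the Schrödinger equation. -/
theorem isTruncatedSolution_of_box (hk0 : k ≠ 0) (a b : ℂ) {f : BoxSpace L}
    (hf : f =ᵐ[boxMeasure L] fun x => V x * (a * planeWave 0 k x + b * planeWave 1 k x +
      freeSol k ((Set.Icc (-L) L).indicator f) x)) :
    HasSecondDerivOn Set.univ
      (fun x => a * planeWave 0 k x + b * planeWave 1 k x +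
        freeSol k ((Set.Icc (-L) L).indicator f) x)
      (fun x => Complex.I * k * (a * planeWave 0 k x - b * planeWave 1 k x) +
        freeSolDeriv k ((Set.Icc (-L) L).indicator f) x)
      (fun x => (((Set.Icc (-L) L).indicator V x : ℝ) - k ^ 2) *
        (a * planeWave 0 k x + b * planeWave 1 k x +
          freeSol k ((Set.Icc (-L) L).indicator f) x)) := by
  refine HasSecondDerivOn.congr_ae Set.ordConnected_univ
    ((hasSecondDerivOn_planeWaves Set.univ k a b).add
      (hasSecondDerivOn_freeSol hk0 (freeIntegrable_box k f))) ?_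
  rw [Measure.restrict_univ]
  filter_upwards [(ae_restrict_iff' measurableSet_Icc).1 hf] with x hx
  rw [Pi.add_apply]
  by_cases hxm : x ∈ Set.Icc (-L) L
  · rw [Set.indicator_of_mem hxm V, Set.indicator_of_mem hxm f]
    rw [hx hxm]
    ring
  · rw [Set.indicator_of_notMem hxm V, Set.indicator_of_notMem hxm f]
    push_cast
    ring

theorem continuous_of_isTruncatedSolution {u : ℝ → ℂ} (hu : IsTruncatedSolution V L k u) :
    Continuous u := by
  obtain ⟨u', hu⟩ := hu
  exact hu.left.continuous

theorem IsTruncatedSolution.sub {u v : ℝ → ℂ} (hu : IsTruncatedSolution V L k u)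
    (hv : IsTruncatedSolution V L k v) : IsTruncatedSolution V L k fun x => u x - v x := by
  obtain ⟨u', hu⟩ := hu
  obtain ⟨v', hv⟩ := hv
  refine ⟨fun x => u' x - v' x, (hu.left.sub hv.left).hasSecondDerivOn ?_⟩
  convert hu.right.sub hv.right using 1
  ext x
  ring

/-- Transfers the derivative at an end of the box from a formula known only outside the box. -/
theorem eq_of_hasDerivWithinAt_Ici {u v : ℝ → ℂ} {a : ℝ} {c d : ℂ} (hu : HasDerivAt u c a)
    (hv : HasDerivAt v d a) (h : ∀ x ≥ a, u x = v x) : c = d := by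
  have h1 : HasDerivWithinAt u d (Set.Ici a) a :=
    hv.hasDerivWithinAt.congr (fun x hx => h x hx) (h a le_rfl)
  exact (uniqueDiffWithinAt_Ici a).eq_deriv _ hu.hasDerivWithinAt h1

theorem eq_of_hasDerivWithinAt_Iic {u v : ℝ → ℂ} {a : ℝ} {c d : ℂ} (hu : HasDerivAt u c a)
    (hv : HasDerivAt v d a) (h : ∀ x ≤ a, u x = v x) : c = d := by
  have h1 : HasDerivWithinAt u d (Set.Iic a) a :=
    hv.hasDerivWithinAt.congr (fun x hx => h x hx) (h a le_rfl)
  exact (uniqueDiffWithinAt_Iic a).eq_deriv _ hu.hasDerivWithinAt h1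

/-- There are no nonzero outgoing solutions. -/
theorem eq_zero_of_outgoing (hVb : MemLp V ∞ volume) (hL : 0 < L) (hk0 : k ≠ 0) (hk : 0 ≤ k.im)
    (hΩ : IsUnit (1 - freeBS V L k)) {v : ℝ → ℂ} (hv : IsTruncatedSolution V L k v) {c c' : ℂ}
    (hl : ∀ x ≤ -L, v x = c' * planeWave 1 k x) (hr : ∀ x ≥ L, v x = c * planeWave 0 k x) :
    c' = 0 ∧ c = 0 := by
  have hcont := continuous_of_isTruncatedSolution hv
  obtain ⟨v', hv⟩ := hv
  have hder : ∀ x, HasDerivAt v (v' x) x := fun x => hv.left.hasDerivAt hv.right.continuous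
  have h1 : v' L = Complex.I * k * v L := by
    rw [eq_of_hasDerivWithinAt_Ici (hder L) ((hasDerivAt_planeWave_zero k L).const_mul c) hr,
      hr L le_rfl]
    ring
  have h2 : v' (-L) = -(Complex.I * k * v (-L)) := by
    rw [eq_of_hasDerivWithinAt_Iic (hder (-L)) ((hasDerivAt_planeWave_one k (-L)).const_mul c') hl,
      hl _ le_rfl]
    ring
  have hmem : MemLp v 2 (boxMeasure L) := by
    obtain ⟨C, hC⟩ := (isCompact_Icc (a := -L) (b := L)).exists_bound_of_continuousOn
      hcont.continuousOn
    exact MemLp.of_bound hcont.aestronglyMeasurable C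
      ((ae_restrict_iff' measurableSet_Icc).2 (Eventually.of_forall hC))
  set w : BoxSpace L := hmem.toLp v
  have hw : w =ᵐ[boxMeasure L] v := hmem.coeFn_toLp
  -- `f = V v` is the source of the outgoing solution `v`, so `v = R_{∞,L} f` on the box and `√|V|
  -- v` is a fixed vector of `K_{∞,L}`.
  set f := sqrtAbsOp V L (signOp V L (sqrtAbsOp V L w)) with hf
  have hfv : f =ᵐ[boxMeasure L] fun x => (V x : ℂ) * w x := sqrtAbs_sign_sqrtAbs_coeFn hVb L w
  have hvf : ∀ x ∈ Set.Icc (-L) L, v x = freeSol k ((Set.Icc (-L) L).indicator f) x := by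
    intro x hx
    refine eq_freeSol_of_outgoing hL hk0 (hv.mono (Set.subset_univ _)) ?_ h1 h2 hx
    filter_upwards [hfv, hw, ae_restrict_mem measurableSet_Icc] with t e1 e2 ht
    rw [e1, e2, Set.indicator_of_mem ht]
    ring
  have hRf : freeBoxResolvent L k f = w := by
    refine Lp.ext ?_
    filter_upwards [freeBoxResolvent_coeFn hk L f, hw, ae_restrict_mem measurableSet_Icc]
      with x e1 e2 hx
    rw [e1, e2, hvf x hx]
  have hK : (1 - freeBS V L k) (sqrtAbsOp V L w) = 0 := by
    rw [sub_apply, one_apply_eq_self, freeBS_apply, ← hf, hRf, sub_self]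
  have hinj : sqrtAbsOp V L w = 0 := by
    obtain ⟨U, hU⟩ := hΩ
    have h3 : (U⁻¹.val * U.val) (sqrtAbsOp V L w) = 0 := by
      rw [mul_apply_eq_comp, hU, hK, map_zero]
    rwa [Units.inv_mul, one_apply_eq_self] at h3
  have hw0 : w = 0 := by rw [← hRf, hf, hinj, map_zero, map_zero, map_zero]
  have hv0 : v =ᵐ[boxMeasure L] fun _ => 0 := by
    rw [hw0] at hw
    exact hw.symm.trans (Lp.coeFn_zero _ _ _)
  have h0 := Measure.eqOn_Icc_of_ae_eq volume (by linarith : -L ≠ L) hv0 hcont.continuousOn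
    continuousOn_const
  constructor
  · have e1 := h0 (show -L ∈ Set.Icc (-L) L from ⟨le_rfl, by linarith⟩)
    rw [hl _ le_rfl] at e1
    exact (mul_eq_zero.1 e1).resolve_right (planeWave_ne_zero _ _ _)
  · have e1 := h0 (show L ∈ Set.Icc (-L) L from ⟨by linarith, le_rfl⟩)
    rw [hr _ le_rfl] at e1
    exact (mul_eq_zero.1 e1).resolve_right (planeWave_ne_zero _ _ _)

theorem IsScatteringMatrix.unique (hVb : MemLp V ∞ volume) (hL : 0 < L) (hk0 : k ≠ 0)
    (hk : 0 ≤ k.im) (hΩ : IsUnit (1 - freeBS V L k)) {S S' : Matrix (Fin 2) (Fin 2) ℂ}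
    (h : IsScatteringMatrix V L k S) (h' : IsScatteringMatrix V L k S') : S = S' := by
  obtain ⟨t, r₁, r₂, rfl, ⟨u, hu, hul, hur⟩, v, hv, hvl, hvr⟩ := h
  obtain ⟨t', r₁', r₂', rfl, ⟨u', hu', hul', hur'⟩, v', hv', hvl', hvr'⟩ := h'
  obtain ⟨h1, h2⟩ := eq_zero_of_outgoing hVb hL hk0 hk hΩ (hu.sub hu') (c := r₁ - r₁')
    (c' := t - t') (fun x hx => by rw [hul x hx, hul' x hx]; ring)
    (fun x hx => by rw [hur x hx, hur' x hx]; ring)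
  obtain ⟨h3, -⟩ := eq_zero_of_outgoing hVb hL hk0 hk hΩ (hv.sub hv') (c := t - t')
    (c' := r₂ - r₂') (fun x hx => by rw [hvl x hx, hvl' x hx]; ring)
    (fun x hx => by rw [hvr x hx, hvr' x hx]; ring)
  rw [sub_eq_zero.1 h1, sub_eq_zero.1 h2, sub_eq_zero.1 h3]

/-! ### The Lippmann-Schwinger equation and the T-matrix. -/

/-- `V` times the scattering solution with incoming wave `ε_j`. -/
def scatSource (V : ℝ → ℝ) (L : ℝ) (k : ℂ) (j : Fin 2) : BoxSpace L :=
  sqrtAbsOp V L (signOp V L (waveOp V L k (sqrtAbsOp V L (eps L j k))))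

/-- The T-matrix in terms of the wave operator. -/
def waveT (V : ℝ → ℝ) (L : ℝ) (k : ℂ) : Matrix (Fin 2) (Fin 2) ℂ :=
  Matrix.of fun l j => 1 / (2 * Complex.I * k) * inner ℂ (eps L l (conj k)) (scatSource V L k j)

/-- The Lippmann-Schwinger equation: `θ = Ω √|V| ε_j` satisfies `θ = √|V| (ε_j + R f)` with `f =
√|V| J θ`; multiplying by `√|V| J` gives `f = V (ε_j + R f)`. -/
theorem scatSource_coeFn (hVb : MemLp V ∞ volume) (hk : 0 ≤ k.im)
    (hΩ : IsUnit (1 - freeBS V L k)) (j : Fin 2) :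
    scatSource V L k j =ᵐ[boxMeasure L] fun x => V x * (planeWave j k x +
      freeSol k ((Set.Icc (-L) L).indicator (scatSource V L k j)) x) := by
  set f := scatSource V L k j with hf
  set θ := waveOp V L k (sqrtAbsOp V L (eps L j k)) with hθ
  have h1 : θ = sqrtAbsOp V L (eps L j k + freeBoxResolvent L k f) := by
    have h2 : ((1 - freeBS V L k) * waveOp V L k) (sqrtAbsOp V L (eps L j k)) =
        sqrtAbsOp V L (eps L j k) := by
      rw [waveOp, Ring.mul_inverse_cancel _ hΩ, one_apply_eq_self]
    rw [mul_apply_eq_comp, ← hθ, sub_apply, one_apply_eq_self, sub_eq_iff_eq_add] at h2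
    rw [map_add]
    exact h2
  have h2 : f =
      sqrtAbsOp V L (signOp V L (sqrtAbsOp V L (eps L j k + freeBoxResolvent L k f))) := by
    rw [← h1]
    rfl
  have h3 := sqrtAbs_sign_sqrtAbs_coeFn hVb L (eps L j k + freeBoxResolvent L k f)
  rw [← h2] at h3
  filter_upwards [h3, Lp.coeFn_add (eps L j k) (freeBoxResolvent L k f), eps_coeFn L j k,
    freeBoxResolvent_coeFn hk L f] with x h3 h4 h5 h6
  rw [h3, h4, Pi.add_apply, h5, h6]

theorem freeSol_scatSource_right {x : ℝ} (hk0 : k ≠ 0) (hx : L ≤ x) (j : Fin 2) :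
    freeSol k ((Set.Icc (-L) L).indicator (scatSource V L k j)) x =
      waveT V L k 0 j * planeWave 0 k x ∧
    freeSolDeriv k ((Set.Icc (-L) L).indicator (scatSource V L k j)) x =
      Complex.I * k * (waveT V L k 0 j * planeWave 0 k x) := by
  rw [(freeSol_of_ge hx).1, (freeSol_of_ge hx).2, waveT, Matrix.of_apply, inner_eps_zero]
  refine ⟨rfl, ?_⟩
  field_simp

theorem freeSol_scatSource_left {x : ℝ} (hk0 : k ≠ 0) (hx : x ≤ -L) (j : Fin 2) :
    freeSol k ((Set.Icc (-L) L).indicator (scatSource V L k j)) x =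
      waveT V L k 1 j * planeWave 1 k x ∧
    freeSolDeriv k ((Set.Icc (-L) L).indicator (scatSource V L k j)) x =
      -(Complex.I * k * (waveT V L k 1 j * planeWave 1 k x)) := by
  rw [(freeSol_of_le hx).1, (freeSol_of_le hx).2, waveT, Matrix.of_apply, inner_eps_one]
  refine ⟨rfl, ?_⟩
  field_simp

/-- Outside the box the field generated by the source is a pure outgoing wave with amplitudes from
`waveT`, so incoming wave plus field has the required form. -/
theorem isScatteringMatrix_waveT (hVb : MemLp V ∞ volume) (hk0 : k ≠ 0)
    (hk : 0 ≤ k.im) (hΩ : IsUnit (1 - freeBS V L k)) :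
    IsScatteringMatrix V L k (1 + waveT V L k) := by
  have h0 := isTruncatedSolution_of_box (V := V) (L := L) hk0 1 0 (f := scatSource V L k 0) (by
    simpa using scatSource_coeFn hVb hk hΩ 0)
  have h1 := isTruncatedSolution_of_box (V := V) (L := L) hk0 0 1 (f := scatSource V L k 1) (by
    simpa using scatSource_coeFn hVb hk hΩ 1)
  -- Both transmission coefficients agree because the Wronskian of the two scattering solutions has
  -- the same value at `-L` and at `L`.
  have ht : waveT V L k 0 0 = waveT V L k 1 1 := by
    have hW := (h0.wronskian Set.ordConnected_univ h1 (-L) trivial L trivial).2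
    rw [intervalIntegral.integral_congr (g := fun _ => 0) (fun x _ => by beta_reduce; ring),
      intervalIntegral.integral_zero] at hW
    beta_reduce at hW
    rw [(freeSol_scatSource_right hk0 le_rfl 0).1, (freeSol_scatSource_right hk0 le_rfl 0).2,
      (freeSol_scatSource_right hk0 le_rfl 1).1, (freeSol_scatSource_right hk0 le_rfl 1).2,
      (freeSol_scatSource_left hk0 le_rfl 0).1, (freeSol_scatSource_left hk0 le_rfl 0).2,
      (freeSol_scatSource_left hk0 le_rfl 1).1, (freeSol_scatSource_left hk0 le_rfl 1).2] at hW
    have p1 := planeWave_mul_planeWave k L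
    have p2 := planeWave_mul_planeWave k (-L)
    have hk2 : 2 * Complex.I * k ≠ 0 := by simp [hk0]
    refine mul_left_cancel₀ hk2 ?_
    linear_combination (-hW) + (-2 * Complex.I * k * (1 + waveT V L k 0 0)) * p1 +
      (2 * Complex.I * k * (1 + waveT V L k 1 1)) * p2
  refine ⟨1 + waveT V L k 1 1, waveT V L k 0 1, waveT V L k 1 0, ?_, ⟨_, ⟨_, h1⟩, ?_, ?_⟩,
    ⟨_, ⟨_, h0⟩, ?_, ?_⟩⟩
  · ext i j
    fin_cases i <;> fin_cases j <;> simp [ht]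
  · intro x hx
    rw [(freeSol_scatSource_left hk0 hx 1).1]
    ring
  · intro x hx
    rw [(freeSol_scatSource_right hk0 hx 1).1]
    ring
  · intro x hx
    rw [(freeSol_scatSource_left hk0 hx 0).1]
    ring
  · intro x hx
    rw [(freeSol_scatSource_right hk0 hx 0).1, ht]
    ring

theorem existsUnique_isScatteringMatrix (hVb : MemLp V ∞ volume) (hL : 0 < L) (hk0 : k ≠ 0)
    (hk : 0 ≤ k.im) (hΩ : IsUnit (1 - freeBS V L k)) : ∃! S, IsScatteringMatrix V L k S :=
  ⟨_, isScatteringMatrix_waveT hVb hk0 hk hΩ, fun _ h =>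
    h.unique hVb hL hk0 hk hΩ (isScatteringMatrix_waveT hVb hk0 hk hΩ)⟩

theorem tMat_eq (hVb : MemLp V ∞ volume) (hL : 0 < L) (hk0 : k ≠ 0) (hk : 0 ≤ k.im)
    (hΩ : IsUnit (1 - freeBS V L k)) : tMat V L k = waveT V L k := by
  have h := isScatteringMatrix_waveT hVb hk0 hk hΩ
  have hex : ∃ S, IsScatteringMatrix V L k S := ⟨_, h⟩
  rw [tMat, sMat, dif_pos hex, hex.choose_spec.unique hVb hL hk0 hk hΩ h, add_sub_cancel_left]

end Scattering

/-! ### Determinants of finite rank perturbations of the identity -/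

section FiniteRank

variable {H : Type} [NormedAddCommGroup H] [InnerProductSpace ℂ H]

theorem isFredholmDet_one : IsFredholmDet (1 : H →L[ℂ] H) 1 := by
  refine ⟨⟨0, 0, by simp, fun x => by simp⟩,
    fun ι b => ?_⟩
  refine tendsto_const_nhds.congr fun F => ?_
  classical
  refine (Eq.trans (congrArg Matrix.det ?_) Matrix.det_one).symm
  ext i j
  rw [Matrix.of_apply, one_apply_eq_self, orthonormal_iff_ite.1 b.orthonormal, Matrix.one_apply]
  simp only [Subtype.ext_iff]

variable [CompleteSpace H]

/-- Both numbers are the Fredholm determinant of the same operator. -/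
theorem det_eq_of_finiteRankOp_eq {σ : Type*} [Fintype σ] [DecidableEq σ] {d c d' c' : σ → H}
    (h : finiteRankOp d c = finiteRankOp d' c') :
    (1 + Matrix.of fun i j => inner ℂ (d i) (c j)).det =
      (1 + Matrix.of fun i j => inner ℂ (d' i) (c' j)).det := by
  have h1 := (isFredholmDet_one (H := H)).mul_one_add_finiteRankOp d c
  have h2 := (isFredholmDet_one (H := H)).mul_one_add_finiteRankOp d' c'
  rw [h] at h1
  have h3 := h1.unique h2
  rw [one_mul, one_mul] at h3
  convert h3

theorem mul_finiteRankOp_mul {σ : Type*} [Fintype σ] (d c : σ → H) (S T : H →L[ℂ] H) :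
    S * finiteRankOp d c * T =
      finiteRankOp (fun j => ContinuousLinearMap.adjoint T (d j)) fun j => S (c j) := by
  ext x
  simp only [mul_apply_eq_comp, finiteRankOp_apply, map_sum, map_smul,
    ContinuousLinearMap.adjoint_inner_left]

theorem adjoint_finiteRankOp {σ : Type*} [Fintype σ] (d c : σ → H) :
    ContinuousLinearMap.adjoint (finiteRankOp d c) = finiteRankOp c d := by
  symm
  rw [ContinuousLinearMap.eq_adjoint_iff]
  intro x y
  simp only [finiteRankOp_apply, sum_inner, inner_sum, inner_smul_left, inner_smul_right,
    inner_conj_symm]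
  exact Finset.sum_congr rfl fun j _ => mul_comm _ _

/-- If `W (1 + F') = J (1 + F)* J W` with finite rank operators `F`, `F'` and `W` invertible, then
`det (1 + F')` is the complex conjugate of `det (1 + F)`. -/
theorem det_eq_conj_of_intertwine {σ : Type*} [Fintype σ] [DecidableEq σ] {d c d' c' : σ → H}
    {W J : H →L[ℂ] H} (hW : IsUnit W) (hJ : J * J = 1)
    (h : W * (1 + finiteRankOp d' c') =
      J * ContinuousLinearMap.adjoint (1 + finiteRankOp d c) * J * W) :
    (1 + Matrix.of fun i j => inner ℂ (d' i) (c' j)).det =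
      conj (1 + Matrix.of fun i j => inner ℂ (d i) (c j)).det := by
  obtain ⟨U, rfl⟩ := hW
  have h1 : finiteRankOp d' c' = (U⁻¹.val * J) * finiteRankOp c d * (J * U.val) := by
    have h2 : U.val * finiteRankOp d' c' = J * finiteRankOp c d * J * U.val := by
      rw [mul_add, mul_one, map_add, adjoint_finiteRankOp,
        show ContinuousLinearMap.adjoint (1 : H →L[ℂ] H) = 1 from star_one _, mul_add, mul_one,
        add_mul, hJ, add_mul, one_mul] at h
      exact add_left_cancel h
    calc finiteRankOp d' c' = U⁻¹.val * (U.val * finiteRankOp d' c') := by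
          rw [← mul_assoc, Units.inv_mul, one_mul]
      _ = _ := by rw [h2]; simp only [mul_assoc]
  rw [mul_finiteRankOp_mul] at h1
  rw [det_eq_of_finiteRankOp_eq h1, RingHom.map_det, ← Matrix.det_transpose]
  congr 1
  -- Inside the inner products `J J` and `U U⁻¹` cancel, leaving `⟪cᵢ, dⱼ⟫`, the conjugate of the
  -- transposed entry.
  have hJJ : ∀ x, J (J x) = x := fun x => congrArg (fun S : H →L[ℂ] H => S x) hJ
  have hUU : ∀ x, U.val (U⁻¹.val x) = x := fun x =>
    congrArg (fun S : H →L[ℂ] H => S x) (Units.mul_inv U)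
  ext i j
  simp only [Matrix.transpose_apply, Matrix.add_apply, Matrix.of_apply, RingHom.mapMatrix_apply,
    Matrix.map_apply, map_add, ContinuousLinearMap.adjoint_inner_left, mul_apply_eq_comp, hUU, hJJ,
    inner_conj_symm]
  congr 1
  rw [Matrix.one_apply, Matrix.one_apply]
  by_cases hij : i = j <;> simp [hij, eq_comm]

end FiniteRank

/-! ### Factorization of the Birman-Schwinger operator -/

section Factorization

variable {V : ℝ → ℝ} {A B : Matrix (Fin 2) (Fin 2) ℂ} {L : ℝ} {k : ℂ}

theorem IsResolventAt.eq_zero_of_apply_eq_zero {H : Type} [NormedAddCommGroup H]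
    [InnerProductSpace ℂ H] {T : H →ₗ.[ℂ] H} {z : ℂ} {R : H →L[ℂ] H} (h : IsResolventAt T z R)
    {f : H} (hf : R f = 0) : f = 0 := by
  obtain ⟨hm, h1⟩ := h.1 f
  have h2 : (⟨R f, hm⟩ : T.domain) = 0 := Subtype.ext hf
  rw [h2, hf, LinearPMap.map_zero, smul_zero, sub_zero] at h1
  exact h1.symm

theorem boxBS_eq (hR : IsResolventAt (boxHamiltonian A B L) (k ^ 2)
      (freeBoxResolvent L k - dOp A B L k)) :
    boxBS V A B L (k ^ 2) =
      freeBS V L k - sqrtAbsOp V L * dOp A B L k * sqrtAbsOp V L * signOp V L := by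
  rw [boxBS, hR.unboundedResolvent_eq, freeBS, mul_sub, sub_mul, sub_mul]

/-- The factor `1 - K_∞` cancels the wave operator in the rank two term, leaving exactly the
correction `√|V| D √|V| J` of Krein's formula. -/
theorem one_sub_boxBS_eq (hR : IsResolventAt (boxHamiltonian A B L) (k ^ 2)
      (freeBoxResolvent L k - dOp A B L k)) (hΩ : IsUnit (1 - freeBS V L k)) :
    1 - boxBS V A B L (k ^ 2) = (1 - freeBS V L k) * (1 + rankTwoOp V A B L k) := by
  rw [boxBS_eq hR, rankTwoOp, waveOp, mul_add, mul_one, ← mul_assoc (1 - freeBS V L k),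
    Ring.mul_inverse_cancel _ hΩ, one_mul]
  abel

/-- The vectors `d_l` in `rankTwoOp = ∑ₗ ⟪d_l, ·⟫ c_l`. -/
def rankTwoBra (V : ℝ → ℝ) (L : ℝ) (k : ℂ) (l : Fin 2) : BoxSpace L :=
  signOp V L (sqrtAbsOp V L (eps L l (conj k)))

/-- The vectors `c_l` in `rankTwoOp = ∑ₗ ⟪d_l, ·⟫ c_l`. -/
def rankTwoKet (V : ℝ → ℝ) (A B : Matrix (Fin 2) (Fin 2) ℂ) (L : ℝ) (k : ℂ) (l : Fin 2) :
    BoxSpace L :=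
  ∑ j, (1 / (2 * Complex.I * k) * dFac L k * gMat A B L k j l) •
    waveOp V L k (sqrtAbsOp V L (eps L j k))

theorem inner_rankTwoBra (hVb : MemLp V ∞ volume) (l : Fin 2) (φ : BoxSpace L) :
    inner ℂ (rankTwoBra V L k l) φ =
      inner ℂ (eps L l (conj k)) (sqrtAbsOp V L (signOp V L φ)) := by
  rw [rankTwoBra, inner_signOp hVb, inner_sqrtAbsOp hVb]

theorem rankTwoOp_eq (hVb : MemLp V ∞ volume) :
    rankTwoOp V A B L k = finiteRankOp (rankTwoBra V L k) (rankTwoKet V A B L k) := by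
  ext1 φ
  rw [finiteRankOp_apply]
  simp only [rankTwoOp, mul_apply_eq_comp, dOp_apply, inner_rankTwoBra hVb, rankTwoKet,
    Fin.sum_univ_two, map_add, map_smul, Matrix.mulVec, dotProduct]
  module

/-- The kets carry the factor `d G`; what remains of each inner product, together with `1 / (2ik)`,
is an entry of the T-matrix. This is where scattering theory enters the determinant. -/
theorem inner_rankTwoBra_rankTwoKet (hVb : MemLp V ∞ volume) (hL : 0 < L) (hk0 : k ≠ 0)
    (hk : 0 ≤ k.im) (hΩ : IsUnit (1 - freeBS V L k)) :
    (Matrix.of fun i j => inner ℂ (rankTwoBra V L k i) (rankTwoKet V A B L k j)) =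
      dTG V A B L k := by
  ext i j
  rw [dTG, tMat_eq hVb hL hk0 hk hΩ, Matrix.smul_apply, Matrix.mul_apply, Matrix.of_apply,
    rankTwoKet, inner_sum, smul_eq_mul, Finset.mul_sum]
  refine Finset.sum_congr rfl fun l _ => ?_
  rw [inner_smul_right, inner_rankTwoBra hVb, waveT, Matrix.of_apply, scatSource]
  ring

/-- Pairing with `J φ` instead of `φ` makes the two outer factors symmetric and exposes the
quadratic form of `R`. -/
theorem inner_signOp_sandwich (hVb : MemLp V ∞ volume) (R : BoxSpace L →L[ℂ] BoxSpace L)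
    (φ : BoxSpace L) :
    inner ℂ (signOp V L φ) ((sqrtAbsOp V L * R * sqrtAbsOp V L * signOp V L) φ) =
      inner ℂ (sqrtAbsOp V L (signOp V L φ)) (R (sqrtAbsOp V L (signOp V L φ))) := by
  rw [inner_sqrtAbsOp hVb]
  rfl

/-- `1 + F / s` is injective for `s ≥ 1`, where `F` is the rank two operator. -/
theorem eq_zero_of_rankTwoOp_apply (hVb : MemLp V ∞ volume) (hAB : A * Bᴴ = B * Aᴴ)
    (hrank : (Matrix.fromCols A B).rank = 2) (hL : 0 < L) (hk0 : k ≠ 0) (hk : 0 ≤ k.im)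
    (hz : (k ^ 2).im ≠ 0)
    (hR : IsResolventAt (boxHamiltonian A B L) (k ^ 2) (freeBoxResolvent L k - dOp A B L k))
    (hΩ : IsUnit (1 - freeBS V L k)) {x : ℝ} (hx : x ≤ -1) {φ : BoxSpace L}
    (hφ : rankTwoOp V A B L k φ = (x : ℂ) • φ) : φ = 0 := by
  set R := freeBoxResolvent L k - dOp A B L k with hRdef
  have hbox : boxBS V A B L (k ^ 2) = sqrtAbsOp V L * R * sqrtAbsOp V L * signOp V L := by
    rw [boxBS, hR.unboundedResolvent_eq]
  -- The operator factorization applied to the eigenvector.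
  have h1 : (x : ℂ) • φ = (1 + x : ℂ) • freeBS V L k φ - boxBS V A B L (k ^ 2) φ := by
    have h := congrArg (fun S : BoxSpace L →L[ℂ] BoxSpace L => S φ) (one_sub_boxBS_eq hR hΩ)
    simp only [mul_apply_eq_comp, add_apply, sub_apply, one_apply_eq_self, hφ, map_add,
      map_smul] at h
    have h' : (x : ℂ) • φ = φ - boxBS V A B L (k ^ 2) φ - (φ - freeBS V L k φ) +
        (x : ℂ) • freeBS V L k φ := by
      rw [h]
      module
    rw [h']
    module
  set ψ := sqrtAbsOp V L (signOp V L φ) with hψ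
  -- After pairing with `J φ` the left side is `x ⟪J φ, φ⟫`, which is real.
  have h2 := congrArg (fun v => (inner ℂ (signOp V L φ) v : ℂ).im) h1
  simp only [inner_sub_right, inner_smul_right, hbox, freeBS, inner_signOp_sandwich hVb,
    ← hψ, Complex.sub_im] at h2
  have h3 : ((1 : ℂ) + x) = ((1 + x : ℝ) : ℂ) := by push_cast; rfl
  rw [h3, Complex.im_ofReal_mul, Complex.im_ofReal_mul, im_inner_signOp hVb, mul_zero,
    im_inner_boxResolvent hAB hrank hL hR, im_inner_freeBoxResolvent hL hk0 hk] at h2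
  set a := ‖freeSol k ((Set.Icc (-L) L).indicator ψ) L‖ ^ 2 +
        ‖freeSol k ((Set.Icc (-L) L).indicator ψ) (-L)‖ ^ 2
  have ha : 0 ≤ a := by positivity
  have hs : 0 ≤ -(1 + x) := by linarith
  have hb : 0 ≤ -(1 + x) * ‖freeBoxResolvent L k ψ‖ ^ 2 + ‖R ψ‖ ^ 2 := by positivity
  -- Because `1 + x ≤ 0`, both resolvent terms have the same sign; they are combined into one square
  -- so that the sign argument applies.
  have h4 := norm_eq_zero_of_energy (mul_nonneg hs ha) hk hz
    (b := Real.sqrt (-(1 + x) * ‖freeBoxResolvent L k ψ‖ ^ 2 + ‖R ψ‖ ^ 2))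
    (by rw [Real.sq_sqrt hb]; linarith)
  rw [Real.sqrt_eq_zero hb] at h4
  have h5 : R ψ = 0 := by
    have h6 : 0 ≤ -(1 + x) * ‖freeBoxResolvent L k ψ‖ ^ 2 := by positivity
    have h7 : ‖R ψ‖ ^ 2 = 0 := by nlinarith [sq_nonneg ‖R ψ‖]
    exact norm_eq_zero.1 (pow_eq_zero_iff two_ne_zero |>.1 h7)
  have h6 : ψ = 0 := hR.eq_zero_of_apply_eq_zero h5
  have h7 : (x : ℂ) • φ = 0 := by
    rw [h1, freeBS_apply, hbox]
    simp only [mul_apply_eq_comp, ← hψ, h6, map_zero, smul_zero, sub_zero]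
  exact (smul_eq_zero.1 h7).resolve_left (by norm_cast; linarith)

/-! ### Complex conjugation -/

/-- The adjoint moves `J` from the right end to the left, and conjugation by the involution `J`
moves it back. -/
theorem conj_sandwich (hVb : MemLp V ∞ volume) (R : BoxSpace L →L[ℂ] BoxSpace L) :
    signOp V L * ContinuousLinearMap.adjoint
      (1 - sqrtAbsOp V L * R * sqrtAbsOp V L * signOp V L) * signOp V L =
    1 - sqrtAbsOp V L * ContinuousLinearMap.adjoint R * sqrtAbsOp V L * signOp V L := by
  have h1 : ContinuousLinearMap.adjoint (1 - sqrtAbsOp V L * R * sqrtAbsOp V L * signOp V L) =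
      1 - signOp V L * (sqrtAbsOp V L * ContinuousLinearMap.adjoint R * sqrtAbsOp V L) := by
    have hs := adjoint_sqrtAbsOp hVb L
    have hJ := adjoint_signOp hVb L
    rw [← ContinuousLinearMap.star_eq_adjoint] at hs hJ ⊢
    rw [star_sub, star_one, star_mul, star_mul, star_mul, hs, hJ,
      ContinuousLinearMap.star_eq_adjoint, mul_assoc (sqrtAbsOp V L)]
  rw [h1, mul_sub, sub_mul, mul_one, ← mul_assoc (signOp V L) (signOp V L), signOp_mul_signOp hVb,
    one_mul]

theorem one_sub_freeBS_conj (hVb : MemLp V ∞ volume) (hk : 0 ≤ k.im) :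
    1 - freeBS V L (-conj k) =
      signOp V L * ContinuousLinearMap.adjoint (1 - freeBS V L k) * signOp V L := by
  rw [freeBS, freeBS, conj_sandwich hVb, adjoint_freeBoxResolvent hk]

theorem one_sub_boxBS_conj (hVb : MemLp V ∞ volume) (hAB : A * Bᴴ = B * Aᴴ)
    (hrank : (Matrix.fromCols A B).rank = 2) (hL : 0 < L) {z : ℂ}
    (hz : z ∉ unboundedSpectrum (boxHamiltonian A B L))
    (hz' : conj z ∉ unboundedSpectrum (boxHamiltonian A B L)) :
    1 - boxBS V A B L (conj z) =
      signOp V L * ContinuousLinearMap.adjoint (1 - boxBS V A B L z) * signOp V L := by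
  simp only [unboundedSpectrum, Set.mem_ofPred_eq, not_not] at hz hz'
  obtain ⟨R, hR⟩ := hz
  obtain ⟨R', hR'⟩ := hz'
  rw [boxBS, boxBS, hR.unboundedResolvent_eq, hR'.unboundedResolvent_eq, conj_sandwich hVb,
    adjoint_boxResolvent hAB hrank hL hR hR']

theorem isUnit_one_sub_freeBS_conj (hVb : MemLp V ∞ volume) (hk : 0 ≤ k.im)
    (hΩ : IsUnit (1 - freeBS V L k)) : IsUnit (1 - freeBS V L (-conj k)) := by
  have hJ : IsUnit (signOp V L) :=
    ⟨⟨_, _, signOp_mul_signOp hVb L, signOp_mul_signOp hVb L⟩, rfl⟩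
  rw [one_sub_freeBS_conj hVb hk, ← ContinuousLinearMap.star_eq_adjoint]
  exact (hJ.mul hΩ.star).mul hJ

end Factorization

/-- The matrix `1 + d T G` in terms of the scattering matrix. -/
theorem one_add_dTG {V : ℝ → ℝ} {A B : Matrix (Fin 2) (Fin 2) ℂ} {L : ℝ} {k : ℂ}
    (hG : IsUnit (dFac L k • (1 : Matrix (Fin 2) (Fin 2) ℂ) + bcMatrix A B k * sigmaX)) :
    1 + dTG V A B L k = (dFac L k • sMat V L k + bcMatrix A B k * sigmaX) *
      (dFac L k • (1 : Matrix (Fin 2) (Fin 2) ℂ) + bcMatrix A B k * sigmaX)⁻¹ := by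
  have h1 : dFac L k • sMat V L k + bcMatrix A B k * sigmaX =
      (dFac L k • (1 : Matrix (Fin 2) (Fin 2) ℂ) + bcMatrix A B k * sigmaX) +
        dFac L k • tMat V L k := by
    rw [tMat, smul_sub]
    abel
  rw [h1, add_mul, Matrix.mul_nonsing_inv _ ((Matrix.isUnit_iff_isUnit_det _).1 hG), dTG, gMat,
    Matrix.smul_mul]

end FermiGas

end

/-! ### Assembly of the theorem. -/

theorem mainTheorem4 (V : ℝ → ℝ) (hV : Integrable V volume) (hVb : MemLp V ∞ volume)
    (A B : Matrix (Fin 2) (Fin 2) ℂ) (hAB : A * Bᴴ = B * Aᴴ)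
    (hrank : (Matrix.fromCols A B).rank = 2)
    (L : ℝ) (hL : 0 < L)
    (z k : ℂ) (hk : k ^ 2 = z) (hkim : 0 ≤ k.im) (hz0 : z ≠ 0)
    -- the following are only required at points where they are not automatic:
    -- the existence of `R_L(z)`, `Ω_{∞,L}(z)` and `U(z)`, respectively
    (hz : z.im = 0 → z ∉ unboundedSpectrum (boxHamiltonian A B L))
    (hΩ : z.im = 0 → -(1 / 4) * (∫ x, |V x|) ^ 2 ≤ z.re → z.re ≤ 0 → IsUnit (1 - freeBS V L k))
    (hU : k.re = 0 → IsUnit (Complex.I • A - k • B)) :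
    -- all objects are well-defined
    (z ∉ unboundedSpectrum (boxHamiltonian A B L) ∧
      IsUnit (1 - freeBS V L k) ∧ IsUnit (Complex.I • A - k • B) ∧
      IsUnit (dFac L k • (1 : Matrix (Fin 2) (Fin 2) ℂ) + bcMatrix A B k * sigmaX) ∧
      ∃! S, IsScatteringMatrix V L k S) ∧
    -- factorization of the operator, spectrum of the rank two operator
    (1 - boxBS V A B L z = (1 - freeBS V L k) * (1 + rankTwoOp V A B L k) ∧
      (z.im ≠ 0 → ∀ x : ℝ, x ≤ -1 → (x : ℂ) ∉ spectrum ℂ (rankTwoOp V A B L k))) ∧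
    -- factorization of the determinant, complex conjugation, eigenvalues of the matrix
    ((∃ Δ ΔInf : ℂ, IsFredholmDet (1 - boxBS V A B L z) Δ ∧
        IsFredholmDet (1 - freeBS V L k) ΔInf ∧
        Δ = ΔInf * (1 + dTG V A B L k).det ∧
        conj z ∉ unboundedSpectrum (boxHamiltonian A B L) ∧
        IsFredholmDet (1 - boxBS V A B L (conj z)) (conj Δ) ∧
        IsFredholmDet (1 - freeBS V L (-conj k)) (conj ΔInf) ∧
        (1 + dTG V A B L (-conj k)).det = conj (1 + dTG V A B L k).det) ∧
      (z.im ≠ 0 → ∀ x : ℝ, x ≤ -1 →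
        ¬ Module.End.HasEigenvalue (Matrix.toLin' (dTG V A B L k)) (x : ℂ))) ∧
    -- the matrix in terms of the scattering matrix
    1 + dTG V A B L k =
      (dFac L k • sMat V L k + bcMatrix A B k * sigmaX) *
        (dFac L k • (1 : Matrix (Fin 2) (Fin 2) ℂ) + bcMatrix A B k * sigmaX)⁻¹ := by
  subst hk
  have hk0 : k ≠ 0 := fun h => hz0 (by rw [h]; simp)
  have hΩ' : IsUnit (1 - freeBS V L k) := by
    by_cases h : (k ^ 2).im = 0 ∧ -(1 / 4) * (∫ x, |V x|) ^ 2 ≤ (k ^ 2).re ∧ (k ^ 2).re ≤ 0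
    · exact hΩ h.1 h.2.1 h.2.2
    · exact isUnit_one_sub_freeBS hV hVb hL hk0 hkim h
  have hU' : IsUnit (Complex.I • A - k • B) := by
    by_cases h : k.re = 0
    · exact hU h
    · exact isUnit_bc hAB hrank h
  have hG : IsUnit (dFac L k • (1 : Matrix (Fin 2) (Fin 2) ℂ) + bcMatrix A B k * sigmaX) := by
    by_cases h : (k ^ 2).im = 0
    · exact isUnit_of_notMem_spectrum hL hk0 hU' (hz h)
    · exact isUnit_of_im_ne_zero hAB hrank hL hk0 hU' h
  have hR := isResolventAt_box hL hk0 hkim hU' hG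
  have hspec : k ^ 2 ∉ unboundedSpectrum (boxHamiltonian A B L) := fun h => h ⟨_, hR⟩
  -- the same objects at the complex conjugate energy
  have hc2 : (-conj k) ^ 2 = conj (k ^ 2) := by rw [neg_sq, map_pow]
  have hck0 : -conj k ≠ 0 := by simpa using hk0
  have hckim : 0 ≤ (-conj k).im := by simpa using hkim
  have hcΩ := isUnit_one_sub_freeBS_conj hVb hkim hΩ'
  have hcU : IsUnit (Complex.I • A - (-conj k) • B) := by
    by_cases h : k.re = 0
    -- On the imaginary axis the root for `z̄` is `k` itself, so the hypothesis at `k` serves again.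
    · have : -conj k = k := Complex.ext (by simp [h]) (by simp)
      rwa [this]
    · exact isUnit_bc hAB hrank (by simpa using h)
  have hcG : IsUnit (dFac L (-conj k) • (1 : Matrix (Fin 2) (Fin 2) ℂ) +
      bcMatrix A B (-conj k) * sigmaX) := by
    by_cases h : (k ^ 2).im = 0
    · refine isUnit_of_notMem_spectrum hL hck0 hcU ?_
      rwa [hc2, Complex.conj_eq_iff_im.2 h]
    · refine isUnit_of_im_ne_zero hAB hrank hL hck0 hcU ?_
      rw [hc2, Complex.conj_im, neg_ne_zero]
      exact h
  have hcR := isResolventAt_box hL hck0 hckim hcU hcG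
  have hcspec : conj (k ^ 2) ∉ unboundedSpectrum (boxHamiltonian A B L) := by
    rw [← hc2]
    exact fun h => h ⟨_, hcR⟩
  have hfac := one_sub_boxBS_eq hR hΩ'
  have hcfac := one_sub_boxBS_eq hcR hcΩ
  have hJ := signOp_mul_signOp hVb L
  have hJ' := adjoint_signOp hVb L
  have hbox := one_sub_boxBS_conj hVb hAB hrank hL hspec hcspec
  have hfree := one_sub_freeBS_conj (L := L) hVb hkim
  have hne : ∀ x : ℝ, x ≤ -1 → (x : ℂ) ≠ 0 := fun x hx => by norm_cast; linarith
  refine ⟨⟨hspec, hΩ', hU', hG, existsUnique_isScatteringMatrix hVb hL hk0 hkim hΩ'⟩,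
    ⟨hfac, fun hz x hx hmem => ?_⟩, ⟨?_, fun hz x hx hev => ?_⟩, one_add_dTG hG⟩
  · rw [rankTwoOp_eq hVb] at hmem
    obtain ⟨φ, hφ0, hφ⟩ := exists_eigenvector_finiteRankOp_of_mem_spectrum (hne x hx) hmem
    rw [← rankTwoOp_eq hVb] at hφ
    exact hφ0 (eq_zero_of_rankTwoOp_apply hVb hAB hrank hL hk0 hkim hz hR hΩ' hx hφ)
  · have htr : IsTraceClass (1 - freeBS V L k - 1) := by
      rw [sub_sub_cancel_left]
      exact (isTraceClass_freeBS hk0 hkim).neg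
    obtain ⟨D, hD⟩ := htr.exists_isFredholmDet
    have hΔ : IsFredholmDet (1 - boxBS V A B L (k ^ 2)) (D * (1 + dTG V A B L k).det) := by
      rw [hfac, rankTwoOp_eq hVb, ← inner_rankTwoBra_rankTwoKet hVb hL hk0 hkim hΩ']
      convert hD.mul_one_add_finiteRankOp (rankTwoBra V L k) (rankTwoKet V A B L k)
    refine ⟨_, D, hΔ, hD, rfl, hcspec, ?_, ?_, ?_⟩
    · rw [hbox]
      exact hΔ.conj_adjoint hJ hJ'
    · rw [hfree]
      exact hD.conj_adjoint hJ hJ'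
    · rw [← inner_rankTwoBra_rankTwoKet hVb hL hk0 hkim hΩ',
        ← inner_rankTwoBra_rankTwoKet hVb hL hck0 hckim hcΩ]
      -- With `F`, `F'` the rank two operators at `k`, `-conj k` and `W = 1 - K_∞(z̄)`, the
      -- factorizations at `z` and `z̄` give `W (1 + F') = J (1 + F)* (1 - K_∞(z))* J = J (1 + F)* J
      -- W`. This avoids dividing by `det (1 - K_∞)`.
      refine det_eq_conj_of_intertwine hcΩ hJ ?_
      rw [← rankTwoOp_eq hVb, ← rankTwoOp_eq hVb, ← hcfac, hc2, hbox, hfac, hfree,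
        ← ContinuousLinearMap.star_eq_adjoint, ← ContinuousLinearMap.star_eq_adjoint,
        ← ContinuousLinearMap.star_eq_adjoint, star_mul]
      calc signOp V L * (star (1 + rankTwoOp V A B L k) * star (1 - freeBS V L k)) * signOp V L
          = signOp V L * star (1 + rankTwoOp V A B L k) * 1 * star (1 - freeBS V L k) *
            signOp V L := by simp only [mul_assoc, one_mul]
        _ = _ := by rw [← hJ]; simp only [mul_assoc]
  · rw [← inner_rankTwoBra_rankTwoKet hVb hL hk0 hkim hΩ'] at hev
    obtain ⟨φ, hφ0, hφ⟩ := exists_eigenvector_finiteRankOp_of_matrix (hne x hx) hev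
    rw [← rankTwoOp_eq hVb] at hφ
    exact hφ0 (eq_zero_of_rankTwoOp_apply hVb hAB hrank hL hk0 hkim hz hR hΩ' hx hφ)
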